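/- For each $n\ge 1$ let $\mathbf d=\mathbf d^{(n)}=(d_1^{(n)},\dots,d_n^{(n)})$ be a sequence of non-negative integers with even sum, and assume that, as $n\to\infty$, $$\sum_{i=1}^n d_i=\Theta(n),\qquad \sum_{i=1}^n d_i^2=O(n),\qquad \max_{1\le i\le n} d_i=o(n^{1/2}).$$ Let $G(n,\mathbf d)$ be a uniformly random simple graph on $[n]=\{1,\dots,n\}$ with degree sequence $\mathbf d$. (Under the assumptions such graphs exist for all large $n$, and only large $n$ matter.) Let $G^*(n,\mathbf d)$ be the configuration-model multigraph: give each vertex $i$ a set of $d_i$ half-edges, choose a uniformly random perfect matching $\Gamma_0$ (a *configuration*) of all the half-edges, and regard each matched pair as an edge between the corresponding vertices. Let $\hat G(n,\mathbf d)$ be the random simple graph obtained from $\Gamma_0$ by switchings, as follows. An edge of a configuration is *bad* if it is a loop or is parallel to another edge. As long as the current configuration has a bad edge, select a bad edge $xy$ ($x,y$ half-edges) by a fixed rule (any rule selecting, possibly at random, a bad edge of the current configuration), choose another edge $kl$ uniformly at random among all other edges of the configuration, with its two half-edges $k,l$ in random order, and replace the edges $xy$ and $kl$ by $xl$ and $ky$.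 When there is no bad edge left, stop; the graph then obtained is $\hat G(n,\mathbf d)$. If the process never stops, restart it with a new independent random configuration. Thus $\hat G(n,\mathbf d)$ and $G^*(n,\mathbf d)$ are defined on the same probability space. For each $n$ let $f_n$ be a real-valued function on the labelled multigraphs with vertex set $[n]$ (in particular, $f_n$ is defined on simple graphs). Suppose that $$f_n\bigl(\hat G(n,\mathbf d)\bigr)-f_n\bigl(G^*(n,\mathbf d)\bigr)\to 0\quad\text{in probability.}$$ If $Y$ is a real random variable such that $f_n(G^*(n,\mathbf d))$ converges in distribution to $Y$ as $n\to\infty$, then also $f_n(G(n,\mathbf d))$ converges in distribution to $Y$. -/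

import Mathlib

open MeasureTheory ProbabilityTheory Filter Topology Asymptotics
open scoped ENNReal

/-- A labelled multigraph (loops and multiple edges allowed) on the vertex set `V`, given by its
multiset of edges; an edge is an unordered pair of vertices, a loop is a diagonal pair. -/
abbrev Multigraph (V : Type) : Type := Multiset (Sym2 V)

/-- A labelled simple graph on `[n]`, viewed as a labelled multigraph. -/
noncomputable def simpleToMultigraph {n : ℕ} (G : SimpleGraph (Fin n)) : Multigraph (Fin n) := by
  classical
  exact G.edgeFinset.val

/-- The finite set of all simple graphs on `[n]` with degree sequence `d`. -/
noncomputable def graphsWithDegrees {n : ℕ} (d : Fin n → ℕ) : Finset (SimpleGraph (Fin n)) := by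
  classical
  exact Finset.univ.filter fun G => ∀ i, G.degree i = d i

/-- The law of the uniformly random simple graph `G(n, d)`. It is only meaningful when `d` is
graphic, i.e. when there is a simple graph with degree sequence `d`; otherwise it is set to be the
point mass at the empty graph. -/
noncomputable def uniformGraphPMF {n : ℕ} (d : Fin n → ℕ) : PMF (SimpleGraph (Fin n)) := by
  classical
  exact if h : (graphsWithDegrees d).Nonempty
    then PMF.uniformOfFinset (graphsWithDegrees d) h else PMF.pure ⊥

/-- The law of `G(n, d)`, as a measure. -/
noncomputable def uniformGraphMeasure {n : ℕ} (d : Fin n → ℕ) : Measure (SimpleGraph (Fin n)) :=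
  (uniformGraphPMF d).toMeasure

instance {n : ℕ} (d : Fin n → ℕ) : IsProbabilityMeasure (uniformGraphMeasure d) := by
  unfold uniformGraphMeasure
  infer_instance

/-- The half-edges: the vertex `i` carries `d i` of them. -/
abbrev HalfEdge {n : ℕ} (d : Fin n → ℕ) : Type := Σ i : Fin n, Fin (d i)

/-- A configuration: a perfect matching of the half-edges, given by the fixed-point free involution
which maps every half-edge to its partner. The edges are the pairs `{x, partner of x}`. -/
def Configuration {n : ℕ} (d : Fin n → ℕ) : Type :=
  {σ : Equiv.Perm (HalfEdge d) // (∀ x, σ (σ x) = x) ∧ ∀ x, σ x ≠ x}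

noncomputable instance {n : ℕ} (d : Fin n → ℕ) : Fintype (Configuration d) := by
  classical
  unfold Configuration
  infer_instance

instance {n : ℕ} (d : Fin n → ℕ) : MeasurableSpace (Configuration d) := ⊤

instance {n : ℕ} (d : Fin n → ℕ) : DiscreteMeasurableSpace (Configuration d) := ⟨fun _ => trivial⟩

namespace Configuration

variable {n : ℕ} {d : Fin n → ℕ}

/-- If the sum of the degrees is even, then there is a configuration. -/
theorem nonempty_of_even (h : Even (∑ i, d i)) : Nonempty (Configuration d) := by
  obtain ⟨k, hk⟩ := h
  have hcard : Fintype.card (HalfEdge d) = Fintype.card (Fin k × Bool) := by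
    simp [hk]; omega
  have e : HalfEdge d ≃ Fin k × Bool := Fintype.equivOfCardEq hcard
  have hinv : Function.Involutive fun x : HalfEdge d => e.symm ((e x).1, !(e x).2) := by
    intro x; simp
  refine ⟨⟨hinv.toPerm _, hinv, ?_⟩⟩
  intro x hx
  have h2 : e.symm ((e x).1, !(e x).2) = x := hx
  have h3 := congrArg Prod.snd ((Equiv.symm_apply_eq e).1 h2)
  simp at h3

/-- The partner of the half-edge `x`. -/
def partner (γ : Configuration d) (x : HalfEdge d) : HalfEdge d := γ.1 x

/-- The pair of endpoints of the edge containing the half-edge `x`. -/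
def endpoints (γ : Configuration d) (x : HalfEdge d) : Sym2 (Fin n) :=
  s(x.1, (γ.partner x).1)

/-- The edges of a configuration, as unordered pairs of half-edges. -/
noncomputable def edges (γ : Configuration d) : Finset (Sym2 (HalfEdge d)) := by
  classical
  exact Finset.univ.image fun x => s(x, γ.partner x)

/-- The multigraph to which a configuration projects. -/
noncomputable def toMultigraph (γ : Configuration d) : Multigraph (Fin n) :=
  γ.edges.val.map (Sym2.map Sigma.fst)

/-- The edge containing the half-edge `x` is bad: it is a loop, or it is parallel to another
edge. -/
def IsBad (γ : Configuration d) (x : HalfEdge d) : Prop :=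
  x.1 = (γ.partner x).1 ∨
    ∃ y, y ≠ x ∧ y ≠ γ.partner x ∧ γ.endpoints y = γ.endpoints x

/-- A configuration is simple if it has no bad edge. -/
def IsSimple (γ : Configuration d) : Prop := ∀ x, ¬ γ.IsBad x

/-- The half-edges that do not belong to the edge containing `x`. Each of the other edges consists
of two of them; choosing one of them, `k`, amounts to choosing another edge `{k, l}` together with
an ordering `(k, l)` of its two half-edges. -/
noncomputable def others (γ : Configuration d) (x : HalfEdge d) : Finset (HalfEdge d) := by
  classical
  exact Finset.univ.filter fun k => k ≠ x ∧ k ≠ γ.partner x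

/-- The switching which replaces the two edges `{x, y}` and `{k, l}` (with `y` the partner of `x`
and `l` the partner of `k`) by the edges `{x, l}` and `{k, y}`, that is, which exchanges the roles
of `y` and `l`. -/
noncomputable def switch (γ : Configuration d) (x k : HalfEdge d) : Configuration d := by
  classical
  exact ⟨Equiv.swap (γ.partner x) (γ.partner k) * γ.1 * Equiv.swap (γ.partner x) (γ.partner k), by
    intro z
    simp [Equiv.Perm.mul_apply, γ.2.1], by
    intro z hz
    refine γ.2.2 (Equiv.swap (γ.partner x) (γ.partner k) z) ?_
    rw [Equiv.Perm.mul_apply, Equiv.Perm.mul_apply, Equiv.swap_apply_eq_iff] at hz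
    exact hz⟩

end Configuration

/-- A rule for choosing the bad edge to be switched: in every configuration that is not simple it
selects a bad edge, possibly at random. The edge is given by one of its two half-edges (which of
the two is immaterial, since the half-edges of the other edge are ordered at random). -/
abbrev BadEdgeRule {n : ℕ} (d : Fin n → ℕ) : Type :=
  (γ : Configuration d) → ¬ γ.IsSimple → PMF {x : HalfEdge d // γ.IsBad x}

/-- One step of the switching process: a simple configuration is left alone; otherwise a bad edge
is selected by the rule, another edge with an ordering of its half-edges is chosen uniformly at
random, and the two are switched. (If there is no other edge, nothing happens.) -/
noncomputable def switchStep {n : ℕ} {d : Fin n → ℕ} (rule : BadEdgeRule d)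
    (γ : Configuration d) : PMF (Configuration d) := by
  classical
  exact if h : γ.IsSimple then PMF.pure γ
    else (rule γ h).bind fun x =>
      if hx : (γ.others x.1).Nonempty then
        (PMF.uniformOfFinset (γ.others x.1) hx).map fun k => γ.switch x.1 k
      else PMF.pure γ

/-- One step of the switching process, as a transition kernel. -/
noncomputable def switchKernel {n : ℕ} {d : Fin n → ℕ} (rule : BadEdgeRule d) :
    Kernel (Configuration d) (Configuration d) :=
  Kernel.ofFunOfCountable fun γ => (switchStep rule γ).toMeasure

instance {n : ℕ} {d : Fin n → ℕ} (rule : BadEdgeRule d) : IsMarkovKernel (switchKernel rule) :=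
  ⟨fun γ => inferInstanceAs (IsProbabilityMeasure (switchStep rule γ).toMeasure)⟩

/-- The uniform distribution on the configurations. -/
noncomputable def uniformConfiguration {n : ℕ} (d : Fin n → ℕ) (hd : Even (∑ i, d i)) :
    Measure (Configuration d) :=
  haveI := Configuration.nonempty_of_even hd
  (PMF.uniformOfFintype (Configuration d)).toMeasure

instance {n : ℕ} (d : Fin n → ℕ) (hd : Even (∑ i, d i)) :
    IsProbabilityMeasure (uniformConfiguration d hd) := by
  unfold uniformConfiguration
  infer_instance

/-- The law of the switching process `(Γ₀, Γ₁, …)`: the Markov chain which starts from a uniformly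
random configuration `Γ₀` and moves by switchings. -/
noncomputable def switchingChain {n : ℕ} (d : Fin n → ℕ) (hd : Even (∑ i, d i))
    (rule : BadEdgeRule d) : Measure (ℕ → Configuration d) :=
  Kernel.trajMeasure (X := fun _ => Configuration d) (uniformConfiguration d hd)
    fun k => (switchKernel rule).comap
      (fun h : (i : Finset.Iic k) → Configuration d => h ⟨k, Finset.mem_Iic.2 le_rfl⟩)
      (measurable_pi_apply _)

instance {n : ℕ} (d : Fin n → ℕ) (hd : Even (∑ i, d i)) (rule : BadEdgeRule d) :
    IsProbabilityMeasure (switchingChain d hd rule) := by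
  unfold switchingChain
  infer_instance

/-- The sample space of the construction: `ω a s` is the configuration after `s` switchings in the
attempt number `a`. -/
abbrev SwitchingSpace {n : ℕ} (d : Fin n → ℕ) : Type := ℕ → ℕ → Configuration d

/-- The law of the construction: independent copies of the switching process, the next one being
used whenever the previous ones do not terminate. -/
noncomputable def switchingMeasure {n : ℕ} (d : Fin n → ℕ) (hd : Even (∑ i, d i))
    (rule : BadEdgeRule d) : Measure (SwitchingSpace d) :=
  Measure.infinitePi fun _ : ℕ => switchingChain d hd rule

instance {n : ℕ} (d : Fin n → ℕ) (hd : Even (∑ i, d i)) (rule : BadEdgeRule d) :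
    IsProbabilityMeasure (switchingMeasure d hd rule) := by
  unfold switchingMeasure
  infer_instance

/-- The configuration-model multigraph `G*(n, d)`: the multigraph of the initial configuration. -/
noncomputable def configurationMultigraph {n : ℕ} {d : Fin n → ℕ} (ω : SwitchingSpace d) :
    Multigraph (Fin n) :=
  (ω 0 0).toMultigraph

/-- The final configuration: the first simple configuration in the first attempt that terminates.
(If no attempt terminates, which has probability zero when `d` is graphic, the initial
configuration is returned.) -/
noncomputable def finalConfiguration {n : ℕ} {d : Fin n → ℕ} (ω : SwitchingSpace d) :
    Configuration d := by
  classical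
  exact if h : ∃ a, ∃ s, (ω a s).IsSimple
    then ω (Nat.find h) (Nat.find (Nat.find_spec h)) else ω 0 0

/-- The switched configuration-model graph `Ĝ(n, d)`: the (simple) graph of the final
configuration, viewed as a multigraph. -/
noncomputable def switchedGraph {n : ℕ} {d : Fin n → ℕ} (ω : SwitchingSpace d) :
    Multigraph (Fin n) :=
  (finalConfiguration ω).toMultigraph

/-! Write N = ∑ d_i, Q = ∑ d_i (d_i - 1) (`pairCount`), Δ for the maximum degree, Z for the number
of configurations and Λ = Q/(2N) + Q²/(4N²) (`badRate`). The core is a domination, uniform over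
events (`uniformGraphMeasure_le`): for every ε and all large n, P(G ∈ 𝔸) ≤ P(Ĝ ∈ 𝔸) + ε for all sets
𝔸 of multigraphs at once. Taking for 𝔸 the preimage of a closed set F, the closeness of f(Ĝ) and
f(G*) and the portmanteau theorem give limsup P(f(G) ∈ F) ≤ P(Y ∈ F), which is convergence in
distribution.

Every simple graph with the given degrees comes from ∏ d_i! simple configurations, so P(G ∈ 𝔸) =
a/s, where s counts the simple configurations and a those among them that project into 𝔸. Two lower
bounds suffice (`comparison_bound`): s ≥ (1 - o(1)) e^{-Λ} Z and P(Ĝ ∈ 𝔸) ≥ (1 - o(1)) e^Λ (a -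
o(Z)) / Z. No upper bound on s is needed.

The first bound (`exists_card_simple_ge`) is a lopsided local lemma. A configuration is simple if it
contains none of the potential loops (at most Q/2) and potential double edges (at most Q²/4), which
have probabilities about 1/N and 1/N². Switching shows that avoiding matchings compatible with M
does not make M more likely (`card_contains_mul_le`), and Δ² = o(N) makes the dependencies
negligible.

The second bound reads the process backwards. From a simple σ perform b switchings at pairwise
disjoint sets of vertices, each creating one loop or one double edge; this is a history of the
resulting γ. These switchings commute, and each is undone by switching an edge it made. So,
whichever bad edge x the rule selects, the number of histories of length b + 1 ending in γ is at
most 4(b + 1) times the sum, over all switchings of x, of the numbers of histories of length b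
(`card_histories_succ_le`). Hence with weights 1/((4N)^b b!) the weighted number of histories of γ
with b ≤ K is at most the probability that K steps from γ end in a simple configuration of the
required kind (`sum_histories_le_hitProb`). Averaging over γ and sorting by starting points, σ
contributes ∑_b #(valid lists of length b)/((4N)^b b!).

For most simple σ there are at least 2Q + Q²/N - o(N) = 4NΛ - o(N) such switchings, with o(N) of
them touching any given vertex (`exists_card_not_hasManyCreatingMoves_le`). Then there are about
(4NΛ)^b valid lists at least, and the sum is about e^Λ at least once K is a large constant
(`HasManyCreatingMoves.sum_valid_ge`). The number of switchings is controlled by first moments of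
triangles, four-cycles and edge weights, and by the concentration of `pathCount` around Q²/N. -/

namespace Configuration

/-! ### Algebra of a single switching -/

variable {n : ℕ} {d : Fin n → ℕ}

@[simp]
theorem partner_partner (γ : Configuration d) (x : HalfEdge d) :
    γ.partner (γ.partner x) = x := γ.2.1 x

@[simp]
theorem partner_ne (γ : Configuration d) (x : HalfEdge d) : γ.partner x ≠ x := γ.2.2 x

@[simp]
theorem ne_partner (γ : Configuration d) (x : HalfEdge d) : x ≠ γ.partner x :=
  (γ.partner_ne x).symm

theorem partner_injective (γ : Configuration d) : Function.Injective γ.partner :=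
  γ.1.injective

@[simp]
theorem partner_inj (γ : Configuration d) {x y : HalfEdge d} :
    γ.partner x = γ.partner y ↔ x = y := γ.partner_injective.eq_iff

theorem partner_eq_iff (γ : Configuration d) {x y : HalfEdge d} :
    γ.partner x = y ↔ x = γ.partner y := by
  constructor
  · rintro rfl; simp
  · rintro rfl; simp

@[ext]
theorem ext {γ γ' : Configuration d} (h : ∀ x, γ.partner x = γ'.partner x) : γ = γ' :=
  Subtype.ext (Equiv.ext h)

theorem switch_partner (γ : Configuration d) (x k z : HalfEdge d) :
    (γ.switch x k).partner z = Equiv.swap (γ.partner x) (γ.partner k)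
      (γ.partner (Equiv.swap (γ.partner x) (γ.partner k) z)) := by
  unfold switch
  simp only [partner, Equiv.Perm.mul_apply]

theorem switch_partner_of_ne (γ : Configuration d) {x k z : HalfEdge d} (hx : z ≠ x) (hk : z ≠ k)
    (hx' : z ≠ γ.partner x) (hk' : z ≠ γ.partner k) :
    (γ.switch x k).partner z = γ.partner z := by
  rw [switch_partner, Equiv.swap_apply_of_ne_of_ne hx' hk', Equiv.swap_apply_of_ne_of_ne] <;>
    simpa

theorem switch_partner_left (γ : Configuration d) {x k : HalfEdge d} (h : γ.partner k ≠ x) :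
    (γ.switch x k).partner x = γ.partner k := by
  rw [switch_partner, Equiv.swap_apply_of_ne_of_ne (by simp) h.symm, Equiv.swap_apply_left]

theorem switch_partner_right (γ : Configuration d) {x k : HalfEdge d} (h : γ.partner k ≠ x) :
    (γ.switch x k).partner k = γ.partner x := by
  have h' : k ≠ γ.partner x := by rintro rfl; simp at h
  rw [switch_partner, Equiv.swap_apply_of_ne_of_ne h' (by simp), Equiv.swap_apply_right]

theorem switch_partner_partner_left (γ : Configuration d) (x k : HalfEdge d)
    (h : γ.partner k ≠ x) : (γ.switch x k).partner (γ.partner x) = k := by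
  rw [partner_eq_iff, switch_partner_right _ h]

theorem switch_partner_partner_right (γ : Configuration d) (x k : HalfEdge d)
    (h : γ.partner k ≠ x) : (γ.switch x k).partner (γ.partner k) = x := by
  rw [partner_eq_iff, switch_partner_left _ h]

theorem switch_self (γ : Configuration d) (x : HalfEdge d) : γ.switch x x = γ := by
  ext z : 1
  simp [switch_partner]

/-- After the switching x and k have exchanged partners, so the same transposition is used for the
second conjugation. Thus a switching is undone by a switching, which is how the process can retrace
a history. -/
theorem switch_switch (γ : Configuration d) {x k : HalfEdge d} (h : γ.partner k ≠ x) :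
    (γ.switch x k).switch x k = γ := by
  ext z : 1
  rw [switch_partner, switch_partner_left _ h, switch_partner_right _ h, switch_partner,
    Equiv.swap_comm (γ.partner k)]
  simp

/-- Both sides rewire {x, y} and {k, l} into {x, k} and {y, l}. Hence it does not matter from which
end the bad edge is named, provided that the other edge is reversed too. -/
theorem switch_comm_partner (γ : Configuration d) (x k : HalfEdge d) (h : γ.partner k ≠ x) :
    γ.switch (γ.partner x) k = γ.switch x (γ.partner k) := by
  by_cases hk : k = x
  · subst hk
    ext z : 1
    simp [switch_partner, Equiv.swap_comm]
  have h' : k ≠ γ.partner x := by rintro rfl; simp at h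
  have h1 : γ.partner k ≠ γ.partner x := by simpa using hk
  have h2 : γ.partner (γ.partner k) ≠ x := by simpa using hk
  ext z : 1
  by_cases z1 : z = x
  · subst z1
    rw [switch_partner_left _ h2, partner_partner]
    have := γ.switch_partner_partner_left (γ.partner z) k h1
    rwa [partner_partner] at this
  by_cases z2 : z = γ.partner x
  · subst z2
    rw [switch_partner_left _ h1, switch_partner_partner_left _ _ _ h2]
  by_cases z3 : z = k
  · subst z3
    rw [switch_partner_right _ h1]
    have := γ.switch_partner_partner_right x (γ.partner z) h2
    rw [partner_partner] at this
    rw [partner_partner, this]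
  by_cases z4 : z = γ.partner k
  · subst z4
    rw [switch_partner_right _ h2, switch_partner_partner_right _ _ _ h1]
  rw [switch_partner_of_ne _ z2 z3 (by simpa) z4, switch_partner_of_ne _ z1 z4 z2 (by simpa)]

/-! ### Partial matchings in a random configuration -/

/-- The configuration contains the edges of the partial matching `M`. -/
def Contains (γ : Configuration d) (M : List (HalfEdge d × HalfEdge d)) : Prop :=
  ∀ p ∈ M, γ.partner p.1 = p.2

/-- The half-edges covered by the partial matching `M`. -/
def support (M : List (HalfEdge d × HalfEdge d)) : List (HalfEdge d) :=
  M.flatMap fun p => [p.1, p.2]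

@[simp] theorem support_nil : support ([] : List (HalfEdge d × HalfEdge d)) = [] := rfl

@[simp] theorem support_cons (p : HalfEdge d × HalfEdge d) (M) :
    support (p :: M) = p.1 :: p.2 :: support M := rfl

theorem length_support (M : List (HalfEdge d × HalfEdge d)) :
    (support M).length = 2 * M.length := by
  induction M with
  | nil => rfl
  | cons p M ih => simp [ih]; ring

theorem Contains.partner_mem_support {γ : Configuration d} {M} (h : γ.Contains M)
    {z : HalfEdge d} (hz : z ∈ support M) : γ.partner z ∈ support M := by
  simp only [support, List.mem_flatMap, List.mem_cons, List.not_mem_nil, or_false] at hz ⊢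
  obtain ⟨p, hp, rfl | rfl⟩ := hz
  · exact ⟨p, hp, Or.inr (h p hp)⟩
  · exact ⟨p, hp, Or.inl ((γ.partner_eq_iff).2 (h p hp).symm)⟩

open Classical in
/-- If the property `P` survives all switchings of the edge `{x, y}` that avoid the half-edges in
`F`, then at most one in `∑ i, d i - 1 - #F` configurations with property `P` contains `{x, y}`. -/
theorem card_partner_eq_mul_le (P : Configuration d → Prop) (x y : HalfEdge d)
    (F : Finset (HalfEdge d)) (hy : y ∉ F)
    (hP : ∀ γ, P γ → γ.partner x = y → ∀ k, k ∉ F → k ≠ x → k ≠ y → P (γ.switch x k)) :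
    (Finset.univ.filter fun γ : Configuration d => P γ ∧ γ.partner x = y).card *
      ((∑ i, d i) - 1 - F.card) ≤ (Finset.univ.filter fun γ : Configuration d => P γ).card := by
  have hc : (Finset.univ \ insert y F).card = (∑ i, d i) - 1 - F.card := by
    rw [Finset.card_sdiff_of_subset (Finset.subset_univ _), Finset.card_insert_of_notMem hy]
    simp; omega
  rw [← hc, ← Finset.card_product]
  refine Finset.card_le_card_of_injOn (fun p => p.1.switch x p.2) ?_ ?_
  · rintro ⟨γ, k⟩ h
    simp only [Finset.coe_product, Set.mem_prod, Finset.mem_coe, Finset.mem_filter,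
      Finset.mem_univ, true_and, Finset.mem_sdiff, Finset.mem_insert, not_or] at h ⊢
    -- The value k = x is kept: it leaves γ unchanged, and it is one of the N - 1 - #F images
    -- counted.
    by_cases hk : k = x
    · subst hk; rw [switch_self]; exact h.1.1
    · exact hP γ h.1.1 h.1.2 k h.2.2 hk h.2.1
  · rintro ⟨γ, k⟩ h ⟨γ', k'⟩ h' e
    simp only [Finset.coe_product, Set.mem_prod, Finset.mem_coe, Finset.mem_filter,
      Finset.mem_univ, true_and, Finset.mem_sdiff, Finset.mem_insert, not_or] at h h' e
    have ne : γ.partner k ≠ x := by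
      rw [Ne, partner_eq_iff, h.1.2]; exact h.2.1
    have ne' : γ'.partner k' ≠ x := by
      rw [Ne, partner_eq_iff, h'.1.2]; exact h'.2.1
    -- The image determines k as the new partner of y, and then γ by switching back.
    have e1 := γ.switch_partner_partner_left x k ne
    have e2 := γ'.switch_partner_partner_left x k' ne'
    rw [h.1.2, e] at e1
    rw [h'.1.2] at e2
    obtain rfl : k = k' := e1.symm.trans e2
    have := congrArg (fun γ : Configuration d => γ.switch x k) e
    simp only [switch_switch _ ne, switch_switch _ ne'] at this
    rw [this]

/-- Two partial matchings are compatible if their union is a matching. -/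
def Compatible (M M' : List (HalfEdge d × HalfEdge d)) : Prop :=
  ∀ p ∈ M, ∀ q ∈ M', (q = p ∨ q = p.swap) ∨
    (q.1 ≠ p.1 ∧ q.1 ≠ p.2 ∧ q.2 ≠ p.1 ∧ q.2 ≠ p.2)

/-- Each of the two edges made by the switching contains x or y. So an edge of `M'` that avoids x
and y and is present afterwards was present before, while an edge of `M'` equal to {x, y} was
present anyway. -/
theorem not_contains_switch {γ : Configuration d} {x y k : HalfEdge d} (hx : γ.partner x = y)
    (hky : k ≠ y) {M' : List (HalfEdge d × HalfEdge d)}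
    (hc : ∀ q ∈ M', (q = (x, y) ∨ q = (y, x)) ∨ (q.1 ≠ x ∧ q.1 ≠ y ∧ q.2 ≠ x ∧ q.2 ≠ y))
    (hM : ¬ γ.Contains M') : ¬ (γ.switch x k).Contains M' := by
  subst hx
  have ne : γ.partner k ≠ x := by rwa [Ne, partner_eq_iff]
  refine fun h => hM fun q hq => ?_
  have h1 := h q hq
  rcases hc q hq with (rfl | rfl) | ⟨a, b, c, e⟩
  · rfl
  · simp
  · by_cases k1 : q.1 = k
    · rw [k1, switch_partner_right _ ne] at h1
      exact absurd h1.symm e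
    by_cases k2 : q.1 = γ.partner k
    · rw [k2, switch_partner_partner_right _ _ _ ne] at h1
      exact absurd h1.symm c
    rwa [switch_partner_of_ne _ a k1 b k2] at h1

theorem contains_switch {γ : Configuration d} {x y k : HalfEdge d}
    (hx : γ.partner x = y) {M : List (HalfEdge d × HalfEdge d)} (hxM : x ∉ support M)
    (hyM : y ∉ support M) (hkM : k ∉ support M) (hM : γ.Contains M) :
    (γ.switch x k).Contains M := by
  subst hx
  intro q hq
  have hq1 : q.1 ∈ support M := by
    simp only [support, List.mem_flatMap]; exact ⟨q, hq, by simp⟩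
  have hl : γ.partner k ∉ support M := fun h => hkM (by simpa using hM.partner_mem_support h)
  have h1 : q.1 ≠ x := fun h => hxM (h ▸ hq1)
  have h2 : q.1 ≠ k := fun h => hkM (h ▸ hq1)
  have h3 : q.1 ≠ γ.partner x := fun h => hyM (h ▸ hq1)
  have h4 : q.1 ≠ γ.partner k := fun h => hl (h ▸ hq1)
  rw [switch_partner_of_ne _ h1 h2 h3 h4]
  exact hM q hq

open Classical in
/-- The probability that a random configuration contains a given partial matching does not
increase when one conditions on not containing some partial matchings compatible with it. -/
theorem card_contains_mul_le (𝓜 : Finset (List (HalfEdge d × HalfEdge d)))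
    (M : List (HalfEdge d × HalfEdge d)) (hM : (support M).Nodup)
    (hc : ∀ M' ∈ 𝓜, Compatible M M') :
    (Finset.univ.filter fun γ : Configuration d => (∀ M' ∈ 𝓜, ¬ γ.Contains M') ∧
      γ.Contains M).card * ((∑ i, d i) - 2 * M.length) ^ M.length ≤
    (Finset.univ.filter fun γ : Configuration d => ∀ M' ∈ 𝓜, ¬ γ.Contains M').card := by
  -- The base N - s of the power has to stay fixed while the induction shortens `M`.
  suffices H : ∀ s : ℕ, 2 * M.length ≤ s →
      (Finset.univ.filter fun γ : Configuration d => (∀ M' ∈ 𝓜, ¬ γ.Contains M') ∧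
      γ.Contains M).card * ((∑ i, d i) - s) ^ M.length ≤
    (Finset.univ.filter fun γ : Configuration d => ∀ M' ∈ 𝓜, ¬ γ.Contains M').card from H _ le_rfl
  intro s
  induction M with
  | nil => intro _; simp [Contains]
  | cons p M ih =>
    intro hs
    simp only [support_cons, List.nodup_cons, List.mem_cons, not_or] at hM
    have h1 := card_partner_eq_mul_le
      (fun γ : Configuration d => (∀ M' ∈ 𝓜, ¬ γ.Contains M') ∧ γ.Contains M) p.1 p.2
      (support M).toFinset (by simpa using hM.2.1) (by
        intro γ hγ hx k hk hkx hky
        refine ⟨fun M' hM' => ?_, ?_⟩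
        · refine not_contains_switch hx hky ?_ (hγ.1 M' hM')
          intro q hq
          have := hc M' hM' p (by simp) q hq
          rcases this with (h | h) | h
          · exact Or.inl (Or.inl h)
          · exact Or.inl (Or.inr h)
          · exact Or.inr h
        · exact contains_switch hx hM.1.2 hM.2.1 (by simpa using hk) hγ.2)
    replace h1 : (Finset.univ.filter fun γ : Configuration d =>
        ((∀ M' ∈ 𝓜, ¬ γ.Contains M') ∧ γ.Contains M) ∧ γ.partner p.1 = p.2).card *
        ((∑ i, d i) - 1 - (support M).toFinset.card) ≤ (Finset.univ.filter fun γ :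
        Configuration d => (∀ M' ∈ 𝓜, ¬ γ.Contains M') ∧ γ.Contains M).card := by
      convert h1
    have hF : (support M).toFinset.card = 2 * M.length := by
      rw [List.toFinset_card_of_nodup hM.2.2, length_support]
    rw [hF] at h1
    have ih' := ih hM.2.2 (fun M' hM' q hq => hc M' hM' q (by simp [hq]))
      (by simp at hs; omega)
    have h2 : (Finset.univ.filter fun γ : Configuration d => (∀ M' ∈ 𝓜, ¬ γ.Contains M') ∧
        γ.Contains (p :: M)).card ≤ (Finset.univ.filter fun γ : Configuration d =>
        ((∀ M' ∈ 𝓜, ¬ γ.Contains M') ∧ γ.Contains M) ∧ γ.partner p.1 = p.2).card := by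
      refine Finset.card_le_card fun γ h => ?_
      rw [Finset.mem_filter] at h ⊢
      exact ⟨h.1, ⟨h.2.1, fun q hq => h.2.2 q (List.mem_cons_of_mem _ hq)⟩,
        h.2.2 p List.mem_cons_self⟩
    simp only [List.length_cons] at hs ⊢
    have h3 := Nat.mul_le_mul h2 (show (∑ i, d i) - s ≤ (∑ i, d i) - 1 - 2 * M.length by omega)
    have h4 := Nat.mul_le_mul_right (((∑ i, d i) - s) ^ M.length) (h3.trans h1)
    rw [pow_succ', ← mul_assoc]
    exact h4.trans ih'

open Classical in
theorem card_contains_mul_le_card (M : List (HalfEdge d × HalfEdge d)) (hM : (support M).Nodup) :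
    (Finset.univ.filter fun γ : Configuration d => γ.Contains M).card *
      ((∑ i, d i) - 2 * M.length) ^ M.length ≤ Fintype.card (Configuration d) := by
  simpa using card_contains_mul_le ∅ M hM (by simp)

end Configuration

/-! ### The lopsided local lemma -/

open Classical in
/-- The lopsided local lemma, in a form for counting. -/
theorem lopsided_local_lemma {Ω ι : Type*} [Fintype Ω] (E : ι → Ω → Prop) (I : Finset ι)
    (r : ι → ι → Prop) (p x : ι → ℝ) (hx0 : ∀ i ∈ I, 0 ≤ x i) (hx1 : ∀ i ∈ I, x i ≤ 1)
    (hE : ∀ i ∈ I, ∀ S ⊆ I, (∀ j ∈ S, ¬ r i j) →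
      ((Finset.univ.filter fun ω => (∀ j ∈ S, ¬ E j ω) ∧ E i ω).card : ℝ) ≤
        p i * (Finset.univ.filter fun ω => ∀ j ∈ S, ¬ E j ω).card)
    (hp : ∀ i ∈ I, p i ≤ x i * (1 - ∑ j ∈ I.filter (r i), x j)) :
    (∏ i ∈ I, (1 - x i)) * Fintype.card Ω ≤
      (Finset.univ.filter fun ω => ∀ j ∈ I, ¬ E j ω).card := by
  have key : ∀ m : ℕ, ∀ S ⊆ I, S.card ≤ m → ∀ i ∈ I,
      ((Finset.univ.filter fun ω => (∀ j ∈ S, ¬ E j ω) ∧ E i ω).card : ℝ) ≤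
        x i * (Finset.univ.filter fun ω => ∀ j ∈ S, ¬ E j ω).card := by
    intro m
    induction m with
    | zero =>
      intro S hS hm i hi
      obtain rfl : S = ∅ := by simpa using hm
      refine (hE i hi ∅ hS (by simp)).trans ?_
      gcongr
      refine (hp i hi).trans ?_
      have : 0 ≤ ∑ j ∈ I.filter (r i), x j :=
        Finset.sum_nonneg fun j hj => hx0 j (Finset.mem_filter.1 hj).1
      nlinarith [hx0 i hi]
    | succ m ih =>
      intro S hS hm i hi
      set S₂ := S.filter fun j => ¬ r i j with hS₂
      set S₁ := S.filter fun j => r i j with hS₁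
      have hS₂I : S₂ ⊆ I := (Finset.filter_subset _ _).trans hS
      have h2 := hE i hi S₂ hS₂I (by simp [S₂])
      set a : ℝ := ((Finset.univ.filter fun ω => ∀ j ∈ S₂, ¬ E j ω).card : ℝ) with ha
      set b : ℝ := ((Finset.univ.filter fun ω => ∀ j ∈ S, ¬ E j ω).card : ℝ) with hb
      have h1 : ((Finset.univ.filter fun ω => (∀ j ∈ S, ¬ E j ω) ∧ E i ω).card : ℝ) ≤
          ((Finset.univ.filter fun ω => (∀ j ∈ S₂, ¬ E j ω) ∧ E i ω).card : ℝ) := by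
        norm_cast
        refine Finset.card_le_card fun ω => ?_
        simp only [Finset.mem_filter, Finset.mem_univ, true_and, S₂]
        exact fun h => ⟨fun j hj => h.1 j hj.1, h.2⟩
      have hs0 : 0 ≤ ∑ j ∈ S₁, x j :=
        Finset.sum_nonneg fun j hj => hx0 j (hS (Finset.mem_filter.1 hj).1)
      have hs1 : ∑ j ∈ S₁, x j ≤ ∑ j ∈ I.filter (r i), x j :=
        Finset.sum_le_sum_of_subset_of_nonneg (Finset.filter_subset_filter _ hS)
          fun j hj _ => hx0 j (Finset.mem_filter.1 hj).1
      -- Given that no event of S₂ occurs, the related events S₁ are handled by a union bound, which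
      -- is why the hypothesis has 1 - ∑ in place of the usual product. The induction hypothesis
      -- applies to S₂ because S₁ ≠ ∅ makes it smaller than S.
      have h3 : a * (1 - ∑ j ∈ S₁, x j) ≤ b := by
        rcases S₁.eq_empty_or_nonempty with he | hne
        · have : S₂ = S := by
            rw [hS₂, Finset.filter_eq_self]
            intro j hj hr
            have : j ∈ S₁ := Finset.mem_filter.2 ⟨hj, hr⟩
            simp [he] at this
          rw [he, ha, hb, this]; simp
        have hcard : S₂.card ≤ m := by
          have := Finset.card_filter_add_card_filter_not (s := S) (fun j => r i j)
          have h0 := hne.card_pos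
          simp only [← hS₁, ← hS₂] at this
          omega
        have h4 : a ≤ b + ∑ j ∈ S₁,
            ((Finset.univ.filter fun ω => (∀ j ∈ S₂, ¬ E j ω) ∧ E j ω).card : ℝ) := by
          rw [ha, hb]
          norm_cast
          refine le_trans (Finset.card_le_card ?_) ((Finset.card_union_le _ _).trans
            (Nat.add_le_add_left Finset.card_biUnion_le _))
          intro ω
          simp only [Finset.mem_filter, Finset.mem_univ, true_and, Finset.mem_union,
            Finset.mem_biUnion]
          intro h
          by_cases hω : ∀ j ∈ S, ¬ E j ω
          · exact Or.inl hω
          · push Not at hω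
            obtain ⟨j, hj, hjE⟩ := hω
            refine Or.inr ⟨j, ?_, h, hjE⟩
            by_contra hj'
            exact h j (Finset.mem_filter.2 ⟨hj, fun hr => hj' (Finset.mem_filter.2 ⟨hj, hr⟩)⟩) hjE
        have h5 : ∑ j ∈ S₁,
            ((Finset.univ.filter fun ω => (∀ j ∈ S₂, ¬ E j ω) ∧ E j ω).card : ℝ) ≤
            ∑ j ∈ S₁, x j * a :=
          Finset.sum_le_sum fun j hj => ih S₂ hS₂I hcard j (hS (Finset.mem_filter.1 hj).1)
        rw [← Finset.sum_mul] at h5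
        linarith
      have ha0 : 0 ≤ a := by positivity
      have hxi := hx0 i hi
      calc _ ≤ p i * a := h1.trans h2
        _ ≤ (x i * (1 - ∑ j ∈ S₁, x j)) * a := by
            gcongr
            refine (hp i hi).trans ?_
            gcongr
        _ = x i * (a * (1 - ∑ j ∈ S₁, x j)) := by ring
        _ ≤ x i * b := by gcongr
  -- Chain rule: excluding one more event i keeps a proportion of at least 1 - x i.
  have : ∀ S ⊆ I, (∏ i ∈ S, (1 - x i)) * Fintype.card Ω ≤
      ((Finset.univ.filter fun ω => ∀ j ∈ S, ¬ E j ω).card : ℝ) := by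
    intro S
    induction S using Finset.induction_on with
    | empty => intro _; simp
    | insert i S hi ih =>
      intro hS
      have hiI := hS (Finset.mem_insert_self i S)
      have hSI := (Finset.subset_insert i S).trans hS
      rw [Finset.prod_insert hi, mul_assoc]
      have h1 := key S.card S hSI le_rfl i hiI
      have h2 : ((Finset.univ.filter fun ω => ∀ j ∈ S, ¬ E j ω).card : ℝ) ≤
          (Finset.univ.filter fun ω => (∀ j ∈ S, ¬ E j ω) ∧ E i ω).card +
          (Finset.univ.filter fun ω => ∀ j ∈ insert i S, ¬ E j ω).card := by
        norm_cast
        refine le_trans (Finset.card_le_card ?_) (Finset.card_union_le _ _)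
        intro ω
        simp only [Finset.mem_filter, Finset.mem_univ, true_and, Finset.mem_union,
          Finset.mem_insert, forall_eq_or_imp]
        tauto
      have h3 := mul_le_mul_of_nonneg_left (ih hSI) (sub_nonneg.2 (hx1 i hiI))
      linarith
  exact this I subset_rfl

/-! ### Switchings that create bad edges, and lists of them -/

/-- The data of a switching: the two half-edges that determine it, and a mark. -/
abbrev Move {n : ℕ} (d : Fin n → ℕ) : Type := HalfEdge d × HalfEdge d × Bool

namespace Configuration

variable {n : ℕ} {d : Fin n → ℕ}

/-- Two vertices are adjacent in the configuration. -/
def Adj (γ : Configuration d) (u v : Fin n) : Prop :=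
  ∃ z : HalfEdge d, z.1 = u ∧ (γ.partner z).1 = v

/-- The vertices involved in the switching `m`. -/
def touched (γ : Configuration d) (m : Move d) : Finset (Fin n) :=
  {m.1.1, (γ.partner m.1).1, m.2.1.1, (γ.partner m.2.1).1}

/-- The switching `m` creates a single loop or a single double edge, outside the set `F` of
vertices. A switching that creates a double edge has to have the mark `false`. -/
structure Creates (γ : Configuration d) (F : Finset (Fin n)) (m : Move d) : Prop where
  disjoint : Disjoint (γ.touched m) F
  ne₁ : m.1.1 ≠ m.2.1.1
  ne₂ : m.1.1 ≠ (γ.partner m.1).1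
  ne₃ : (γ.partner m.2.1).1 ≠ m.2.1.1
  ne₄ : (γ.partner m.2.1).1 ≠ (γ.partner m.1).1
  ne₅ : m.2.1.1 ≠ (γ.partner m.1).1
  not_adj : ¬ γ.Adj m.2.1.1 (γ.partner m.1).1
  parallel : m.1.1 = (γ.partner m.2.1).1 ∨ m.2.2 = false ∧ γ.Adj m.1.1 (γ.partner m.2.1).1

/-- The configuration obtained by performing a list of switchings, from right to left. -/
noncomputable def switchList (σ : Configuration d) : List (Move d) → Configuration d
  | [] => σ
  | m :: D => (switchList σ D).switch m.1 m.2.1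

/-- The vertices involved in a list of switchings. -/
noncomputable def used (σ : Configuration d) : List (Move d) → Finset (Fin n)
  | [] => ∅
  | m :: D => used σ D ∪ (switchList σ D).touched m

/-- The switchings in the list involve pairwise disjoint sets of vertices, and each of them creates
a loop or a double edge. -/
def Valid (σ : Configuration d) : List (Move d) → Prop
  | [] => True
  | m :: D => Valid σ D ∧ (switchList σ D).Creates (used σ D) m

theorem switch_partner_of_notMem (γ : Configuration d) (m : Move d) {z : HalfEdge d}
    (hz : z.1 ∉ γ.touched m) : (γ.switch m.1 m.2.1).partner z = γ.partner z := by
  simp only [touched, Finset.mem_insert, Finset.mem_singleton, not_or] at hz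
  obtain ⟨h1, h2, h3, h4⟩ := hz
  exact switch_partner_of_ne _ (fun h => h1 (h ▸ rfl)) (fun h => h3 (h ▸ rfl))
    (fun h => h2 (h ▸ rfl)) (fun h => h4 (h ▸ rfl))

theorem switchList_partner_of_notMem (σ : Configuration d) (D : List (Move d)) {z : HalfEdge d}
    (hz : z.1 ∉ σ.used D) : (σ.switchList D).partner z = σ.partner z := by
  induction D with
  | nil => rfl
  | cons m D ih =>
    simp only [used, Finset.mem_union, not_or] at hz
    rw [switchList, switch_partner_of_notMem _ _ hz.2, ih hz.1]

/-- All the conditions concern edges at the touched vertices, so they cannot be affected by changes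
elsewhere. -/
theorem Creates.of_partner_eq {γ γ' : Configuration d} {F F' : Finset (Fin n)} {m : Move d}
    (h : γ.Creates F m) (hF : Disjoint (γ.touched m) F')
    (hp : ∀ z : HalfEdge d, z.1 ∈ γ.touched m → γ'.partner z = γ.partner z) :
    γ'.Creates F' m := by
  have h1 : γ'.partner m.1 = γ.partner m.1 := hp _ (by simp [touched])
  have h2 : γ'.partner m.2.1 = γ.partner m.2.1 := hp _ (by simp [touched])
  have ha : ∀ u v, u ∈ γ.touched m → (γ'.Adj u v ↔ γ.Adj u v) := by
    intro u v hu
    constructor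
    · rintro ⟨z, rfl, rfl⟩
      exact ⟨z, rfl, by rw [hp z hu]⟩
    · rintro ⟨z, rfl, rfl⟩
      exact ⟨z, rfl, by rw [hp z hu]⟩
  have ht : γ'.touched m = γ.touched m := by simp [touched, h1, h2]
  refine ⟨ht ▸ hF, h.ne₁, h1 ▸ h.ne₂, h2 ▸ h.ne₃, ?_, h1 ▸ h.ne₅, ?_, ?_⟩
  · rw [h1, h2]; exact h.ne₄
  · rw [h1, ha _ _ (by simp [touched])]; exact h.not_adj
  · rw [h2, ha _ _ (by simp [touched])]; exact h.parallel

theorem creates_switchList {σ : Configuration d} {D : List (Move d)} {m : Move d}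
    (h : σ.Creates ∅ m) (hF : Disjoint (σ.touched m) (σ.used D)) :
    (σ.switchList D).Creates (σ.used D) m :=
  h.of_partner_eq hF fun _ hz =>
    switchList_partner_of_notMem _ _ (Finset.disjoint_left.1 hF hz)

theorem touched_switch {γ : Configuration d} {g h : Move d}
    (hd : Disjoint ((γ.switch h.1 h.2.1).touched g) (γ.touched h)) :
    (γ.switch h.1 h.2.1).touched g = γ.touched g := by
  have h1 : g.1.1 ∉ γ.touched h := Finset.disjoint_left.1 hd (by simp [touched])
  have h2 : g.2.1.1 ∉ γ.touched h := Finset.disjoint_left.1 hd (by simp [touched])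
  simp [touched, switch_partner_of_notMem _ _ h1, switch_partner_of_notMem _ _ h2]

/-- The two conjugating transpositions move half-edges at disjoint sets of vertices, hence commute.
-/
theorem switch_switch_comm {γ : Configuration d} {g h : Move d}
    (hd : Disjoint (γ.touched g) (γ.touched h)) :
    (γ.switch h.1 h.2.1).switch g.1 g.2.1 = (γ.switch g.1 g.2.1).switch h.1 h.2.1 := by
  have aux : ∀ {a b : HalfEdge d}, a.1 ∈ γ.touched g → b.1 ∈ γ.touched h → a ≠ b := by
    rintro a b ha hb rfl
    exact Finset.disjoint_left.1 hd ha hb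
  have e1 : (γ.switch h.1 h.2.1).partner g.1 = γ.partner g.1 :=
    switch_partner_of_notMem _ _ (Finset.disjoint_left.1 hd (by simp [touched]))
  have e2 : (γ.switch h.1 h.2.1).partner g.2.1 = γ.partner g.2.1 :=
    switch_partner_of_notMem _ _ (Finset.disjoint_left.1 hd (by simp [touched]))
  have e3 : (γ.switch g.1 g.2.1).partner h.1 = γ.partner h.1 :=
    switch_partner_of_notMem _ _ (Finset.disjoint_left.1 hd.symm (by simp [touched]))
  have e4 : (γ.switch g.1 g.2.1).partner h.2.1 = γ.partner h.2.1 :=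
    switch_partner_of_notMem _ _ (Finset.disjoint_left.1 hd.symm (by simp [touched]))
  set a := γ.partner g.1 with ha
  set b := γ.partner g.2.1 with hb
  set c := γ.partner h.1 with hc
  set e := γ.partner h.2.1 with he
  have hac : a ≠ c := aux (by simp [touched, a]) (by simp [touched, c])
  have hae : a ≠ e := aux (by simp [touched, a]) (by simp [touched, e])
  have hbc : b ≠ c := aux (by simp [touched, b]) (by simp [touched, c])
  have hbe : b ≠ e := aux (by simp [touched, b]) (by simp [touched, e])
  have comm : ∀ w, Equiv.swap a b (Equiv.swap c e w) = Equiv.swap c e (Equiv.swap a b w) := by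
    intro w
    simp only [Equiv.swap_apply_def]
    split_ifs <;> simp_all
  ext z : 1
  rw [switch_partner, e1, e2, switch_partner, switch_partner, e3, e4, switch_partner, ← ha, ← hb,
    ← hc, ← he, comm, comm]

theorem Valid.swap {σ : Configuration d} {D : List (Move d)} {g h : Move d}
    (hv : σ.Valid (g :: h :: D)) :
    σ.Valid (h :: g :: D) ∧ σ.switchList (h :: g :: D) = σ.switchList (g :: h :: D) ∧
      σ.used (h :: g :: D) = σ.used (g :: h :: D) := by
  obtain ⟨⟨hD, hh⟩, hg⟩ := hv
  simp only [switchList, used] at hg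
  simp only [Valid, switchList, used]
  set γ := σ.switchList D
  set F := σ.used D
  have hd := hg.disjoint
  rw [Finset.disjoint_union_right] at hd
  have ht := touched_switch hd.2
  have hdis : Disjoint (γ.touched g) (γ.touched h) := ht ▸ hd.2
  have ht' : (γ.switch g.1 g.2.1).touched h = γ.touched h := by
    have h1 : h.1.1 ∉ γ.touched g := Finset.disjoint_right.1 hdis (by simp [touched])
    have h2 : h.2.1.1 ∉ γ.touched g := Finset.disjoint_right.1 hdis (by simp [touched])
    simp [touched, switch_partner_of_notMem _ _ h1, switch_partner_of_notMem _ _ h2]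
  refine ⟨⟨⟨hD, ?_⟩, ?_⟩, (switch_switch_comm hdis).symm, ?_⟩
  · refine hg.of_partner_eq hd.1 fun z hz => ?_
    rw [switch_partner_of_notMem _ _ (Finset.disjoint_left.1 hd.2 hz)]
  · refine hh.of_partner_eq ?_ fun z hz => ?_
    · rw [Finset.disjoint_union_right]
      exact ⟨hh.disjoint, hdis.symm⟩
    · rw [switch_partner_of_notMem _ _ (Finset.disjoint_right.1 hdis hz)]
  · rw [ht, ht', Finset.union_assoc, Finset.union_assoc, Finset.union_comm (γ.touched g)]

/-- Adjacent exchanges suffice, by `Valid.swap`. This allows any switching of a history to be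
regarded as the last one performed, that is, as the head of the list. -/
theorem Valid.perm {σ : Configuration d} {D D' : List (Move d)} (hp : D.Perm D')
    (hv : σ.Valid D) :
    σ.Valid D' ∧ σ.switchList D' = σ.switchList D ∧ σ.used D' = σ.used D := by
  induction hp with
  | nil => exact ⟨hv, rfl, rfl⟩
  | cons m _ ih =>
    obtain ⟨h1, h2, h3⟩ := ih hv.1
    refine ⟨⟨h1, ?_⟩, ?_, ?_⟩
    · rw [h2, h3]; exact hv.2
    · rw [switchList, switchList, h2]
    · rw [used, used, h2, h3]
  | swap g h D => exact hv.swap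
  | trans _ _ ih1 ih2 =>
    obtain ⟨a, b, c⟩ := ih1 hv
    obtain ⟨a', b', c'⟩ := ih2 a
    exact ⟨a', b'.trans b, c'.trans c⟩

theorem Creates.partner_ne {γ : Configuration d} {F : Finset (Fin n)} {m : Move d}
    (h : γ.Creates F m) : γ.partner m.2.1 ≠ m.1 := by
  intro e
  rw [partner_eq_iff] at e
  exact h.ne₅ (by rw [e])

theorem Creates.partner_fst {γ : Configuration d} {F : Finset (Fin n)} {m : Move d}
    (h : γ.Creates F m) : (γ.switch m.1 m.2.1).partner m.1 = γ.partner m.2.1 :=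
  switch_partner_left _ h.partner_ne

theorem Creates.partner_snd {γ : Configuration d} {F : Finset (Fin n)} {m : Move d}
    (h : γ.Creates F m) : (γ.switch m.1 m.2.1).partner m.2.1 = γ.partner m.1 :=
  switch_partner_right _ h.partner_ne

theorem Creates.partner_partner_fst {γ : Configuration d} {F : Finset (Fin n)} {m : Move d}
    (h : γ.Creates F m) : (γ.switch m.1 m.2.1).partner (γ.partner m.1) = m.2.1 :=
  switch_partner_partner_left _ _ _ h.partner_ne

theorem Creates.partner_partner_snd {γ : Configuration d} {F : Finset (Fin n)} {m : Move d}
    (h : γ.Creates F m) : (γ.switch m.1 m.2.1).partner (γ.partner m.2.1) = m.1 :=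
  switch_partner_partner_right _ _ _ h.partner_ne

/-! ### Bad edges after a list of switchings -/

theorem endpoints_eq_iff (γ : Configuration d) (x y : HalfEdge d) :
    γ.endpoints x = γ.endpoints y ↔ (x.1 = y.1 ∧ (γ.partner x).1 = (γ.partner y).1) ∨
      (x.1 = (γ.partner y).1 ∧ (γ.partner x).1 = y.1) := by
  simp [endpoints]

theorem endpoints_congr {γ γ' : Configuration d} {x : HalfEdge d}
    (h : γ.partner x = γ'.partner x) : γ.endpoints x = γ'.endpoints x := by
  simp [endpoints, h]

theorem switch_partner_eq_or (γ : Configuration d) (m : Move d) (z : HalfEdge d) :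
    z = m.1 ∨ z = γ.partner m.2.1 ∨ (z = m.2.1 ∨ z = γ.partner m.1) ∨
      (γ.switch m.1 m.2.1).partner z = γ.partner z := by
  by_cases h1 : z = m.1
  · exact Or.inl h1
  by_cases h2 : z = γ.partner m.2.1
  · exact Or.inr (Or.inl h2)
  by_cases h3 : z = m.2.1
  · exact Or.inr (Or.inr (Or.inl (Or.inl h3)))
  by_cases h4 : z = γ.partner m.1
  · exact Or.inr (Or.inr (Or.inl (Or.inr h4)))
  exact Or.inr (Or.inr (Or.inr (switch_partner_of_ne _ h1 h3 h4 h2)))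

theorem Creates.endpoints_fst {γ : Configuration d} {F : Finset (Fin n)} {m : Move d}
    (h : γ.Creates F m) :
    (γ.switch m.1 m.2.1).endpoints m.1 = s(m.1.1, (γ.partner m.2.1).1) := by
  simp [endpoints, h.partner_fst]

theorem Creates.endpoints_partner_snd {γ : Configuration d} {F : Finset (Fin n)} {m : Move d}
    (h : γ.Creates F m) :
    (γ.switch m.1 m.2.1).endpoints (γ.partner m.2.1) = s(m.1.1, (γ.partner m.2.1).1) := by
  simp [endpoints, h.partner_partner_snd, Sym2.eq_swap]

theorem Creates.endpoints_new {γ : Configuration d} {F : Finset (Fin n)} {m : Move d}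
    (h : γ.Creates F m) {z : HalfEdge d} (hz : z = m.2.1 ∨ z = γ.partner m.1) :
    (γ.switch m.1 m.2.1).endpoints z = s(m.2.1.1, (γ.partner m.1).1) := by
  rcases hz with rfl | rfl
  · simp [endpoints, h.partner_snd]
  · simp [endpoints, h.partner_partner_fst, Sym2.eq_swap]

theorem Creates.sym2_ne {γ : Configuration d} {F : Finset (Fin n)} {m : Move d}
    (h : γ.Creates F m) : s(m.2.1.1, (γ.partner m.1).1) ≠ s(m.1.1, (γ.partner m.2.1).1) := by
  rw [Ne, Sym2.eq_iff]
  rintro (⟨a, b⟩ | ⟨a, b⟩)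
  · exact h.ne₁ a.symm
  · exact h.ne₃ a.symm

theorem Creates.endpoints_ne {γ : Configuration d} {F : Finset (Fin n)} {m : Move d}
    (h : γ.Creates F m) (z : HalfEdge d) : γ.endpoints z ≠ s(m.2.1.1, (γ.partner m.1).1) := by
  intro e
  rcases Sym2.eq_iff.1 e with ⟨a, b⟩ | ⟨a, b⟩
  · exact h.not_adj ⟨z, a, b⟩
  · exact h.not_adj ⟨γ.partner z, b, by simpa⟩

/-- The bad edges of the new configuration are parallel to the switched one or were bad before. -/
theorem Creates.bad {γ : Configuration d} {F : Finset (Fin n)} {m : Move d}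
    (h : γ.Creates F m) {z : HalfEdge d} (hz : (γ.switch m.1 m.2.1).IsBad z) :
    (γ.switch m.1 m.2.1).endpoints z = (γ.switch m.1 m.2.1).endpoints m.1 ∨
      (γ.IsBad z ∧ (γ.switch m.1 m.2.1).partner z = γ.partner z) := by
  rw [h.endpoints_fst]
  rcases γ.switch_partner_eq_or m z with e | e | e | e
  · left; rw [e, h.endpoints_fst]
  · left; rw [e, h.endpoints_partner_snd]
  -- The by-product {k, y} is never bad: it is not a loop by `ne₅`, not parallel to the other new
  -- edge by `sym2_ne`, and not parallel to an old edge by `not_adj`.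
  · have e1 := h.endpoints_new e
    rcases hz with hz | ⟨w, hw1, hw2, hw⟩
    · simp only [endpoints, ← hz] at e1
      exfalso
      rcases Sym2.eq_iff.1 e1 with ⟨a, b⟩ | ⟨a, b⟩ <;> exact h.ne₅ (by rw [← a, ← b])
    · rw [e1] at hw
      rcases γ.switch_partner_eq_or m w with f | f | f | f
      · rw [f, h.endpoints_fst] at hw; exact absurd hw.symm h.sym2_ne
      · rw [f, h.endpoints_partner_snd] at hw; exact absurd hw.symm h.sym2_ne
      · exfalso
        rcases e with rfl | rfl <;> rcases f with rfl | rfl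
        · exact hw1 rfl
        · exact hw2 h.partner_snd.symm
        · exact hw2 h.partner_partner_fst.symm
        · exact hw1 rfl
      · rw [endpoints_congr f] at hw
        exact absurd hw (h.endpoints_ne w)
  · rcases hz with hz | ⟨w, hw1, hw2, hw⟩
    · exact Or.inr ⟨Or.inl (by rw [hz, e]), e⟩
    · rcases γ.switch_partner_eq_or m w with f | f | f | f
      · left; rw [← hw, f, h.endpoints_fst]
      · left; rw [← hw, f, h.endpoints_partner_snd]
      · rw [h.endpoints_new f, endpoints_congr e] at hw
        exact absurd hw.symm (h.endpoints_ne z)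
      · right
        rw [endpoints_congr e, endpoints_congr f] at hw
        exact ⟨Or.inr ⟨w, hw1, by rwa [← e], hw⟩, e⟩

theorem Valid.mem_used {σ : Configuration d} {D : List (Move d)} (hv : σ.Valid D) {m : Move d}
    (hm : m ∈ D) :
    m.1.1 ∈ σ.used D ∧ ((σ.switchList D).partner m.1).1 ∈ σ.used D := by
  induction D with
  | nil => simp at hm
  | cons g D ih =>
    simp only [used, switchList, Finset.mem_union]
    rcases List.mem_cons.1 hm with rfl | hm
    · rw [hv.2.partner_fst]
      exact ⟨Or.inr (by simp [touched]), Or.inr (by simp [touched])⟩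
    · obtain ⟨h1, h2⟩ := ih hv.1 hm
      rw [switch_partner_of_notMem _ _ (Finset.disjoint_right.1 hv.2.disjoint h1)]
      exact ⟨Or.inl h1, Or.inl h2⟩

/-- After a valid list of switchings of a simple configuration, every bad edge is parallel to an
edge created by one of the switchings. -/
theorem Valid.exists_of_isBad {σ : Configuration d} (hσ : σ.IsSimple) {D : List (Move d)}
    (hv : σ.Valid D) {z : HalfEdge d} (hz : (σ.switchList D).IsBad z) :
    ∃ m ∈ D, (σ.switchList D).endpoints z = (σ.switchList D).endpoints m.1 := by
  induction D with
  | nil => exact absurd hz (hσ z)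
  | cons g D ih =>
    rcases hv.2.bad hz with h | ⟨h, e⟩
    · exact ⟨g, by simp, h⟩
    · obtain ⟨m, hm, h'⟩ := ih hv.1 h
      refine ⟨m, by simp [hm], ?_⟩
      have := switch_partner_of_notMem (σ.switchList D) g
        (Finset.disjoint_right.1 hv.2.disjoint (hv.1.mem_used hm).1)
      rw [switchList, endpoints_congr e, endpoints_congr this, h']

theorem Valid.mem_used_of_isBad {σ : Configuration d} (hσ : σ.IsSimple) {D : List (Move d)}
    (hv : σ.Valid D) {z : HalfEdge d} (hz : (σ.switchList D).IsBad z) : z.1 ∈ σ.used D := by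
  obtain ⟨m, hm, h⟩ := hv.exists_of_isBad hσ hz
  obtain ⟨h1, h2⟩ := hv.mem_used hm
  rcases (endpoints_eq_iff _ _ _).1 h with ⟨a, _⟩ | ⟨a, _⟩
  · rwa [a]
  · rwa [a]

/-- All bad edges lie over vertices already used, and the next switching avoids those. Thus it
creates its loop or double edge in surroundings that are still simple. -/
theorem Valid.not_isBad {σ : Configuration d} (hσ : σ.IsSimple) {m : Move d} {D : List (Move d)}
    (hv : σ.Valid (m :: D)) {z : HalfEdge d} (hz : z.1 ∈ (σ.switchList D).touched m) :
    ¬ (σ.switchList D).IsBad z :=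
  fun h => Finset.disjoint_left.1 hv.2.disjoint hz (hv.1.mem_used_of_isBad hσ h)

theorem Valid.isBad {σ : Configuration d} {m : Move d} {D : List (Move d)}
    (hv : σ.Valid (m :: D)) : (σ.switchList (m :: D)).IsBad m.1 := by
  have h := hv.2
  rw [switchList]
  rcases h.parallel with hl | ⟨-, z, hz1, hz2⟩
  · left
    rw [h.partner_fst]; exact hl
  · right
    set γ := σ.switchList D
    have a1 : z ≠ m.1 := by
      rintro rfl; exact h.ne₄ hz2.symm
    have a2 : z ≠ m.2.1 := by
      rintro rfl; exact h.ne₁ hz1.symm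
    have a3 : z ≠ γ.partner m.1 := by
      rintro rfl; exact h.ne₂ hz1.symm
    have a4 : z ≠ γ.partner m.2.1 := by
      rintro rfl
      rw [partner_partner] at hz2
      exact h.ne₃ hz2.symm
    refine ⟨z, a1, by rwa [h.partner_fst], ?_⟩
    rw [h.endpoints_fst, endpoints, switch_partner_of_ne _ a1 a2 a3 a4, hz1, hz2]

theorem Valid.not_isSimple {σ : Configuration d} {m : Move d} {D : List (Move d)}
    (hv : σ.Valid (m :: D)) : ¬ (σ.switchList (m :: D)).IsSimple := fun h => h _ hv.isBad

open Classical in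
/-- The half-edges of the loop or double edge containing `x`, with the possible marks. -/
noncomputable def choices (γ : Configuration d) (x : HalfEdge d) :
    Finset (HalfEdge d × Bool) :=
  Finset.univ.filter fun q => γ.endpoints q.1 = γ.endpoints x ∧
    (x.1 = (γ.partner x).1 ∨ q.2 = false)

theorem choices_congr {γ : Configuration d} {x y : HalfEdge d}
    (h : γ.endpoints x = γ.endpoints y) : γ.choices x = γ.choices y := by
  unfold choices
  rw [h]
  have : x.1 = (γ.partner x).1 ↔ y.1 = (γ.partner y).1 := by
    rcases (endpoints_eq_iff _ _ _).1 h with ⟨a, b⟩ | ⟨a, b⟩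
    · rw [a, b]
    · rw [a, b, eq_comm]
  simp only [this]

theorem Valid.mem_choices {σ : Configuration d} {m : Move d} {D : List (Move d)}
    (hv : σ.Valid (m :: D)) : (m.1, m.2.2) ∈ (σ.switchList (m :: D)).choices m.1 := by
  simp only [choices, Finset.mem_filter, Finset.mem_univ, true_and]
  rw [switchList, hv.2.partner_fst]
  rcases hv.2.parallel with h | h
  · exact Or.inl h
  · exact Or.inr h.1

/-- This is where the mark matters. A loop has two half-edges, a double edge has four; both marks
are allowed for a loop and only one for a double edge, so that the same constant 4 is correct for
both kinds. -/
theorem Valid.card_choices_le {σ : Configuration d} (hσ : σ.IsSimple) {m : Move d}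
    {D : List (Move d)} (hv : σ.Valid (m :: D)) :
    ((σ.switchList (m :: D)).choices m.1).card ≤ 4 := by
  classical
  have h := hv.2
  have hbad := fun z hz => hv.not_isBad hσ (z := z) hz
  rw [switchList]
  set γ := σ.switchList D with hγ
  -- A half-edge with the right endpoints that does not belong to the switched edge.
  have main : ∀ z : HalfEdge d, (γ.switch m.1 m.2.1).endpoints z = s(m.1.1, (γ.partner m.2.1).1) →
      z = m.1 ∨ z = γ.partner m.2.1 ∨ γ.endpoints z = s(m.1.1, (γ.partner m.2.1).1) := by
    intro z hz
    rcases γ.switch_partner_eq_or m z with e | e | e | e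
    · exact Or.inl e
    · exact Or.inr (Or.inl e)
    · rw [h.endpoints_new e] at hz
      exact absurd hz h.sym2_ne
    · rw [endpoints_congr e] at hz
      exact Or.inr (Or.inr hz)
  have hin : ∀ z : HalfEdge d, γ.endpoints z = s(m.1.1, (γ.partner m.2.1).1) →
      z.1 ∈ γ.touched m := by
    intro z hz
    rcases Sym2.eq_iff.1 hz with ⟨a, _⟩ | ⟨a, _⟩ <;> simp [touched, a]
  by_cases hl : m.1.1 = (γ.partner m.2.1).1
  · have : (γ.switch m.1 m.2.1).choices m.1 ⊆
        ({m.1, γ.partner m.2.1} : Finset (HalfEdge d)) ×ˢ (Finset.univ : Finset Bool) := by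
      intro q hq
      simp only [choices, Finset.mem_filter, Finset.mem_univ, true_and, h.endpoints_fst] at hq
      simp only [Finset.mem_product, Finset.mem_insert, Finset.mem_singleton, Finset.mem_univ,
        and_true]
      rcases main _ hq.1 with e | e | e
      · exact Or.inl e
      · exact Or.inr e
      · exfalso
        refine hbad _ (hin _ e) (Or.inl ?_)
        rw [← hl] at e
        rcases Sym2.eq_iff.1 e with ⟨a, b⟩ | ⟨a, b⟩ <;> rw [a, b]
    refine (Finset.card_le_card this).trans ?_
    rw [Finset.card_product]
    have := Finset.card_le_two (a := m.1) (b := γ.partner m.2.1)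
    simp only [Finset.card_univ, Fintype.card_bool]
    omega
  -- The edge z₀ was not bad before the switching, so it is the only old edge with these endpoints:
  -- two edges, four half-edges.
  · obtain ⟨-, z₀, hz1, hz2⟩ := h.parallel.resolve_left hl
    have e₀ : γ.endpoints z₀ = s(m.1.1, (γ.partner m.2.1).1) := by rw [endpoints, hz1, hz2]
    have : (γ.switch m.1 m.2.1).choices m.1 ⊆
        ({m.1, γ.partner m.2.1, z₀, γ.partner z₀} : Finset (HalfEdge d)) ×ˢ ({false}) := by
      intro q hq
      simp only [choices, Finset.mem_filter, Finset.mem_univ, true_and, h.endpoints_fst,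
        h.partner_fst, hl, false_or] at hq
      simp only [Finset.mem_product, Finset.mem_insert, Finset.mem_singleton]
      refine ⟨?_, hq.2⟩
      rcases main _ hq.1 with e | e | e
      · exact Or.inl e
      · exact Or.inr (Or.inl e)
      · right; right
        by_contra hc
        rw [not_or] at hc
        refine hbad _ (hin _ e) (Or.inr ⟨z₀, fun h => hc.1 h.symm, ?_, by rw [e, e₀]⟩)
        intro h'
        exact hc.2 (by rw [h', partner_partner])
    refine (Finset.card_le_card this).trans ?_
    rw [Finset.card_product, Finset.card_singleton, mul_one]
    exact Finset.card_le_four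

/-! ### Relabelling the half-edges at each vertex -/

/-- The action of a permutation of the half-edges on configurations. -/
def relabel (τ : Equiv.Perm (HalfEdge d)) (γ : Configuration d) : Configuration d :=
  ⟨τ * γ.1 * τ⁻¹, fun z => by simp [Equiv.Perm.mul_apply, γ.2.1], fun z hz => by
    refine γ.2.2 (τ⁻¹ z) ?_
    rw [Equiv.Perm.mul_apply, Equiv.Perm.mul_apply] at hz
    exact (Equiv.Perm.eq_inv_iff_eq).2 hz⟩

@[simp]
theorem relabel_partner (τ : Equiv.Perm (HalfEdge d)) (γ : Configuration d) (z : HalfEdge d) :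
    (γ.relabel τ).partner (τ z) = τ (γ.partner z) := by
  simp [relabel, partner, Equiv.Perm.mul_apply]

theorem relabel_injective (τ : Equiv.Perm (HalfEdge d)) :
    Function.Injective (relabel τ) := by
  intro γ γ' h
  ext z : 1
  have := congrArg (fun δ => δ.partner (τ z)) h
  simpa using this

theorem relabel_switch (τ : Equiv.Perm (HalfEdge d)) (γ : Configuration d) (x k : HalfEdge d) :
    (γ.switch x k).relabel τ = (γ.relabel τ).switch (τ x) (τ k) := by
  ext z : 1
  obtain ⟨w, rfl⟩ := τ.surjective z
  rw [relabel_partner, switch_partner, switch_partner, relabel_partner, relabel_partner]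
  rw [τ.injective.swap_apply, relabel_partner, τ.injective.swap_apply]

/-- A permutation of the half-edges acts on moves. -/
def mapMove (τ : Equiv.Perm (HalfEdge d)) (m : Move d) : Move d := (τ m.1, τ m.2.1, m.2.2)

theorem mapMove_injective (τ : Equiv.Perm (HalfEdge d)) : Function.Injective (mapMove τ) := by
  rintro ⟨x, k, t⟩ ⟨x', k', t'⟩ h
  simpa [mapMove] using h

section relabel

variable {τ : Equiv.Perm (HalfEdge d)}

theorem adj_relabel (hτ : ∀ z, (τ z).1 = z.1) (γ : Configuration d) (u v : Fin n) :
    (γ.relabel τ).Adj u v ↔ γ.Adj u v := by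
  constructor
  · rintro ⟨z, rfl, rfl⟩
    obtain ⟨w, rfl⟩ := τ.surjective z
    exact ⟨w, (hτ w).symm, by rw [relabel_partner, hτ]⟩
  · rintro ⟨z, rfl, rfl⟩
    exact ⟨τ z, hτ z, by rw [relabel_partner, hτ]⟩

theorem touched_relabel (hτ : ∀ z, (τ z).1 = z.1) (γ : Configuration d) (m : Move d) :
    (γ.relabel τ).touched (mapMove τ m) = γ.touched m := by
  simp [touched, mapMove, hτ]

theorem Creates.relabel (hτ : ∀ z, (τ z).1 = z.1) {γ : Configuration d} {F : Finset (Fin n)}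
    {m : Move d} (h : γ.Creates F m) : (γ.relabel τ).Creates F (mapMove τ m) := by
  have ht := touched_relabel hτ γ m
  obtain ⟨h0, h1, h2, h3, h4, h5, h6, h7⟩ := h
  constructor
  · rwa [ht]
  all_goals simpa [mapMove, hτ, adj_relabel hτ]

theorem switchList_relabel (σ : Configuration d) (D : List (Move d)) :
    (σ.relabel τ).switchList (D.map (mapMove τ)) = (σ.switchList D).relabel τ := by
  induction D with
  | nil => rfl
  | cons m D ih => rw [List.map_cons, switchList, switchList, ih, relabel_switch]; rfl

theorem used_relabel (hτ : ∀ z, (τ z).1 = z.1) (σ : Configuration d) (D : List (Move d)) :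
    (σ.relabel τ).used (D.map (mapMove τ)) = σ.used D := by
  induction D with
  | nil => rfl
  | cons m D ih => rw [List.map_cons, used, used, ih, switchList_relabel, touched_relabel hτ]

theorem Valid.relabel (hτ : ∀ z, (τ z).1 = z.1) {σ : Configuration d} {D : List (Move d)}
    (hv : σ.Valid D) : (σ.relabel τ).Valid (D.map (mapMove τ)) := by
  induction D with
  | nil => exact hv
  | cons m D ih =>
    refine ⟨ih hv.1, ?_⟩
    rw [switchList_relabel, used_relabel hτ]
    exact hv.2.relabel hτ

theorem endpoints_relabel (hτ : ∀ z, (τ z).1 = z.1) (γ : Configuration d) (z : HalfEdge d) :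
    (γ.relabel τ).endpoints (τ z) = γ.endpoints z := by
  simp [endpoints, hτ]

theorem IsSimple.relabel (hτ : ∀ z, (τ z).1 = z.1) {γ : Configuration d} (h : γ.IsSimple) :
    (γ.relabel τ).IsSimple := by
  intro z hz
  obtain ⟨w, rfl⟩ := τ.surjective z
  refine h w ?_
  rcases hz with hz | ⟨y, h1, h2, h3⟩
  · left; simpa [hτ] using hz
  · obtain ⟨y, rfl⟩ := τ.surjective y
    rw [endpoints_relabel hτ, endpoints_relabel hτ] at h3
    exact Or.inr ⟨y, fun h => h1 (by rw [h]), fun h => h2 (by rw [h, relabel_partner]), h3⟩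

end relabel

/-! ### Histories and their recursion -/

/-- A set of configurations is symmetric if it does not depend on the labels of the half-edges
at the vertices. -/
def Symmetric (𝒜 : Set (Configuration d)) : Prop :=
  ∀ τ : Equiv.Perm (HalfEdge d), (∀ z, (τ z).1 = z.1) → ∀ γ ∈ 𝒜, γ.relabel τ ∈ 𝒜

open Classical in
/-- The ways to obtain `γ` from a simple configuration in `𝒜` by a valid list of switchings. -/
noncomputable def histories (𝒜 : Set (Configuration d)) (b : ℕ) (γ : Configuration d) :
    Finset (Configuration d × (Fin b → Move d)) :=
  Finset.univ.filter fun p => p.1 ∈ 𝒜 ∧ p.1.IsSimple ∧ p.1.Valid (List.ofFn p.2) ∧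
    p.1.switchList (List.ofFn p.2) = γ

theorem mem_histories {𝒜 : Set (Configuration d)} {b : ℕ} {γ : Configuration d}
    {p : Configuration d × (Fin b → Move d)} : p ∈ histories 𝒜 b γ ↔
      p.1 ∈ 𝒜 ∧ p.1.IsSimple ∧ p.1.Valid (List.ofFn p.2) ∧
        p.1.switchList (List.ofFn p.2) = γ := by
  simp [histories]

/-- A history is relabelled as a whole, starting point and switchings alike; the symmetry of `𝒜`
keeps the starting point admissible. -/
theorem card_histories_le_relabel {𝒜 : Set (Configuration d)} (h𝒜 : Symmetric 𝒜)
    {τ : Equiv.Perm (HalfEdge d)} (hτ : ∀ z, (τ z).1 = z.1) (b : ℕ) (γ : Configuration d) :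
    (histories 𝒜 b γ).card ≤ (histories 𝒜 b (γ.relabel τ)).card := by
  refine Finset.card_le_card_of_injOn (fun p => (p.1.relabel τ, mapMove τ ∘ p.2)) ?_ ?_
  · rintro p hp
    rw [Finset.mem_coe, mem_histories] at hp ⊢
    obtain ⟨h1, h2, h3, h4⟩ := hp
    simp only [← List.map_ofFn]
    exact ⟨h𝒜 τ hτ _ h1, h2.relabel hτ, h3.relabel hτ, by rw [switchList_relabel, h4]⟩
  · rintro ⟨σ, D⟩ _ ⟨σ', D'⟩ _ h
    simp only [Prod.mk.injEq] at h ⊢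
    exact ⟨relabel_injective τ h.1, (mapMove_injective τ).comp_left h.2⟩

theorem mem_others {γ : Configuration d} {x k : HalfEdge d} :
    k ∈ γ.others x ↔ k ≠ x ∧ k ≠ γ.partner x := by
  simp [others]

/-- The sum over all switchings of a bad edge depends only on the endpoints of the edge. -/
theorem sum_switch_le (f : Configuration d → ℕ)
    (hf : ∀ τ : Equiv.Perm (HalfEdge d), (∀ z, (τ z).1 = z.1) → ∀ γ, f γ ≤ f (γ.relabel τ))
    (γ : Configuration d) {x z : HalfEdge d} (h : γ.endpoints z = γ.endpoints x) :
    ∑ k ∈ γ.others z, f (γ.switch z k) ≤ ∑ k ∈ γ.others x, f (γ.switch x k) := by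
  -- The two ends of an edge give the same switchings, up to reversing the other edge.
  have swap : ∀ y, ∑ k ∈ γ.others (γ.partner y), f (γ.switch (γ.partner y) k) =
      ∑ k ∈ γ.others y, f (γ.switch y k) := by
    intro y
    refine Finset.sum_nbij' γ.partner γ.partner ?_ ?_ (by simp) (by simp) ?_
    · intro k hk
      simp only [mem_others, partner_partner] at hk ⊢
      exact ⟨by rw [Ne, partner_eq_iff]; exact hk.1, by simpa using hk.2⟩
    · intro k hk
      simp only [mem_others, partner_partner] at hk ⊢
      exact ⟨by simpa using hk.1, by rw [Ne, partner_eq_iff]; exact hk.2⟩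
    · intro k hk
      rw [mem_others] at hk
      rw [switch_comm_partner _ _ _ (by rw [Ne, partner_eq_iff]; exact hk.1)]
  have main : ∀ z, z.1 = x.1 → (γ.partner z).1 = (γ.partner x).1 →
      ∑ k ∈ γ.others z, f (γ.switch z k) ≤ ∑ k ∈ γ.others x, f (γ.switch x k) := by
    intro z h1 h2
    by_cases zx : z = x
    · rw [zx]
    by_cases zy : z = γ.partner x
    · rw [zy, swap]
    have zy' : x ≠ γ.partner z := by
      rintro rfl; simp at zy
    -- This exchanges the two parallel edges. It preserves vertices and fixes γ, so it carries the
    -- switchings of z to those of x.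
    set τ : Equiv.Perm (HalfEdge d) := Equiv.swap x z * Equiv.swap (γ.partner x) (γ.partner z)
      with hτdef
    have τx : τ x = z := by
      rw [hτdef, Equiv.Perm.mul_apply, Equiv.swap_apply_of_ne_of_ne (by simp) zy',
        Equiv.swap_apply_left]
    have τz : τ z = x := by
      rw [hτdef, Equiv.Perm.mul_apply, Equiv.swap_apply_of_ne_of_ne zy (by simp),
        Equiv.swap_apply_right]
    have τx' : τ (γ.partner x) = γ.partner z := by
      rw [hτdef, Equiv.Perm.mul_apply, Equiv.swap_apply_left,
        Equiv.swap_apply_of_ne_of_ne zy'.symm (by simp)]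
    have τz' : τ (γ.partner z) = γ.partner x := by
      rw [hτdef, Equiv.Perm.mul_apply, Equiv.swap_apply_right,
        Equiv.swap_apply_of_ne_of_ne (by simp) (Ne.symm zy)]
    have τo : ∀ w, w ≠ x → w ≠ z → w ≠ γ.partner x → w ≠ γ.partner z → τ w = w := by
      intro w a b c e
      rw [hτdef, Equiv.Perm.mul_apply, Equiv.swap_apply_of_ne_of_ne c e,
        Equiv.swap_apply_of_ne_of_ne a b]
    have cases : ∀ w, w = x ∨ w = z ∨ w = γ.partner x ∨ w = γ.partner z ∨
        (w ≠ x ∧ w ≠ z ∧ w ≠ γ.partner x ∧ w ≠ γ.partner z) := by intro w; tauto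
    have hτ : ∀ w, (τ w).1 = w.1 := by
      intro w
      rcases cases w with rfl | rfl | rfl | rfl | ⟨a, b, c, e⟩
      · rw [τx, h1]
      · rw [τz, h1]
      · rw [τx', h2]
      · rw [τz', h2]
      · rw [τo w a b c e]
    have hγ : γ.relabel τ = γ := by
      ext w : 1
      obtain ⟨w, rfl⟩ := τ.surjective w
      rw [relabel_partner]
      rcases cases w with rfl | rfl | rfl | rfl | ⟨a, b, c, e⟩
      · rw [τx', τx]
      · rw [τz', τz]
      · rw [τx', partner_partner, partner_partner, τx]
      · rw [τz', partner_partner, partner_partner, τz]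
      · rw [τo w a b c e, τo _ ?_ ?_ (by simpa) (by simpa)]
        · rwa [Ne, partner_eq_iff]
        · rwa [Ne, partner_eq_iff]
    calc _ ≤ ∑ k ∈ γ.others z, f (γ.switch x (τ k)) := by
          refine Finset.sum_le_sum fun k _ => ?_
          have := hf τ hτ (γ.switch z k)
          rwa [relabel_switch, hγ, τz] at this
      _ = ∑ k ∈ γ.others x, f (γ.switch x k) := by
          refine Finset.sum_equiv τ ?_ (fun _ _ => rfl)
          intro k
          have e1 : τ k ≠ x ↔ k ≠ z := by rw [← τz, τ.injective.ne_iff]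
          have e2 : τ k ≠ γ.partner x ↔ k ≠ γ.partner z := by rw [← τz', τ.injective.ne_iff]
          rw [mem_others, mem_others, e1, e2]
  rcases (endpoints_eq_iff _ _ _).1 h with ⟨a, b⟩ | ⟨a, b⟩
  · exact main z a b
  · have := main (γ.partner z) b (by simpa using a)
    rwa [swap] at this

theorem ofFn_perm_cons {α : Type*} {b : ℕ} (D : Fin (b + 1) → α) (i : Fin (b + 1)) :
    (List.ofFn D).Perm (D i :: List.ofFn (Fin.tail (D ∘ Equiv.swap 0 i))) := by
  refine (Equiv.Perm.ofFn_comp_perm (Equiv.swap 0 i) D).symm.trans ?_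
  rw [List.ofFn_succ]
  simp only [Function.comp_apply, Equiv.swap_apply_left]
  exact List.Perm.refl _

/-- The main recursive inequality: every history ending in `γ` arises from a history ending in a
configuration obtained from `γ` by switching the bad edge `x`. -/
theorem card_histories_succ_le {𝒜 : Set (Configuration d)} (h𝒜 : Symmetric 𝒜) (b : ℕ)
    (γ : Configuration d) {x : HalfEdge d} (hx : γ.IsBad x) :
    (histories 𝒜 (b + 1) γ).card ≤
      4 * (b + 1) * ∑ k ∈ γ.others x, (histories 𝒜 b (γ.switch x k)).card := by
  classical
  rcases (histories 𝒜 (b + 1) γ).eq_empty_or_nonempty with he | ⟨p₀, hp₀⟩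
  · simp [he]
  -- The switching in a history that creates the edge `x`.
  have front : ∀ p ∈ histories 𝒜 (b + 1) γ, ∃ i : Fin (b + 1),
      p.1.Valid (p.2 i :: List.ofFn (Fin.tail (p.2 ∘ Equiv.swap 0 i))) ∧
      p.1.switchList (p.2 i :: List.ofFn (Fin.tail (p.2 ∘ Equiv.swap 0 i))) = γ ∧
      γ.endpoints x = γ.endpoints (p.2 i).1 := by
    intro p hp
    obtain ⟨h1, h2, h3, h4⟩ := mem_histories.1 hp
    rw [← h4] at hx
    obtain ⟨m, hm, h5⟩ := h3.exists_of_isBad h2 hx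
    rw [h4] at h5
    obtain ⟨i, rfl⟩ := (List.mem_ofFn' _ _).1 hm
    obtain ⟨a, a', -⟩ := h3.perm (ofFn_perm_cons p.2 i)
    exact ⟨i, a, a'.trans h4, h5⟩
  have hcard : (γ.choices x).card ≤ 4 := by
    obtain ⟨i, a, a', a''⟩ := front p₀ hp₀
    have := a.card_choices_le (mem_histories.1 hp₀).2.1
    rw [a'] at this
    rwa [choices_congr a'']
  -- A history is encoded by the position i of a switching that made an edge parallel to x, its
  -- first half-edge and its mark (one of at most 4 choices), its second half-edge k, and the
  -- remaining history. The latter ends in `γ.switch q.1 k`, because the switching at i can be moved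
  -- to the head of the list and undone.
  have hsub : histories 𝒜 (b + 1) γ ⊆ Finset.univ.biUnion fun i : Fin (b + 1) =>
      (γ.choices x).biUnion fun q => (γ.others q.1).biUnion fun k =>
        (histories 𝒜 b (γ.switch q.1 k)).image fun p =>
          (p.1, (Fin.cons (q.1, k, q.2) p.2 : Fin (b + 1) → Move d) ∘ Equiv.swap 0 i) := by
    intro p hp
    obtain ⟨i, a, a', a''⟩ := front p hp
    obtain ⟨h1, h2, -, -⟩ := mem_histories.1 hp
    simp only [Finset.mem_biUnion, Finset.mem_univ, true_and, Finset.mem_image]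
    have hne := a.2.partner_ne
    have hγ : p.1.switchList (List.ofFn (Fin.tail (p.2 ∘ Equiv.swap 0 i))) =
        γ.switch (p.2 i).1 (p.2 i).2.1 := by
      rw [← a', switchList, switch_switch _ hne]
    refine ⟨i, ((p.2 i).1, (p.2 i).2.2), ?_, (p.2 i).2.1, ?_,
      (p.1, Fin.tail (p.2 ∘ Equiv.swap 0 i)), ?_, ?_⟩
    · rw [choices_congr a'']
      have := a.mem_choices
      rwa [a'] at this
    · rw [mem_others]
      have e := a.2.partner_fst
      rw [← switchList, a'] at e
      refine ⟨fun h => a.2.ne₁ (by rw [h]), ?_⟩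
      rw [e]
      exact (partner_ne _ _).symm
    · rw [mem_histories]
      exact ⟨h1, h2, a.1, hγ⟩
    · have : (Fin.cons (p.2 i) (Fin.tail (p.2 ∘ Equiv.swap 0 i)) : Fin (b + 1) → Move d) =
          p.2 ∘ Equiv.swap 0 i := by
        conv_rhs => rw [← Fin.cons_self_tail (p.2 ∘ Equiv.swap 0 i)]
        simp
      refine Prod.ext rfl ?_
      simp only [Prod.mk.eta]
      rw [this]
      ext1 j
      simp
  -- The edge recorded by q may be the other edge of the double edge rather than the selected edge
  -- x; by symmetry this makes no difference.
  have hsum : ∀ q ∈ γ.choices x, ∑ k ∈ γ.others q.1, (histories 𝒜 b (γ.switch q.1 k)).card ≤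
      ∑ k ∈ γ.others x, (histories 𝒜 b (γ.switch x k)).card := by
    intro q hq
    refine sum_switch_le (fun γ => (histories 𝒜 b γ).card)
      (fun τ hτ γ => card_histories_le_relabel h𝒜 hτ b γ) γ ?_
    exact (Finset.mem_filter.1 hq).2.1
  calc _ ≤ ∑ i : Fin (b + 1), ∑ q ∈ γ.choices x, ∑ k ∈ γ.others q.1,
        (histories 𝒜 b (γ.switch q.1 k)).card := by
        refine (Finset.card_le_card hsub).trans (Finset.card_biUnion_le.trans ?_)
        refine Finset.sum_le_sum fun i _ => Finset.card_biUnion_le.trans ?_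
        refine Finset.sum_le_sum fun q _ => Finset.card_biUnion_le.trans ?_
        exact Finset.sum_le_sum fun k _ => Finset.card_image_le
    _ ≤ ∑ i : Fin (b + 1), ∑ q ∈ γ.choices x, ∑ k ∈ γ.others x,
        (histories 𝒜 b (γ.switch x k)).card :=
        Finset.sum_le_sum fun i _ => Finset.sum_le_sum hsum
    _ = (b + 1) * ((γ.choices x).card * ∑ k ∈ γ.others x,
        (histories 𝒜 b (γ.switch x k)).card) := by simp
    _ ≤ (b + 1) * (4 * ∑ k ∈ γ.others x, (histories 𝒜 b (γ.switch x k)).card) := by gcongr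
    _ = _ := by ring

/-! ### Counting valid lists of switchings -/

theorem card_touched_le (γ : Configuration d) (m : Move d) : (γ.touched m).card ≤ 4 :=
  Finset.card_le_four

theorem card_used_le (σ : Configuration d) (D : List (Move d)) :
    (σ.used D).card ≤ 4 * D.length := by
  induction D with
  | nil => simp [used]
  | cons m D ih =>
    have := card_touched_le (σ.switchList D) m
    have := Finset.card_union_le (σ.used D) ((σ.switchList D).touched m)
    rw [used, List.length_cons]
    omega

open Classical in
/-- If the moves in `𝒢` create bad edges and every vertex is touched by at most `M` of them, then
there are many valid lists of moves. -/
theorem pow_le_card_valid (σ : Configuration d) (𝒢 : Finset (Move d))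
    (h𝒢 : ∀ m ∈ 𝒢, σ.Creates ∅ m) (M K : ℕ)
    (hM : ∀ v, (𝒢.filter fun m => v ∈ σ.touched m).card ≤ M) {b : ℕ} (hb : b ≤ K) :
    (𝒢.card - 4 * K * M) ^ b ≤
      (Finset.univ.filter fun D : Fin b → Move d => σ.Valid (List.ofFn D)).card := by
  induction b with
  | zero => simp [Valid]
  | succ b ih =>
    set A := Finset.univ.filter fun D : Fin b → Move d => σ.Valid (List.ofFn D) with hA
    let B : (Fin b → Move d) → Finset (Move d) := fun D =>
      𝒢.filter fun m => Disjoint (σ.touched m) (σ.used (List.ofFn D))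
    -- The earlier switchings use at most 4K vertices, each of which rules out at most M switchings.
    have hB : ∀ D ∈ A, 𝒢.card - 4 * K * M ≤ (B D).card := by
      intro D hD
      have h1 : 𝒢 ⊆ B D ∪ (σ.used (List.ofFn D)).biUnion
          fun v => 𝒢.filter fun m => v ∈ σ.touched m := by
        intro m hm
        simp only [B, Finset.mem_union, Finset.mem_filter, Finset.mem_biUnion, hm, true_and,
          Finset.disjoint_left]
        by_cases h : ∃ v ∈ σ.used (List.ofFn D), v ∈ σ.touched m
        · exact Or.inr h
        · push Not at h
          exact Or.inl fun v hv hv' => h v hv' hv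
      have h2 : ((σ.used (List.ofFn D)).biUnion
          fun v => 𝒢.filter fun m => v ∈ σ.touched m).card ≤ 4 * K * M := by
        refine Finset.card_biUnion_le.trans ((Finset.sum_le_card_nsmul _ _ M fun v _ => hM v).trans ?_)
        rw [smul_eq_mul]
        have := σ.card_used_le (List.ofFn D)
        rw [List.length_ofFn] at this
        gcongr
        omega
      have h3 := (Finset.card_le_card h1).trans (Finset.card_union_le _ _)
      omega
    have h4 : (A.sigma B).card ≤ (Finset.univ.filter fun D : Fin (b + 1) → Move d =>
        σ.Valid (List.ofFn D)).card := by
      refine Finset.card_le_card_of_injOn (fun p => (Fin.cons p.2 p.1 : Fin (b + 1) → Move d)) ?_ ?_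
      · rintro ⟨D, m⟩ h
        simp only [Finset.mem_coe, Finset.mem_sigma, A, B, Finset.mem_filter, Finset.mem_univ,
          true_and] at h ⊢
        rw [List.ofFn_cons]
        exact ⟨h.1, creates_switchList (h𝒢 m h.2.1) h.2.2⟩
      · rintro ⟨D, m⟩ _ ⟨D', m'⟩ _ h
        obtain ⟨rfl, rfl⟩ := Fin.cons_injective2 h
        rfl
    refine le_trans ?_ h4
    rw [Finset.card_sigma, pow_succ]
    refine le_trans ?_ (Finset.card_nsmul_le_sum A _ _ hB)
    rw [smul_eq_mul]
    gcongr
    exact ih (by omega)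

-- Double counting: a start and a valid list determine the end, so the pairs can be sorted by
-- either.
open Classical in
theorem sum_card_histories (𝒜 : Set (Configuration d)) (b : ℕ) :
    ∑ γ, (histories 𝒜 b γ).card =
      ∑ σ : Configuration d, if σ ∈ 𝒜 ∧ σ.IsSimple then
        (Finset.univ.filter fun D : Fin b → Move d => σ.Valid (List.ofFn D)).card else 0 := by
  have h1 : ∑ γ, (histories 𝒜 b γ).card = (Finset.univ.filter
      fun p : Configuration d × (Fin b → Move d) => p.1 ∈ 𝒜 ∧ p.1.IsSimple ∧
        p.1.Valid (List.ofFn p.2)).card := by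
    rw [Finset.card_eq_sum_card_fiberwise (f := fun p => p.1.switchList (List.ofFn p.2))
      (t := Finset.univ) (by intro _ _; simp)]
    refine Finset.sum_congr rfl fun γ _ => ?_
    congr 1
    ext p
    simp only [mem_histories, Finset.mem_filter, Finset.mem_univ, true_and]
    tauto
  rw [h1, Finset.card_filter, Fintype.sum_prod_type]
  refine Finset.sum_congr rfl fun σ _ => ?_
  rw [Finset.card_filter]
  split_ifs with h
  · refine Finset.sum_congr rfl fun D _ => ?_
    simp [h.1, h.2]
  · refine Finset.sum_eq_zero fun D _ => ?_
    rw [if_neg]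
    tauto

end Configuration

/-! ### The switching process as a Markov chain -/

section Chain

variable {n : ℕ} {d : Fin n → ℕ}

theorem lintegral_toMeasure_bind {α β : Type*} [MeasurableSpace β]
    [DiscreteMeasurableSpace β] [Countable β] (p : PMF α) (q : α → PMF β) (g : β → ℝ≥0∞) :
    ∫⁻ b, g b ∂(p.bind q).toMeasure = ∑' a, p a * ∫⁻ b, g b ∂(q a).toMeasure := by
  simp only [lintegral_countable', PMF.toMeasure_apply_singleton _ _ (MeasurableSet.of_discrete),
    PMF.bind_apply, ← ENNReal.tsum_mul_left]
  rw [ENNReal.tsum_comm]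
  refine tsum_congr fun a => tsum_congr fun b => ?_
  ring

theorem lintegral_toMeasure_pure {β : Type*} [MeasurableSpace β]
    [DiscreteMeasurableSpace β] (b : β) (g : β → ℝ≥0∞) :
    ∫⁻ c, g c ∂(PMF.pure b).toMeasure = g b := by
  rw [PMF.toMeasure_pure, lintegral_dirac]

theorem lintegral_toMeasure_map_uniform {α β : Type*} [MeasurableSpace β]
    [DiscreteMeasurableSpace β] [Countable β] (s : Finset α) (hs : s.Nonempty) (h : α → β)
    (g : β → ℝ≥0∞) :
    ∫⁻ b, g b ∂((PMF.uniformOfFinset s hs).map h).toMeasure =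
      ∑ k ∈ s, (s.card : ℝ≥0∞)⁻¹ * g (h k) := by
  rw [PMF.map, lintegral_toMeasure_bind]
  simp only [Function.comp_apply, lintegral_toMeasure_pure, PMF.uniformOfFinset_apply]
  rw [tsum_eq_sum (s := s) (by intro b hb; simp [hb])]
  refine Finset.sum_congr rfl fun k hk => ?_
  simp [hk]

/-- The weight of a history of length `b`. -/
noncomputable def historyWeight (N b : ℕ) : ℝ≥0∞ := ((4 * N : ℝ≥0∞) ^ b * b.factorial)⁻¹

/-- The weights are chosen so that the factor 4(b + 1) of `card_histories_succ_le` becomes 1/N,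
which is at most the probability with which the process picks any given k. -/
theorem historyWeight_succ (N b : ℕ) :
    historyWeight N (b + 1) * (4 * (b + 1) : ℝ≥0∞) = historyWeight N b * (N : ℝ≥0∞)⁻¹ := by
  have h4 : (4 * (b + 1) : ℝ≥0∞) ≠ 0 := by positivity
  have h4' : (4 * (b + 1) : ℝ≥0∞) ≠ ⊤ := by
    finiteness
  unfold historyWeight
  have : ((4 * N : ℝ≥0∞) ^ (b + 1) * (b + 1).factorial) =
      (4 * (b + 1) : ℝ≥0∞) * (((4 * N : ℝ≥0∞) ^ b * b.factorial) * N) := by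
    rw [Nat.factorial_succ]; push_cast; ring
  rw [this, ENNReal.mul_inv (Or.inl h4) (Or.inl h4'), mul_right_comm, ENNReal.inv_mul_cancel h4 h4',
    one_mul, ENNReal.mul_inv (Or.inr (ENNReal.natCast_ne_top N)) (Or.inl ?_)]
  finiteness

open Configuration

/-- The probability that `K` steps of the switching process, started from `γ`, lead to a simple
configuration in `𝒜`. -/
noncomputable def hitProb (rule : BadEdgeRule d) (𝒜 : Set (Configuration d)) :
    ℕ → Configuration d → ℝ≥0∞
  | 0, γ => Set.indicator {σ | σ ∈ 𝒜 ∧ σ.IsSimple} 1 γ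
  | K + 1, γ => ∫⁻ γ', hitProb rule 𝒜 K γ' ∂(switchKernel rule γ)

theorem histories_zero (𝒜 : Set (Configuration d)) (γ : Configuration d) :
    ((histories 𝒜 0 γ).card : ℝ≥0∞) = Set.indicator {σ | σ ∈ 𝒜 ∧ σ.IsSimple} 1 γ := by
  classical
  by_cases h : γ ∈ 𝒜 ∧ γ.IsSimple
  · rw [Set.indicator_of_mem (show γ ∈ {σ | σ ∈ 𝒜 ∧ σ.IsSimple} from h)]
    have : histories 𝒜 0 γ = {(γ, Fin.elim0)} := by
      ext ⟨σ, D⟩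
      simp only [mem_histories, List.ofFn_zero, Valid, switchList, true_and,
        Finset.mem_singleton, Prod.mk.injEq]
      constructor
      · rintro ⟨-, -, rfl⟩; exact ⟨rfl, Subsingleton.elim _ _⟩
      · rintro ⟨rfl, -⟩; exact ⟨h.1, h.2, rfl⟩
    simp [this]
  · rw [Set.indicator_of_notMem (show γ ∉ {σ | σ ∈ 𝒜 ∧ σ.IsSimple} from h)]
    have : histories 𝒜 0 γ = ∅ := by
      ext ⟨σ, D⟩
      simp only [mem_histories, List.ofFn_zero, Valid, switchList, true_and,
        Finset.notMem_empty, iff_false]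
      rintro ⟨h1, h2, rfl⟩; exact h ⟨h1, h2⟩
    simp [this]

theorem histories_succ_of_isSimple (𝒜 : Set (Configuration d)) (b : ℕ) {γ : Configuration d}
    (h : γ.IsSimple) : histories 𝒜 (b + 1) γ = ∅ := by
  ext ⟨σ, D⟩
  simp only [mem_histories, Finset.notMem_empty, iff_false]
  rintro ⟨-, -, h3, rfl⟩
  rw [List.ofFn_succ] at h3 h
  exact h3.not_isSimple h

/-- Induction on K. A simple γ is not moved and has no history of length K + 1. For any other γ the
term b = 0 vanishes, and by `card_histories_succ_le` the remaining terms are at most an average over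
k of the induction hypothesis. That bound holds for every bad edge, hence also for the average over
the edge selected by the rule. -/
theorem sum_histories_le_hitProb (rule : BadEdgeRule d) {𝒜 : Set (Configuration d)}
    (h𝒜 : Symmetric 𝒜) (K : ℕ) (γ : Configuration d) :
    ∑ b ∈ Finset.range (K + 1), historyWeight (∑ i, d i) b * (histories 𝒜 b γ).card ≤
      hitProb rule 𝒜 K γ := by
  have w0 : historyWeight (∑ i, d i) 0 = 1 := by simp [historyWeight]
  induction K generalizing γ with
  | zero => simp [w0, histories_zero, hitProb]
  | succ K ih =>
    rw [hitProb]
    have hk : switchKernel rule γ = (switchStep rule γ).toMeasure := rfl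
    rw [hk, switchStep]
    by_cases h : γ.IsSimple
    · rw [dif_pos h, lintegral_toMeasure_pure]
      refine le_trans ?_ (ih γ)
      rw [Finset.sum_range_succ, histories_succ_of_isSimple _ _ h]
      simp
    · rw [dif_neg h, lintegral_toMeasure_bind]
      set c := ∑ b ∈ Finset.range (K + 1 + 1),
        historyWeight (∑ i, d i) b * (histories 𝒜 b γ).card with hc
      calc c = ∑' x, rule γ h x * c := by rw [ENNReal.tsum_mul_right, PMF.tsum_coe, one_mul]
        _ ≤ _ := by
          refine ENNReal.tsum_le_tsum fun x => ?_
          gcongr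
          have hcx : c ≤ ∑ k ∈ γ.others x.1,
              ((∑ i, d i : ℕ) : ℝ≥0∞)⁻¹ * hitProb rule 𝒜 K (γ.switch x.1 k) := by
            rw [hc, Finset.sum_range_succ', histories_zero, Set.indicator_of_notMem (by
              intro h'; exact h h'.2), mul_zero, add_zero]
            calc _ ≤ ∑ b ∈ Finset.range (K + 1), historyWeight (∑ i, d i) (b + 1) *
                  ((4 * (b + 1) * ∑ k ∈ γ.others x.1,
                    (histories 𝒜 b (γ.switch x.1 k)).card : ℕ) : ℝ≥0∞) := by
                  gcongr with b _
                  exact card_histories_succ_le h𝒜 b γ x.2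
              _ = ∑ b ∈ Finset.range (K + 1), ∑ k ∈ γ.others x.1, ((∑ i, d i : ℕ) : ℝ≥0∞)⁻¹ *
                  (historyWeight (∑ i, d i) b * (histories 𝒜 b (γ.switch x.1 k)).card) := by
                  refine Finset.sum_congr rfl fun b _ => ?_
                  push_cast
                  rw [← mul_assoc, historyWeight_succ, Finset.mul_sum]
                  refine Finset.sum_congr rfl fun k _ => ?_
                  push_cast
                  ring
              _ ≤ _ := by
                  rw [Finset.sum_comm]
                  refine Finset.sum_le_sum fun k _ => ?_
                  rw [← Finset.mul_sum]
                  gcongr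
                  exact ih _
          split_ifs with hx
          · rw [lintegral_toMeasure_map_uniform]
            refine hcx.trans (Finset.sum_le_sum fun k _ => ?_)
            gcongr
            have := Finset.card_le_univ (γ.others x.1)
            simpa using this
          -- Without another edge the process does not move, but then c is bounded by an empty sum.
          · rw [Finset.not_nonempty_iff_eq_empty] at hx
            rw [hx, Finset.sum_empty] at hcx
            exact hcx.trans zero_le

/-- The Markov property: the joint law of the first k steps and the next one is a composition
product, and the kernel only looks at the state at time k. -/
theorem lintegral_switchingChain_succ (hd : Even (∑ i, d i)) (rule : BadEdgeRule d) (k : ℕ)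
    (g : Configuration d → Configuration d → ℝ≥0∞) :
    ∫⁻ ω, g (ω k) (ω (k + 1)) ∂(switchingChain d hd rule) =
      ∫⁻ ω, ∫⁻ γ, g (ω k) γ ∂(switchKernel rule (ω k)) ∂(switchingChain d hd rule) := by
  have hk : Measurable fun h : (i : Finset.Iic k) → Configuration d =>
      h ⟨k, Finset.mem_Iic.2 le_rfl⟩ := measurable_pi_apply _
  have hmeas : Measurable fun p : ((i : Finset.Iic k) → Configuration d) × Configuration d =>
      g (p.1 ⟨k, Finset.mem_Iic.2 le_rfl⟩) p.2 :=
    (Measurable.of_discrete (f := fun q : Configuration d × Configuration d => g q.1 q.2)).comp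
      ((hk.comp measurable_fst).prodMk measurable_snd)
  have key := Kernel.map_frestrictLe_trajMeasure_compProd_eq_map_trajMeasure
    (X := fun _ => Configuration d) (μ₀ := uniformConfiguration d hd)
    (κ := fun k => (switchKernel rule).comap
      (fun h : (i : Finset.Iic k) → Configuration d => h ⟨k, Finset.mem_Iic.2 le_rfl⟩)
      (measurable_pi_apply _)) (a := k)
  have h1 := congrArg (fun μ => ∫⁻ p, g (p.1 ⟨k, Finset.mem_Iic.2 le_rfl⟩) p.2 ∂μ) key
  beta_reduce at h1
  rw [Measure.lintegral_compProd hmeas, lintegral_map hmeas (by fun_prop)] at h1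
  rw [lintegral_map (hmeas.lintegral_kernel_prod_right') (by fun_prop)] at h1
  exact h1.symm

theorem lintegral_switchingChain_zero (hd : Even (∑ i, d i)) (rule : BadEdgeRule d)
    (g : Configuration d → ℝ≥0∞) :
    ∫⁻ ω, g (ω 0) ∂(switchingChain d hd rule) = ∫⁻ γ, g γ ∂(uniformConfiguration d hd) := by
  have h : (switchingChain d hd rule).map (Preorder.frestrictLe (π := fun _ => Configuration d) 0) =
      (uniformConfiguration d hd).map (MeasurableEquiv.piUnique _).symm := by
    unfold switchingChain Kernel.trajMeasure
    rw [Measure.map_comp _ _ (by fun_prop), Kernel.traj_map_frestrictLe, Kernel.partialTraj_self,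
      Measure.id_comp]
  have hm : Measurable fun p : (i : Finset.Iic 0) → Configuration d =>
      g (p ⟨0, Finset.mem_Iic.2 le_rfl⟩) :=
    (Measurable.of_discrete (f := g)).comp
      (measurable_pi_apply (⟨0, Finset.mem_Iic.2 le_rfl⟩ : Finset.Iic 0))
  have h1 := congrArg (fun μ => ∫⁻ p, g (p ⟨0, Finset.mem_Iic.2 le_rfl⟩) ∂μ) h
  beta_reduce at h1
  rw [lintegral_map hm (by fun_prop), lintegral_map hm (by fun_prop)] at h1
  exact h1

theorem measurableSet_eval (K : ℕ) (s : Set (Configuration d)) :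
    MeasurableSet {ω : ℕ → Configuration d | ω K ∈ s} := by
  have hK : Measurable fun ω : ℕ → Configuration d => ω K := measurable_pi_apply K
  exact hK (MeasurableSet.of_discrete (s := s))

/-- The expectation of `hitProb rule 𝒜 k` at time K - k does not depend on k. For k = 0 it is the
probability of the event, for k = K it is the integral over the initial law. -/
theorem lintegral_hitProb (hd : Even (∑ i, d i)) (rule : BadEdgeRule d)
    (𝒜 : Set (Configuration d)) (K : ℕ) :
    switchingChain d hd rule {ω | ω K ∈ 𝒜 ∧ (ω K).IsSimple} =
      ∫⁻ γ, hitProb rule 𝒜 K γ ∂(uniformConfiguration d hd) := by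
  have : ∀ k ≤ K, ∫⁻ ω, hitProb rule 𝒜 k (ω (K - k)) ∂(switchingChain d hd rule) =
      switchingChain d hd rule {ω | ω K ∈ 𝒜 ∧ (ω K).IsSimple} := by
    intro k
    induction k with
    | zero =>
      intro _
      have : ∀ ω : ℕ → Configuration d, hitProb rule 𝒜 0 (ω (K - 0)) =
          Set.indicator {ω : ℕ → Configuration d | ω K ∈ 𝒜 ∧ (ω K).IsSimple} 1 ω := by
        intro ω
        simp [hitProb, Set.indicator]
      simp_rw [this]
      rw [lintegral_indicator_one]
      exact measurableSet_eval K {γ | γ ∈ 𝒜 ∧ γ.IsSimple}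
    | succ k ih =>
      intro hk
      rw [← ih (by omega), show K - k = K - (k + 1) + 1 by omega]
      exact (lintegral_switchingChain_succ hd rule (K - (k + 1)) fun _ γ => hitProb rule 𝒜 k γ).symm
  rw [← this K le_rfl, Nat.sub_self, lintegral_switchingChain_zero]

theorem ae_switchingChain_eq (hd : Even (∑ i, d i)) (rule : BadEdgeRule d) :
    ∀ᵐ ω ∂(switchingChain d hd rule), ∀ k, (ω k).IsSimple → ω (k + 1) = ω k := by
  classical
  rw [ae_all_iff]
  intro k
  have h := lintegral_switchingChain_succ hd rule k
    fun γ γ' => if γ.IsSimple ∧ γ' ≠ γ then 1 else 0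
  have h0 : ∀ γ : Configuration d,
      ∫⁻ γ', (if γ.IsSimple ∧ γ' ≠ γ then 1 else 0) ∂(switchKernel rule γ) = 0 := by
    intro γ
    by_cases hγ : γ.IsSimple
    · have hk : switchKernel rule γ = (switchStep rule γ).toMeasure := rfl
      rw [hk, switchStep, dif_pos hγ, lintegral_toMeasure_pure]
      simp
    · simp [hγ]
  simp_rw [h0, lintegral_zero] at h
  rw [lintegral_eq_zero_iff] at h
  · filter_upwards [h] with ω hω hs
    by_contra hne
    simp [hs, hne] at hω
  · have m1 : Measurable fun ω : ℕ → Configuration d => ω k := measurable_pi_apply k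
    have m2 : Measurable fun ω : ℕ → Configuration d => ω (k + 1) := measurable_pi_apply (k + 1)
    exact (Measurable.of_discrete (f := fun q : Configuration d × Configuration d =>
      (if q.1.IsSimple ∧ q.2 ≠ q.1 then 1 else 0 : ℝ≥0∞))).comp
      (m1.prodMk m2)

/-- The law of the final configuration is bounded below by the law of the first attempt after `K`
steps. -/
theorem switchingChain_le_switchingMeasure (hd : Even (∑ i, d i)) (rule : BadEdgeRule d)
    (𝒜 : Set (Configuration d)) (K : ℕ) :
    switchingChain d hd rule {ω | ω K ∈ 𝒜 ∧ (ω K).IsSimple} ≤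
      switchingMeasure d hd rule {ω | finalConfiguration ω ∈ 𝒜} := by
  have hmp : MeasurePreserving (fun ω : SwitchingSpace d => ω 0) (switchingMeasure d hd rule)
      (switchingChain d hd rule) :=
    measurePreserving_eval_infinitePi _ 0
  have hmeas : MeasurableSet {ω : ℕ → Configuration d | ω K ∈ 𝒜 ∧ (ω K).IsSimple} :=
    measurableSet_eval K {γ | γ ∈ 𝒜 ∧ γ.IsSimple}
  rw [← hmp.measure_preimage hmeas.nullMeasurableSet]
  refine measure_mono_ae ?_
  filter_upwards [hmp.quasiMeasurePreserving.ae (ae_switchingChain_eq hd rule)] with ω hω hK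
  change ω 0 K ∈ 𝒜 ∧ (ω 0 K).IsSimple at hK
  change finalConfiguration ω ∈ 𝒜
  classical
  have hex : ∃ a, ∃ s, (ω a s).IsSimple := ⟨0, K, hK.2⟩
  have h0 : Nat.find hex = 0 := (Nat.find_eq_zero hex).2 ⟨K, hK.2⟩
  have hconst : ∀ s, (ω 0 s).IsSimple → ∀ j, ω 0 (s + j) = ω 0 s := by
    intro s hs j
    induction j with
    | zero => rfl
    | succ j ih => rw [← add_assoc, hω _ (by rw [ih]; exact hs), ih]
  -- The first simple time is at most K, and the process is constant from then on.
  have hfin : ∀ a, a = 0 → ∀ h : ∃ s, (ω a s).IsSimple, ω a (Nat.find h) = ω 0 K := by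
    rintro a rfl h
    obtain ⟨j, hj⟩ := Nat.exists_eq_add_of_le (Nat.find_min' h hK.2)
    rw [hj, hconst _ (Nat.find_spec h)]
  have : finalConfiguration ω = ω 0 K := by
    unfold finalConfiguration
    rw [dif_pos hex]
    exact hfin _ h0 _
  rw [this]
  exact hK.1

end Chain

/-- A graph is cut out by countably many adjacency conditions. On a finite vertex set it follows
that all sets of graphs are measurable. -/
instance (V : Type*) [Countable V] : MeasurableSingletonClass (SimpleGraph V) := by
  refine ⟨fun G => ?_⟩
  have h : {G} = ⋂ u, ⋂ v, {H : SimpleGraph V | H.Adj u v = G.Adj u v} := by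
    ext H
    simp only [Set.mem_singleton_iff, Set.mem_iInter, Set.mem_ofPred_eq]
    refine ⟨by rintro rfl _ _; rfl, fun h => ?_⟩
    ext u v
    rw [h u v]
  rw [h]
  refine MeasurableSet.iInter fun u => MeasurableSet.iInter fun v => ?_
  exact (SimpleGraph.measurable_iff_adj.1 measurable_id u v)
    (MeasurableSet.of_discrete (s := {G.Adj u v}))

/-! ### Simple configurations and simple graphs -/

namespace Configuration

variable {n : ℕ} {d : Fin n → ℕ}

theorem mem_edges {γ : Configuration d} {e : Sym2 (HalfEdge d)} :
    e ∈ γ.edges ↔ ∃ z, s(z, γ.partner z) = e := by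
  simp [edges]

theorem edges_relabel (τ : Equiv.Perm (HalfEdge d)) (γ : Configuration d) :
    (γ.relabel τ).edges = γ.edges.map ⟨Sym2.map τ, Sym2.map.injective τ.injective⟩ := by
  ext e
  simp only [mem_edges, Finset.mem_map, Function.Embedding.coeFn_mk]
  constructor
  · rintro ⟨z, rfl⟩
    obtain ⟨w, rfl⟩ := τ.surjective z
    exact ⟨_, ⟨w, rfl⟩, by simp⟩
  · rintro ⟨_, ⟨w, rfl⟩, rfl⟩
    exact ⟨τ w, by simp⟩

theorem toMultigraph_relabel {τ : Equiv.Perm (HalfEdge d)} (hτ : ∀ z, (τ z).1 = z.1)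
    (γ : Configuration d) : (γ.relabel τ).toMultigraph = γ.toMultigraph := by
  rw [toMultigraph, toMultigraph, edges_relabel, Finset.map_val, Multiset.map_map]
  refine Multiset.map_congr rfl fun e _ => ?_
  simp only [Function.comp_apply, Function.Embedding.coeFn_mk, Sym2.map_map]
  congr 1
  ext z : 1
  exact hτ z

/-- The multigraph forgets the labels of half-edges, so every event about graphs is among the
symmetric ones to which the bound on histories applies. -/
theorem symmetric_preimage (𝔸 : Set (Multigraph (Fin n))) :
    Symmetric {γ : Configuration d | γ.toMultigraph ∈ 𝔸} := by
  intro τ hτ γ hγ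
  rw [Set.mem_ofPred_eq, toMultigraph_relabel hτ]
  exact hγ

/-- The underlying simple graph of a configuration. -/
def toGraph (γ : Configuration d) : SimpleGraph (Fin n) where
  Adj u v := u ≠ v ∧ γ.Adj u v
  symm := ⟨by
    rintro u v ⟨h, z, rfl, rfl⟩
    exact ⟨h.symm, γ.partner z, rfl, by simp⟩⟩
  loopless := ⟨fun u h => h.1 rfl⟩

theorem IsSimple.ne {γ : Configuration d} (h : γ.IsSimple) (z : HalfEdge d) :
    z.1 ≠ (γ.partner z).1 := fun e => h z (Or.inl e)

theorem IsSimple.eq_or {γ : Configuration d} (h : γ.IsSimple) {y z : HalfEdge d}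
    (e : γ.endpoints y = γ.endpoints z) : y = z ∨ y = γ.partner z := by
  by_contra hc
  rw [not_or] at hc
  exact h z (Or.inr ⟨y, hc.1, hc.2, e⟩)

theorem IsSimple.eq {γ : Configuration d} (h : γ.IsSimple) {y z : HalfEdge d}
    (e₁ : y.1 = z.1) (e₂ : (γ.partner y).1 = (γ.partner z).1) : y = z := by
  rcases h.eq_or ((endpoints_eq_iff _ _ _).2 (Or.inl ⟨e₁, e₂⟩)) with e | e
  · exact e
  · rw [e] at e₁
    exact absurd e₁.symm (h.ne z)

theorem IsSimple.adj_toGraph {γ : Configuration d} (h : γ.IsSimple) {u v : Fin n} :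
    γ.toGraph.Adj u v ↔ γ.Adj u v := by
  refine ⟨fun h => h.2, fun h' => ⟨?_, h'⟩⟩
  obtain ⟨z, rfl, rfl⟩ := h'
  exact h.ne z

theorem IsSimple.toMultigraph_eq {γ : Configuration d} (h : γ.IsSimple) :
    γ.toMultigraph = simpleToMultigraph γ.toGraph := by
  classical
  have h1 : γ.toMultigraph.Nodup := by
    refine Multiset.Nodup.map_on ?_ γ.edges.nodup
    intro e he e' he' heq
    obtain ⟨y, rfl⟩ := mem_edges.1 he
    obtain ⟨z, rfl⟩ := mem_edges.1 he'
    rcases h.eq_or (y := y) (z := z) (by simpa [endpoints] using heq) with rfl | rfl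
    · rfl
    · simp [Sym2.eq_swap]
  refine (Multiset.Nodup.ext h1 (by unfold simpleToMultigraph; exact Finset.nodup _)).2 ?_
  intro e
  unfold simpleToMultigraph
  rw [Finset.mem_val, SimpleGraph.mem_edgeFinset, toMultigraph, Multiset.mem_map]
  constructor
  · rintro ⟨_, he, rfl⟩
    obtain ⟨z, rfl⟩ := mem_edges.1 (show _ ∈ γ.edges from he)
    simp only [Sym2.map_mk, SimpleGraph.mem_edgeSet]
    exact h.adj_toGraph.2 ⟨z, rfl, rfl⟩
  · induction e using Sym2.ind with
    | _ u v =>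
      intro he
      rw [SimpleGraph.mem_edgeSet] at he
      obtain ⟨z, rfl, rfl⟩ := h.adj_toGraph.1 he
      exact ⟨_, show _ ∈ γ.edges from mem_edges.2 ⟨z, rfl⟩, rfl⟩

/-- In a simple configuration, the half-edges at a vertex correspond to its neighbours. -/
noncomputable def IsSimple.neighborEquiv {γ : Configuration d} (h : γ.IsSimple) (i : Fin n) :
    Fin (d i) ≃ γ.toGraph.neighborSet i :=
  Equiv.ofBijective (fun j => ⟨(γ.partner ⟨i, j⟩).1, h.adj_toGraph.2 ⟨⟨i, j⟩, rfl, rfl⟩⟩) <| by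
    constructor
    · intro j j' e
      have := h.eq (y := ⟨i, j⟩) (z := ⟨i, j'⟩) rfl (congrArg Subtype.val e)
      simpa using this
    · rintro ⟨v, hv⟩
      obtain ⟨⟨_, j⟩, rfl, rfl⟩ := h.adj_toGraph.1 hv
      exact ⟨j, rfl⟩

theorem IsSimple.toGraph_mem {γ : Configuration d} (h : γ.IsSimple) :
    γ.toGraph ∈ graphsWithDegrees d := by
  classical
  unfold graphsWithDegrees
  rw [Finset.mem_filter]
  refine ⟨Finset.mem_univ _, fun i => ?_⟩
  have := Fintype.card_congr (h.neighborEquiv i)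
  rw [Fintype.card_fin, SimpleGraph.card_neighborSet_eq_degree] at this
  convert this.symm

/-- The half-edge at the other end of an edge. -/
def neighborHalfEdge (G : SimpleGraph (Fin n)) (e : ∀ i, Fin (d i) ≃ G.neighborSet i) {i : Fin n}
    (a : G.neighborSet i) : HalfEdge d :=
  ⟨a.1, (e a.1).symm ⟨i, a.2.symm⟩⟩

theorem involutive_neighborHalfEdge (G : SimpleGraph (Fin n))
    (e : ∀ i, Fin (d i) ≃ G.neighborSet i) :
    Function.Involutive fun x : HalfEdge d => neighborHalfEdge G e (e x.1 x.2) := by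
  rintro ⟨i, j⟩
  have : ∀ a : G.neighborSet i, neighborHalfEdge G e
      (e (neighborHalfEdge G e a).1 (neighborHalfEdge G e a).2) = ⟨i, (e i).symm a⟩ := by
    intro a
    have h : e a.1 ((e a.1).symm ⟨i, a.2.symm⟩) = ⟨i, a.2.symm⟩ := Equiv.apply_symm_apply _ _
    exact congrArg (neighborHalfEdge G e) h
  simp [this]

/-- The configuration given by a graph and bijections between half-edges and neighbours. -/
def ofNeighborEquiv (G : SimpleGraph (Fin n)) (e : ∀ i, Fin (d i) ≃ G.neighborSet i) :
    Configuration d :=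
  ⟨(involutive_neighborHalfEdge G e).toPerm, involutive_neighborHalfEdge G e, by
    rintro ⟨i, j⟩ h
    have h1 : ((e i j).1 : Fin n) = i := congrArg Sigma.fst h
    have h2 := (e i j).2
    rw [h1] at h2
    exact G.loopless.irrefl _ h2⟩

theorem ofNeighborEquiv_partner (G : SimpleGraph (Fin n)) (e : ∀ i, Fin (d i) ≃ G.neighborSet i)
    (x : HalfEdge d) : (ofNeighborEquiv G e).partner x =
      ⟨(e x.1 x.2).1, (e (e x.1 x.2).1).symm ⟨x.1, (e x.1 x.2).2.symm⟩⟩ := rfl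

theorem isSimple_ofNeighborEquiv (G : SimpleGraph (Fin n))
    (e : ∀ i, Fin (d i) ≃ G.neighborSet i) : (ofNeighborEquiv G e).IsSimple := by
  rintro ⟨i, j⟩ (h | ⟨⟨i', j'⟩, h1, h2, h3⟩)
  · have h2 := (e i j).2
    rw [ofNeighborEquiv_partner] at h
    simp only at h
    rw [← h] at h2
    exact G.loopless.irrefl _ h2
  · have key : ∀ x y : HalfEdge d, x.1 = y.1 →
        ((ofNeighborEquiv G e).partner x).1 = ((ofNeighborEquiv G e).partner y).1 → x = y := by
      rintro ⟨a, b⟩ ⟨a', b'⟩ e1 e2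
      simp only at e1
      subst e1
      rw [ofNeighborEquiv_partner, ofNeighborEquiv_partner] at e2
      have : b = b' := (e a).injective (Subtype.ext e2)
      rw [this]
    rcases (endpoints_eq_iff _ _ _).1 h3 with ⟨a, b⟩ | ⟨a, b⟩
    · exact h1 (key _ _ a b)
    · exact h2 (key _ _ a (by simpa using b))

theorem toGraph_ofNeighborEquiv (G : SimpleGraph (Fin n))
    (e : ∀ i, Fin (d i) ≃ G.neighborSet i) : (ofNeighborEquiv G e).toGraph = G := by
  ext u v
  rw [(isSimple_ofNeighborEquiv G e).adj_toGraph]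
  constructor
  · rintro ⟨⟨i, j⟩, rfl, rfl⟩
    exact (e i j).2
  · intro h
    refine ⟨⟨u, (e u).symm ⟨v, h⟩⟩, rfl, ?_⟩
    rw [ofNeighborEquiv_partner]
    simp

/-- The simple configurations with a given graph. -/
noncomputable def fiberEquiv (G : SimpleGraph (Fin n)) :
    {γ : Configuration d // γ.IsSimple ∧ γ.toGraph = G} ≃ ∀ i, Fin (d i) ≃ G.neighborSet i where
  toFun γ i := (γ.2.1.neighborEquiv i).trans (Equiv.setCongr (by rw [γ.2.2]))
  invFun e := ⟨ofNeighborEquiv G e, isSimple_ofNeighborEquiv G e, toGraph_ofNeighborEquiv G e⟩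
  left_inv := by
    rintro ⟨γ, h, rfl⟩
    refine Subtype.ext (Configuration.ext ?_)
    rintro ⟨i, j⟩
    rw [ofNeighborEquiv_partner]
    refine Sigma.ext rfl (heq_of_eq ?_)
    refine (Equiv.symm_apply_eq _).2 (Subtype.ext ?_)
    change i = (γ.partner (γ.partner ⟨i, j⟩)).1
    rw [partner_partner]
  right_inv := by
    intro e
    ext i j
    rfl

-- A simple configuration over G is a choice, at each vertex, of a bijection between half-edges and
-- neighbours. The count does not depend on G, so a uniform simple configuration projects to a
-- uniform simple graph.
open Classical in
theorem card_fiber {G : SimpleGraph (Fin n)} (hG : G ∈ graphsWithDegrees d) :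
    (Finset.univ.filter fun γ : Configuration d => γ.IsSimple ∧ γ.toGraph = G).card =
      ∏ i, (d i).factorial := by
  have hdeg : ∀ i, Fintype.card (G.neighborSet i) = d i := by
    intro i
    unfold graphsWithDegrees at hG
    rw [Finset.mem_filter] at hG
    rw [← hG.2 i, SimpleGraph.card_neighborSet_eq_degree]
  rw [← Fintype.card_subtype, Fintype.card_congr (fiberEquiv G), Fintype.card_pi]
  refine Finset.prod_congr rfl fun i _ => ?_
  rw [Fintype.card_equiv (Fintype.equivOfCardEq (by rw [Fintype.card_fin, hdeg])),
    Fintype.card_fin]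

open Classical in
theorem card_graphs_mul (𝔸 : Set (Multigraph (Fin n))) :
    ((graphsWithDegrees d).filter fun G => simpleToMultigraph G ∈ 𝔸).card *
      ∏ i, (d i).factorial =
    (Finset.univ.filter fun γ : Configuration d => γ.toMultigraph ∈ 𝔸 ∧ γ.IsSimple).card := by
  rw [Finset.card_eq_sum_card_fiberwise (f := toGraph)
    (t := (graphsWithDegrees d).filter fun G => simpleToMultigraph G ∈ 𝔸)]
  · rw [Finset.sum_congr rfl (g := fun _ => ∏ i, (d i).factorial), Finset.sum_const, smul_eq_mul]
    intro G hG
    rw [Finset.mem_filter] at hG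
    rw [← card_fiber hG.1]
    congr 1
    ext γ
    simp only [Finset.mem_filter, Finset.mem_univ, true_and]
    constructor
    · rintro ⟨⟨-, h⟩, h'⟩; exact ⟨h, h'⟩
    · rintro ⟨h, h'⟩
      refine ⟨⟨?_, h⟩, h'⟩
      rw [h.toMultigraph_eq, h']; exact hG.2
  · intro γ hγ
    simp only [Finset.mem_coe, Finset.mem_filter, Finset.mem_univ, true_and] at hγ ⊢
    exact ⟨hγ.2.toGraph_mem, by rw [← hγ.2.toMultigraph_eq]; exact hγ.1⟩

open Classical in
theorem uniformGraphMeasure_eq (𝔸 : Set (Multigraph (Fin n)))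
    (h : ∃ γ : Configuration d, γ.IsSimple) :
    uniformGraphMeasure d {G | simpleToMultigraph G ∈ 𝔸} =
      ((Finset.univ.filter fun γ : Configuration d => γ.toMultigraph ∈ 𝔸 ∧ γ.IsSimple).card : ℝ≥0∞) /
        (Finset.univ.filter fun γ : Configuration d => γ.IsSimple).card := by
  have hne : (graphsWithDegrees d).Nonempty := by
    obtain ⟨γ, hγ⟩ := h
    exact ⟨_, hγ.toGraph_mem⟩
  have h1 := card_graphs_mul (d := d) 𝔸
  have h2 := card_graphs_mul (d := d) Set.univ
  simp only [Set.mem_univ, true_and, Finset.filter_true] at h2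
  have hp : (∏ i, (d i).factorial) ≠ 0 :=
    Finset.prod_ne_zero_iff.2 fun i _ => Nat.factorial_ne_zero _
  unfold uniformGraphMeasure uniformGraphPMF
  rw [dif_pos hne, PMF.toMeasure_uniformOfFinset_apply _ _ (MeasurableSet.of_discrete), ← h1, ← h2]
  push_cast
  rw [ENNReal.mul_div_mul_right _ _ (by exact_mod_cast hp)
    (ENNReal.prod_ne_top fun _ _ => ENNReal.natCast_ne_top _)]
  rfl

end Configuration

/-! ### Counting potential loops and double edges -/

theorem two_mul_card_le {α : Type*} [DecidableEq α] {A B : Finset α} (f : α → α)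
    (hf : Function.Injective f) (hA : A ⊆ B) (hfB : ∀ a ∈ A, f a ∈ B) (hfA : ∀ a ∈ A, f a ∉ A) :
    2 * A.card ≤ B.card := by
  have h1 : Disjoint A (A.image f) := by
    rw [Finset.disjoint_left]
    intro a ha ha'
    obtain ⟨b, hb, rfl⟩ := Finset.mem_image.1 ha'
    exact hfA b hb ha
  have h2 : A ∪ A.image f ⊆ B := by
    refine Finset.union_subset hA fun a ha => ?_
    obtain ⟨b, hb, rfl⟩ := Finset.mem_image.1 ha
    exact hfB b hb
  have h3 := Finset.card_le_card h2
  rw [Finset.card_union_of_disjoint h1, Finset.card_image_of_injective _ hf] at h3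
  omega

section Counting

variable {n : ℕ} (d : Fin n → ℕ)

/-- The number of ordered pairs of distinct half-edges at the same vertex. -/
def pairCount : ℕ := ∑ i, d i * (d i - 1)

/-- The maximum degree. -/
def maxDegree : ℕ := Finset.univ.sup d

theorem le_maxDegree (i : Fin n) : d i ≤ maxDegree d := Finset.le_sup (Finset.mem_univ i)

variable {d}

/-- The half-edges at the vertex of `z`. -/
def siblings (z : HalfEdge d) : Finset (HalfEdge d) := Finset.univ.filter fun w => w.1 = z.1

@[simp] theorem mem_siblings {z w : HalfEdge d} : w ∈ siblings z ↔ w.1 = z.1 := by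
  simp [siblings]

theorem card_halfEdges_at (v : Fin n) :
    (Finset.univ.filter fun w : HalfEdge d => w.1 = v).card = d v := by
  have : (Finset.univ.filter fun w : HalfEdge d => w.1 = v) =
      (Finset.univ : Finset (Fin (d v))).map ⟨Sigma.mk v, sigma_mk_injective⟩ := by
    ext ⟨i, j⟩
    simp only [Finset.mem_filter, Finset.mem_univ, true_and, Finset.mem_map,
      Function.Embedding.coeFn_mk]
    constructor
    · rintro rfl; exact ⟨j, rfl⟩
    · rintro ⟨j', h⟩; exact (congrArg Sigma.fst h).symm
  rw [this, Finset.card_map, Finset.card_univ, Fintype.card_fin]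

theorem card_siblings (z : HalfEdge d) : (siblings z).card = d z.1 := card_halfEdges_at z.1

theorem card_siblings_le (z : HalfEdge d) : (siblings z).card ≤ maxDegree d :=
  (card_siblings z).le.trans (le_maxDegree d _)

variable (d) in
/-- The ordered pairs of distinct half-edges at the same vertex. -/
def siblingPairs : Finset (HalfEdge d × HalfEdge d) :=
  Finset.univ.filter fun p => p.2.1 = p.1.1 ∧ p.2 ≠ p.1

theorem mem_siblingPairs {p : HalfEdge d × HalfEdge d} :
    p ∈ siblingPairs d ↔ p.2.1 = p.1.1 ∧ p.2 ≠ p.1 := by simp [siblingPairs]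

theorem sum_halfEdge {M : Type*} [AddCommMonoid M] (g : Fin n → M) :
    ∑ z : HalfEdge d, g z.1 = ∑ i, d i • g i := by
  rw [Fintype.sum_sigma]
  simp

theorem card_erase_siblings (z : HalfEdge d) : ((siblings z).erase z).card = d z.1 - 1 := by
  rw [Finset.card_erase_of_mem (by simp), card_siblings]

theorem card_siblingPairs : (siblingPairs d).card = pairCount d := by
  have h : ∀ z : HalfEdge d, ∑ w : HalfEdge d, (if w.1 = z.1 ∧ w ≠ z then 1 else 0) =
      d z.1 - 1 := by
    intro z
    rw [← card_erase_siblings, ← Finset.card_filter]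
    congr 1
    ext w
    simp [and_comm]
  rw [siblingPairs, Finset.card_filter, Fintype.sum_prod_type]
  simp only [h]
  rw [sum_halfEdge (fun i => d i - 1), pairCount]
  simp

variable (d) in
/-- The potential loops. -/
def potentialLoops : Finset (HalfEdge d × HalfEdge d) :=
  Finset.univ.filter fun p => p.2.1 = p.1.1 ∧ (p.1.2 : ℕ) < p.2.2

variable (d) in
/-- The potential double edges: the pairs of parallel edges `{x, y}`, `{x', y'}`, represented as
`((x, x'), (y, y'))`. -/
def potentialDoubles : Finset ((HalfEdge d × HalfEdge d) × (HalfEdge d × HalfEdge d)) :=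
  (potentialLoops d ×ˢ siblingPairs d).filter fun p => p.1.1.1 < p.2.1.1

theorem potentialLoops_subset : potentialLoops d ⊆ siblingPairs d := by
  intro p hp
  simp only [potentialLoops, Finset.mem_filter, Finset.mem_univ, true_and] at hp
  rw [mem_siblingPairs]
  refine ⟨hp.1, fun h => ?_⟩
  rw [h] at hp
  exact lt_irrefl _ hp.2

theorem two_mul_card_potentialLoops : 2 * (potentialLoops d).card ≤ pairCount d := by
  rw [← card_siblingPairs]
  refine two_mul_card_le Prod.swap Prod.swap_injective potentialLoops_subset ?_ ?_
  · intro p hp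
    have := mem_siblingPairs.1 (potentialLoops_subset hp)
    exact mem_siblingPairs.2 ⟨this.1.symm, this.2.symm⟩
  · intro p hp
    simp only [potentialLoops, Finset.mem_filter, Finset.mem_univ, true_and, Prod.fst_swap,
      Prod.snd_swap] at hp ⊢
    omega

/-- At most half of the pairs of sibling pairs have the smaller vertex first, and at most half of
those have their first pair in increasing order. The second pair remains ordered, since it records
which half-edges are joined. -/
theorem four_mul_card_potentialDoubles :
    4 * (potentialDoubles d).card ≤ pairCount d ^ 2 := by
  set D := (siblingPairs d ×ˢ siblingPairs d).filter fun p => p.1.1.1 < p.2.1.1 with hD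
  have h1 : 2 * D.card ≤ (siblingPairs d ×ˢ siblingPairs d).card := by
    refine two_mul_card_le Prod.swap Prod.swap_injective (Finset.filter_subset _ _) ?_ ?_
    · intro p hp
      simp only [hD, Finset.mem_filter, Finset.mem_product] at hp ⊢
      exact ⟨hp.1.2, hp.1.1⟩
    · intro p hp
      simp only [hD, Finset.mem_filter, Finset.mem_product, Prod.fst_swap, Prod.snd_swap] at hp ⊢
      exact fun h => lt_asymm hp.2 h.2
  have h2 : 2 * (potentialDoubles d).card ≤ D.card := by
    refine two_mul_card_le (Prod.map Prod.swap id)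
      (Prod.swap_injective.prodMap Function.injective_id) ?_ ?_ ?_
    · refine Finset.filter_subset_filter _ (Finset.product_subset_product_left ?_)
      exact potentialLoops_subset
    · intro p hp
      simp only [potentialDoubles, hD, Finset.mem_filter, Finset.mem_product, Prod.map_fst,
        Prod.map_snd, id, Prod.fst_swap] at hp ⊢
      have := mem_siblingPairs.1 (potentialLoops_subset hp.1.1)
      exact ⟨⟨mem_siblingPairs.2 ⟨this.1.symm, this.2.symm⟩, hp.1.2⟩, by rw [this.1]; exact hp.2⟩
    · intro p hp
      simp only [potentialDoubles, potentialLoops, Finset.mem_filter, Finset.mem_product,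
        Finset.mem_univ, true_and, Prod.map_fst, Prod.map_snd, id, Prod.fst_swap,
        Prod.snd_swap] at hp ⊢
      omega
  rw [Finset.card_product, card_siblingPairs] at h1
  rw [sq]
  omega

/-- The edges of a potential loop or double edge. -/
def obstruction : (HalfEdge d × HalfEdge d) ⊕ ((HalfEdge d × HalfEdge d) × (HalfEdge d × HalfEdge d)) →
    List (HalfEdge d × HalfEdge d)
  | Sum.inl p => [p]
  | Sum.inr p => [(p.1.1, p.2.1), (p.1.2, p.2.2)]

variable (d) in
/-- The potential loops and double edges. -/
def obstructions :
    Finset ((HalfEdge d × HalfEdge d) ⊕ ((HalfEdge d × HalfEdge d) × (HalfEdge d × HalfEdge d))) :=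
  (potentialLoops d).disjSum (potentialDoubles d)

open Configuration

theorem support_obstruction_inl (p : HalfEdge d × HalfEdge d) :
    support (obstruction (Sum.inl p)) = [p.1, p.2] := rfl

theorem support_obstruction_inr (p : (HalfEdge d × HalfEdge d) × (HalfEdge d × HalfEdge d)) :
    support (obstruction (Sum.inr p)) = [p.1.1, p.2.1, p.1.2, p.2.2] := rfl

theorem nodup_obstruction {i} (hi : i ∈ obstructions d) : (support (obstruction i)).Nodup := by
  rcases i with p | p
  · rw [obstructions, Finset.inl_mem_disjSum] at hi
    have := mem_siblingPairs.1 (potentialLoops_subset hi)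
    rw [support_obstruction_inl]
    simpa using this.2.symm
  · rw [obstructions, Finset.inr_mem_disjSum, potentialDoubles, Finset.mem_filter,
      Finset.mem_product] at hi
    have h1 := mem_siblingPairs.1 (potentialLoops_subset hi.1.1)
    have h2 := mem_siblingPairs.1 hi.1.2
    have h3 := hi.2.ne
    rw [support_obstruction_inr]
    have aux : ∀ a b : HalfEdge d, a.1 ≠ b.1 → a ≠ b := fun a b h e => h (by rw [e])
    simp only [List.nodup_cons, List.mem_cons, List.not_mem_nil, or_false, not_or,
      not_false_eq_true, List.nodup_nil, and_true]
    refine ⟨⟨aux _ _ h3, h1.2.symm, aux _ _ ?_⟩, ⟨aux _ _ ?_, h2.2.symm⟩, aux _ _ ?_⟩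
    · rw [h2.1]; exact h3
    · rw [h1.1]; exact h3.symm
    · rw [h1.1, h2.1]; exact h3

theorem isSimple_of_not_contains {γ : Configuration d}
    (h : ∀ i ∈ obstructions d, ¬ γ.Contains (obstruction i)) : γ.IsSimple := by
  have hloop : ∀ z : HalfEdge d, z.1 ≠ (γ.partner z).1 := by
    have aux : ∀ z : HalfEdge d, z.1 = (γ.partner z).1 →
        ¬ ((z.2 : ℕ) < (γ.partner z).2) := by
      intro z hz hlt
      refine h (Sum.inl (z, γ.partner z)) ?_ ?_
      · rw [obstructions, Finset.inl_mem_disjSum]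
        simp only [potentialLoops, Finset.mem_filter, Finset.mem_univ, true_and]
        exact ⟨hz.symm, hlt⟩
      · simp [obstruction, Contains]
    intro z hz
    have h1 := aux z hz
    have h2 := aux (γ.partner z) (by rw [partner_partner, hz])
    rw [partner_partner] at h2
    refine γ.partner_ne z ?_
    have h3 : ((γ.partner z).2 : ℕ) = z.2 := by omega
    exact Sigma.ext hz.symm ((Fin.heq_ext_iff (by rw [hz])).2 h3)
  intro x hx
  rcases hx with hx | ⟨y, h1, h2, h3⟩
  · exact hloop x hx
  -- Two distinct parallel edges, suitably oriented.
  have main : ∀ x y : HalfEdge d, x.1 < (γ.partner x).1 → y.1 = x.1 →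
      (γ.partner y).1 = (γ.partner x).1 → ¬ ((x.2 : ℕ) < y.2) := by
    intro x y hlt e1 e2 hlt'
    refine h (Sum.inr ((x, y), (γ.partner x, γ.partner y))) ?_ ?_
    · rw [obstructions, Finset.inr_mem_disjSum, potentialDoubles, Finset.mem_filter,
        Finset.mem_product]
      refine ⟨⟨?_, ?_⟩, hlt⟩
      · simp only [potentialLoops, Finset.mem_filter, Finset.mem_univ, true_and]
        exact ⟨e1, hlt'⟩
      · rw [mem_siblingPairs]
        refine ⟨e2, ?_⟩
        rw [Ne, partner_inj]
        rintro rfl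
        exact lt_irrefl _ hlt'
    · simp [obstruction, Contains]
  have main2 : ∀ x y : HalfEdge d, x.1 < (γ.partner x).1 → y.1 = x.1 →
      (γ.partner y).1 = (γ.partner x).1 → y = x := by
    intro x y hlt e1 e2
    have a1 := main x y hlt e1 e2
    have a2 := main y x (by rw [e1, e2]; exact hlt) e1.symm e2.symm
    have h3 : (y.2 : ℕ) = x.2 := by omega
    exact Sigma.ext e1 ((Fin.heq_ext_iff (by rw [e1])).2 h3)
  have main3 : ∀ x y : HalfEdge d, y.1 = x.1 → (γ.partner y).1 = (γ.partner x).1 → y = x := by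
    intro x y e1 e2
    rcases lt_or_gt_of_ne (hloop x) with hlt | hlt
    · exact main2 x y hlt e1 e2
    · have := main2 (γ.partner x) (γ.partner y) (by rwa [partner_partner]) e2
        (by simpa using e1)
      simpa using this
  rcases (endpoints_eq_iff _ _ _).1 h3 with ⟨a, b⟩ | ⟨a, b⟩
  · exact h1 (main3 _ _ a b)
  · exact h2 (main3 _ _ a (by simpa using b))

theorem card_loops_through_le (z : HalfEdge d) :
    ((potentialLoops d).filter fun p => z ∈ support (obstruction (Sum.inl p))).card ≤
      2 * maxDegree d := by
  have : ((potentialLoops d).filter fun p => z ∈ support (obstruction (Sum.inl p))) ⊆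
      ({z} ×ˢ siblings z) ∪ (siblings z ×ˢ {z}) := by
    rintro ⟨x, x'⟩ hp
    rw [Finset.mem_filter, support_obstruction_inl] at hp
    have h1 := mem_siblingPairs.1 (potentialLoops_subset hp.1)
    simp only [List.mem_cons, List.not_mem_nil, or_false] at hp
    simp only [Finset.mem_union, Finset.mem_product, Finset.mem_singleton, mem_siblings]
    rcases hp.2 with rfl | rfl
    · exact Or.inl ⟨rfl, h1.1⟩
    · exact Or.inr ⟨h1.1.symm, rfl⟩
  have h2 := (Finset.card_le_card this).trans (Finset.card_union_le _ _)
  simp only [Finset.card_product, Finset.card_singleton] at h2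
  have := card_siblings_le z
  omega

/-- There are four positions for z; its sibling then has at most Δ values, and the pair at the other
vertex at most Q. -/
theorem card_doubles_through_le (z : HalfEdge d) :
    ((potentialDoubles d).filter fun p => z ∈ support (obstruction (Sum.inr p))).card ≤
      4 * maxDegree d * pairCount d := by
  have : ((potentialDoubles d).filter fun p => z ∈ support (obstruction (Sum.inr p))) ⊆
      ((({z} ×ˢ siblings z) ×ˢ siblingPairs d) ∪ ((siblings z ×ˢ {z}) ×ˢ siblingPairs d)) ∪
      ((siblingPairs d ×ˢ ({z} ×ˢ siblings z)) ∪ (siblingPairs d ×ˢ (siblings z ×ˢ {z}))) := by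
    rintro ⟨⟨x, x'⟩, ⟨y, y'⟩⟩ hp
    rw [Finset.mem_filter, support_obstruction_inr, potentialDoubles, Finset.mem_filter,
      Finset.mem_product] at hp
    have h0 := potentialLoops_subset hp.1.1.1
    have h1 := mem_siblingPairs.1 h0
    have h2 := mem_siblingPairs.1 hp.1.1.2
    simp only [List.mem_cons, List.not_mem_nil, or_false] at hp
    simp only [Finset.mem_union, Finset.mem_product, Finset.mem_singleton, mem_siblings]
    rcases hp.2 with rfl | rfl | rfl | rfl
    · exact Or.inl (Or.inl ⟨⟨rfl, h1.1⟩, hp.1.1.2⟩)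
    · exact Or.inr (Or.inl ⟨h0, rfl, h2.1⟩)
    · exact Or.inl (Or.inr ⟨⟨h1.1.symm, rfl⟩, hp.1.1.2⟩)
    · exact Or.inr (Or.inr ⟨h0, h2.1.symm, rfl⟩)
  refine (Finset.card_le_card this).trans ((Finset.card_union_le _ _).trans
    ((Nat.add_le_add (Finset.card_union_le _ _) (Finset.card_union_le _ _)).trans ?_))
  simp only [Finset.card_product, Finset.card_singleton, card_siblingPairs]
  have := Nat.mul_le_mul_right (pairCount d) (card_siblings_le z)
  nlinarith

end Counting

/-! ### The probability that a configuration is simple -/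

section SimpleProbability

variable {n : ℕ} {d : Fin n → ℕ}

open Configuration

theorem length_obstruction_pos
    (i : (HalfEdge d × HalfEdge d) ⊕ ((HalfEdge d × HalfEdge d) × (HalfEdge d × HalfEdge d))) :
    1 ≤ (obstruction i).length ∧ (obstruction i).length ≤ 2 := by
  rcases i with p | p <;> simp [obstruction]

theorem sum_obstructions (g : ℕ → ℝ) :
    ∑ i ∈ obstructions d, g (obstruction i).length =
      (potentialLoops d).card * g 1 + (potentialDoubles d).card * g 2 := by
  rw [obstructions, Finset.sum_disjSum]
  simp [obstruction]

open Classical in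
theorem sum_related_obstructions_le (g : ℕ → ℝ) (h1 : 0 ≤ g 1) (h2 : 0 ≤ g 2) (L : List (HalfEdge d))
    (hL : L.length ≤ 4)
    (r : (HalfEdge d × HalfEdge d) ⊕ ((HalfEdge d × HalfEdge d) × (HalfEdge d × HalfEdge d)) → Prop)
    [DecidablePred r] (hr : ∀ i, r i → ∃ z ∈ L, z ∈ support (obstruction i)) :
    ∑ i ∈ (obstructions d).filter r, g (obstruction i).length ≤
    4 * (2 * maxDegree d * g 1 + 4 * maxDegree d * pairCount d * g 2) := by
  have hg : ∀ i : (HalfEdge d × HalfEdge d) ⊕ ((HalfEdge d × HalfEdge d) × (HalfEdge d × HalfEdge d)),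
      0 ≤ g (obstruction i).length := by
    rintro (p | p)
    · exact h1
    · exact h2
  set c : ℝ := 2 * maxDegree d * g 1 + 4 * maxDegree d * pairCount d * g 2 with hc
  have hc0 : 0 ≤ c := by positivity
  have hz : ∀ z, ∑ i ∈ (obstructions d).filter (fun i => z ∈ support (obstruction i)),
      g (obstruction i).length ≤ c := by
    intro z
    rw [Finset.sum_filter, obstructions, Finset.sum_disjSum, ← Finset.sum_filter,
      ← Finset.sum_filter]
    simp only [obstruction, List.length_cons, List.length_nil, zero_add,
      Nat.reduceAdd, Finset.sum_const, nsmul_eq_mul]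
    have e1 := card_loops_through_le z
    have e2 := card_doubles_through_le z
    have e1' : (((potentialLoops d).filter fun p => z ∈ support (obstruction (Sum.inl p))).card : ℝ)
        ≤ 2 * maxDegree d := by exact_mod_cast e1
    have e2' : (((potentialDoubles d).filter
        fun p => z ∈ support (obstruction (Sum.inr p))).card : ℝ)
        ≤ 4 * maxDegree d * pairCount d := by exact_mod_cast e2
    exact add_le_add (mul_le_mul_of_nonneg_right e1' h1) (mul_le_mul_of_nonneg_right e2' h2)
  calc _ ≤ ∑ i ∈ obstructions d, ∑ z ∈ L.toFinset,
        if z ∈ support (obstruction i) then g (obstruction i).length else 0 := by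
        rw [Finset.sum_filter]
        refine Finset.sum_le_sum fun i _ => ?_
        have hnn : ∀ z ∈ L.toFinset,
            0 ≤ if z ∈ support (obstruction i) then g (obstruction i).length else 0 := by
          intro z _; split_ifs
          · exact hg i
          · exact le_rfl
        split_ifs with h
        · obtain ⟨z, hz, hz'⟩ := hr i h
          refine le_trans ?_ (Finset.single_le_sum hnn (List.mem_toFinset.2 hz))
          rw [if_pos hz']
        · exact Finset.sum_nonneg hnn
    _ = ∑ z ∈ L.toFinset, ∑ i ∈ (obstructions d).filter (fun i => z ∈ support (obstruction i)),
        g (obstruction i).length := by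
        rw [Finset.sum_comm]
        simp only [Finset.sum_filter]
    _ ≤ ∑ z ∈ L.toFinset, c := Finset.sum_le_sum fun z _ => hz z
    _ = L.toFinset.card * c := by simp
    _ ≤ 4 * c := by
        gcongr
        exact_mod_cast (List.toFinset_card_le L).trans hL

/-- Since e^y ≥ 1 + y for y = (1 + η)x, it is enough that (1 - x)(1 + (1 + η)x) ≥ 1, and this
amounts to (1 + η)x ≤ η when x > 0. -/
theorem exp_neg_le_one_sub {x η : ℝ} (hη : 0 < η) (hx : x ≤ η / (1 + η)) (hx0 : 0 ≤ x) :
    Real.exp (-((1 + η) * x)) ≤ 1 - x := by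
  have h1 : x * (1 + η) ≤ η := by rwa [le_div_iff₀ (by positivity)] at hx
  have h2 : 1 + (1 + η) * x ≤ Real.exp ((1 + η) * x) := by
    have := Real.add_one_le_exp ((1 + η) * x); linarith
  rw [Real.exp_neg]
  have h3 : 0 < 1 + (1 + η) * x := by positivity
  refine (inv_anti₀ h3 h2).trans ?_
  rw [inv_le_iff_one_le_mul₀ h3]
  nlinarith

/-- The fourth power collects one factor 1 + η from `exp_neg_le_one_sub`, one from the local lemma
weights, and up to two from replacing a by 1/N. -/
theorem exp_le_prod_obstructions {η a N : ℝ} (hη : 0 < η) (hN : 0 < N) (ha0 : 0 < a)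
    (ha1 : a ≤ 1) (hx : (1 + η) * a ≤ η / (1 + η)) (haN : a ≤ (1 + η) / N) :
    Real.exp (-((1 + η) ^ 4 * ((pairCount d : ℝ) / (2 * N) + (pairCount d : ℝ) ^ 2 / (4 * N ^ 2)))) ≤
      ∏ i ∈ obstructions d, (1 - (1 + η) * a ^ (obstruction i).length) := by
  have hle : ∀ r, 1 ≤ r → (1 + η) * a ^ r ≤ η / (1 + η) := by
    intro r hr
    refine le_trans ?_ hx
    have : a ^ r ≤ a ^ 1 := pow_le_pow_of_le_one ha0.le ha1 hr
    rw [pow_one] at this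
    exact mul_le_mul_of_nonneg_left this (by positivity)
  have hprod : Real.exp (-((1 + η) * ∑ i ∈ obstructions d, (1 + η) * a ^ (obstruction i).length)) ≤
      ∏ i ∈ obstructions d, (1 - (1 + η) * a ^ (obstruction i).length) := by
    rw [Finset.mul_sum, ← Finset.sum_neg_distrib, Real.exp_sum]
    refine Finset.prod_le_prod (fun i _ => (Real.exp_pos _).le) fun i _ => ?_
    exact exp_neg_le_one_sub hη (hle _ (length_obstruction_pos i).1) (by positivity)
  refine le_trans (Real.exp_le_exp.2 ?_) hprod
  rw [neg_le_neg_iff, sum_obstructions fun r => (1 + η) * a ^ r]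
  have c1 : ((2 * (potentialLoops d).card : ℕ) : ℝ) ≤ (pairCount d : ℝ) :=
    Nat.cast_le.2 two_mul_card_potentialLoops
  have c2 : ((4 * (potentialDoubles d).card : ℕ) : ℝ) ≤ ((pairCount d ^ 2 : ℕ) : ℝ) :=
    Nat.cast_le.2 four_mul_card_potentialDoubles
  push_cast at c1 c2
  have hQ0 : (0 : ℝ) ≤ pairCount d := by positivity
  generalize (pairCount d : ℝ) = Q at *
  generalize ((potentialLoops d).card : ℝ) = l at *
  generalize ((potentialDoubles d).card : ℝ) = m at *
  have b1 : l * ((1 + η) * a ^ 1) ≤ (1 + η) ^ 2 * (Q / (2 * N)) := by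
    calc l * ((1 + η) * a ^ 1) ≤ Q / 2 * ((1 + η) * ((1 + η) / N) ^ 1) := by
          gcongr
          linarith
      _ = _ := by field_simp
  have b2 : m * ((1 + η) * a ^ 2) ≤ (1 + η) ^ 3 * (Q ^ 2 / (4 * N ^ 2)) := by
    calc m * ((1 + η) * a ^ 2) ≤ Q ^ 2 / 4 * ((1 + η) * ((1 + η) / N) ^ 2) := by
          gcongr
          linarith
      _ = _ := by field_simp
  have t1 : (0 : ℝ) ≤ Q / (2 * N) := by positivity
  have p23 : (1 + η) ^ 2 ≤ (1 + η) ^ 3 := pow_le_pow_right₀ (by linarith) (by norm_num)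
  have b1' := b1.trans (mul_le_mul_of_nonneg_right p23 t1)
  calc _ ≤ (1 + η) * ((1 + η) ^ 3 * (Q / (2 * N)) + (1 + η) ^ 3 * (Q ^ 2 / (4 * N ^ 2))) := by
        gcongr
    _ = _ := by ring

-- The local lemma, with obstructions related when they share a half-edge. An obstruction with r
-- edges has conditional probability at most a^r for a = 1/(N - 4), because N - 2r ≥ N - 4, and it
-- receives the weight (1 + η)a^r.
open Classical in
theorem exp_mul_le_card_simple {η : ℝ} (hη : 0 < η)
    (hN : 4 * (1 + η) ≤ η * (∑ i, d i : ℕ))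
    (hx : (1 + η) * ((∑ i, d i : ℕ) - 4 : ℝ)⁻¹ ≤ η / (1 + η))
    (hs : 1 ≤ (1 + η) * (1 - 4 * (2 * maxDegree d * ((1 + η) * ((∑ i, d i : ℕ) - 4 : ℝ)⁻¹) +
      4 * maxDegree d * pairCount d * ((1 + η) * ((∑ i, d i : ℕ) - 4 : ℝ)⁻¹ ^ 2)))) :
    Real.exp (-((1 + η) ^ 4 * ((pairCount d : ℝ) / (2 * (∑ i, d i : ℕ)) +
      (pairCount d : ℝ) ^ 2 / (4 * (∑ i, d i : ℕ) ^ 2)))) * Fintype.card (Configuration d) ≤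
      (Finset.univ.filter fun γ : Configuration d => γ.IsSimple).card := by
  set N : ℕ := ∑ i, d i with hNdef
  set Q : ℝ := (pairCount d : ℝ) with hQ
  have hN4 : (4 : ℝ) < N := by
    by_contra hc
    rw [not_lt] at hc
    nlinarith
  have hN4' : 4 < N := by exact_mod_cast hN4
  set a : ℝ := ((N : ℝ) - 4)⁻¹ with ha
  have ha0 : 0 < a := by rw [ha]; exact inv_pos.2 (by linarith)
  have ha1 : a ≤ 1 := by
    have : (5 : ℝ) ≤ N := by exact_mod_cast hN4'
    rw [ha]; exact inv_le_one_of_one_le₀ (by linarith)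
  have haN : a ≤ (1 + η) / N := by
    rw [ha, le_div_iff₀ (by linarith), inv_mul_le_iff₀ (by linarith)]
    nlinarith
  set g : ℕ → ℝ := fun r => (1 + η) * a ^ r with hg
  have hg0 : ∀ r, 0 ≤ g r := fun r => by positivity
  have hle : ∀ r, 1 ≤ r → g r ≤ η / (1 + η) := by
    intro r hr
    refine le_trans ?_ hx
    have : a ^ r ≤ a ^ 1 := pow_le_pow_of_le_one ha0.le ha1 hr
    rw [pow_one] at this
    exact mul_le_mul_of_nonneg_left this (by positivity)
  have hlt1 : η / (1 + η) ≤ 1 := by rw [div_le_one (by positivity)]; linarith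
  have hLLL := lopsided_local_lemma (Ω := Configuration d)
    (fun i γ => γ.Contains (obstruction i)) (obstructions d)
    (fun i j => ∃ z ∈ support (obstruction i), z ∈ support (obstruction j))
    (fun i => a ^ (obstruction i).length) (fun i => g (obstruction i).length)
    (fun i _ => hg0 _) (fun i _ => (hle _ (length_obstruction_pos i).1).trans hlt1) ?_ ?_
  · refine le_trans ?_ (hLLL.trans (Nat.cast_le.2 (Finset.card_le_card fun γ hγ => ?_)))
    · exact mul_le_mul_of_nonneg_right
        (exp_le_prod_obstructions hη (by linarith) ha0 ha1 hx haN) (Nat.cast_nonneg _)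
    · have h2 : ∀ i ∈ obstructions d, ¬ γ.Contains (obstruction i) := by simpa using hγ
      simpa using isSimple_of_not_contains h2
  · intro i hi S hS hr
    have hcomp : ∀ M' ∈ S.image obstruction, Compatible (obstruction i) M' := by
      intro M' hM'
      obtain ⟨j, hj, rfl⟩ := Finset.mem_image.1 hM'
      intro p hp q hq
      right
      have hmem : ∀ {k : (HalfEdge d × HalfEdge d) ⊕
          ((HalfEdge d × HalfEdge d) × (HalfEdge d × HalfEdge d))} {p : HalfEdge d × HalfEdge d},
          p ∈ obstruction k → p.1 ∈ support (obstruction k) ∧ p.2 ∈ support (obstruction k) := by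
        intro k p hp
        simp only [support, List.mem_flatMap]
        exact ⟨⟨p, hp, by simp⟩, ⟨p, hp, by simp⟩⟩
      have a1 := hmem hp
      have a2 := hmem hq
      have a3 := hr j hj
      push Not at a3
      exact ⟨fun h => a3 _ a1.1 (h ▸ a2.1), fun h => a3 _ a1.2 (h ▸ a2.1),
        fun h => a3 _ a1.1 (h ▸ a2.2), fun h => a3 _ a1.2 (h ▸ a2.2)⟩
    have key := card_contains_mul_le (S.image obstruction) (obstruction i) (nodup_obstruction hi)
      hcomp
    simp only [Finset.forall_mem_image] at key
    have hlen := length_obstruction_pos i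
    set r := (obstruction i).length
    have hpow : ((N : ℝ) - 4) ^ r ≤ (((∑ i, d i) - 2 * r : ℕ) : ℝ) ^ r := by
      have : ((N : ℝ) - 4) ≤ (((∑ i, d i) - 2 * r : ℕ) : ℝ) := by
        rw [← hNdef, Nat.cast_sub (by omega)]
        have : (r : ℝ) ≤ 2 := by exact_mod_cast hlen.2
        push_cast; linarith
      exact pow_le_pow_left₀ (by linarith) this r
    have key' : ((Finset.univ.filter fun γ : Configuration d =>
        (∀ j ∈ S, ¬ γ.Contains (obstruction j)) ∧ γ.Contains (obstruction i)).card : ℝ) *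
        (((∑ i, d i) - 2 * r : ℕ) : ℝ) ^ r ≤
        (Finset.univ.filter fun γ : Configuration d =>
          ∀ j ∈ S, ¬ γ.Contains (obstruction j)).card := by
      have := (Nat.cast_le (α := ℝ)).2 key
      push_cast at this ⊢
      convert this
    rw [ha, inv_pow, ← div_eq_inv_mul, le_div_iff₀ (pow_pos (by linarith) r)]
    refine le_trans (mul_le_mul_of_nonneg_left hpow (Nat.cast_nonneg _)) ?_
    exact le_of_eq_of_le (by congr!) (key'.trans_eq (by congr!))
  · intro i hi
    have hpos : (0 : ℝ) ≤ a ^ (obstruction i).length := by positivity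
    have hsum := sum_related_obstructions_le g (hg0 1) (hg0 2) (support (obstruction i)) (by
      have := length_obstruction_pos i
      rw [length_support]; omega) (fun j => ∃ z ∈ support (obstruction i), z ∈ support (obstruction j))
      fun _ h => h
    have hs' : 1 ≤ (1 + η) * (1 - 4 * (2 * maxDegree d * g 1 + 4 * maxDegree d * Q * g 2)) := by
      simpa only [hg, pow_one] using hs
    refine le_trans ?_ (mul_le_mul_of_nonneg_left (sub_le_sub_left
      (le_of_eq_of_le (by congr!) hsum) 1) (hg0 _))
    calc a ^ (obstruction i).length = a ^ (obstruction i).length * 1 := (mul_one _).symm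
      _ ≤ a ^ (obstruction i).length * ((1 + η) * (1 - 4 * (2 * maxDegree d * g 1 +
          4 * maxDegree d * Q * g 2))) := by gcongr
      _ = _ := by simp only [hg]; ring

/-- The expected number of loops and pairs of parallel edges, approximately. -/
noncomputable def badRate (d : Fin n → ℕ) : ℝ :=
  (pairCount d : ℝ) / (2 * (∑ i, d i : ℕ)) + (pairCount d : ℝ) ^ 2 / (4 * (∑ i, d i : ℕ) ^ 2)

theorem badRate_nonneg (d : Fin n → ℕ) : 0 ≤ badRate d := by unfold badRate; positivity

theorem badRate_le {A : ℝ} (hN : 0 < ∑ i, d i) (hQ : (pairCount d : ℝ) ≤ A * (∑ i, d i : ℕ)) :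
    badRate d ≤ A / 2 + A ^ 2 / 4 := by
  unfold badRate
  have hN' : (0 : ℝ) < (∑ i, d i : ℕ) := by exact_mod_cast hN
  set N : ℝ := ((∑ i, d i : ℕ) : ℝ)
  have h0 : (0 : ℝ) ≤ pairCount d := by positivity
  refine add_le_add ?_ ?_
  · rw [div_le_div_iff₀ (by positivity) (by norm_num)]; nlinarith
  · rw [div_le_div_iff₀ (by positivity) (by norm_num)]
    have : (pairCount d : ℝ) ^ 2 ≤ (A * N) ^ 2 := pow_le_pow_left₀ h0 hQ 2
    nlinarith

theorem one_le_maxDegree (hN : 0 < ∑ i, d i) : 1 ≤ maxDegree d := by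
  by_contra h
  have h0 : maxDegree d = 0 := by omega
  have : ∑ i, d i = 0 := Finset.sum_eq_zero fun i _ => by
    have := le_maxDegree d i
    omega
  omega

/-- The choice of δ makes the sum of the related weights at most 4(8δ + 32Aδ) = η/2, and (1 + η)(1 -
η/2) ≥ 1 for η ≤ 1. No separate assumption that N is large is needed: 1 ≤ D² ≤ δN already forces it.
-/
theorem local_lemma_bounds {A η δ N D Q : ℝ} (hA : 0 < A) (hη0 : 0 < η) (hη1 : η ≤ 1)
    (hδA : δ * (64 + 256 * A) = η) (hN' : 0 < N) (hD1 : 1 ≤ D) (hQ0 : 0 ≤ Q) (hQ : Q ≤ A * N)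
    (hΔ : D ^ 2 ≤ δ * N) :
    4 * (1 + η) ≤ η * N ∧ (1 + η) * (N - 4)⁻¹ ≤ η / (1 + η) ∧
    1 ≤ (1 + η) * (1 - 4 * (2 * D * ((1 + η) * (N - 4)⁻¹) +
      4 * D * Q * ((1 + η) * (N - 4)⁻¹ ^ 2))) := by
  have hδ0 : 0 < δ := by
    by_contra h
    rw [not_lt] at h
    nlinarith [mul_nonneg_of_nonpos_of_nonpos h (by linarith : -(64 + 256 * A) ≤ 0)]
  have hD2 : D ≤ δ * N := by nlinarith
  have h64 : 64 * δ ≤ η := by nlinarith [mul_pos hδ0 hA]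
  have hηN : 64 ≤ η * N := by nlinarith
  have hN64 : 64 ≤ N := by nlinarith
  have hN4 : 0 < N - 4 := by linarith
  have hinv : (N - 4)⁻¹ ≤ 2 / N := by
    rw [inv_eq_one_div, div_le_div_iff₀ hN4 hN']; linarith
  have hinv0 : 0 ≤ (N - 4)⁻¹ := by positivity
  have hη2 : η / 2 ≤ η / (1 + η) := by gcongr; linarith
  refine ⟨by linarith, ?_, ?_⟩
  · refine le_trans ?_ hη2
    calc (1 + η) * (N - 4)⁻¹ ≤ 2 * (2 / N) := by gcongr; linarith
      _ = 4 / N := by ring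
      _ ≤ η / 2 := by rw [div_le_div_iff₀ hN' (by norm_num)]; linarith
  · have e1 : 2 * D * ((1 + η) * (N - 4)⁻¹) ≤ 8 * δ := by
      calc 2 * D * ((1 + η) * (N - 4)⁻¹) ≤ 2 * (δ * N) * (2 * (2 / N)) := by gcongr; linarith
        _ = 8 * δ := by field_simp; norm_num
    have e2 : 4 * D * Q * ((1 + η) * (N - 4)⁻¹ ^ 2) ≤ 32 * A * δ := by
      calc 4 * D * Q * ((1 + η) * (N - 4)⁻¹ ^ 2) ≤
            4 * (δ * N) * (A * N) * (2 * (2 / N) ^ 2) := by gcongr; linarith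
        _ = 32 * A * δ := by field_simp; norm_num
    have e3 : 4 * (2 * D * ((1 + η) * (N - 4)⁻¹) + 4 * D * Q * ((1 + η) * (N - 4)⁻¹ ^ 2)) ≤
        η / 2 := by linarith
    generalize 4 * (2 * D * ((1 + η) * (N - 4)⁻¹) + 4 * D * Q * ((1 + η) * (N - 4)⁻¹ ^ 2)) = t at *
    nlinarith

theorem exp_rate_bound {B ε η b : ℝ} (hη0 : 0 < η) (hη1 : η ≤ 1) (hηε : 15 * η * B ≤ ε)
    (hb0 : 0 ≤ b) (hb : b ≤ B) :
    (1 - ε) * Real.exp (-b) ≤ Real.exp (-((1 + η) ^ 4 * b)) := by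
  have h2 : η ^ 2 ≤ η := by nlinarith
  have h3 : η ^ 3 ≤ η := by nlinarith
  have h4 : η ^ 4 ≤ η := by nlinarith
  have h15 : (1 + η) ^ 4 ≤ 1 + 15 * η := by
    have : (1 + η) ^ 4 = 1 + 4 * η + 6 * η ^ 2 + 4 * η ^ 3 + η ^ 4 := by ring
    linarith
  have h16 : (1 + η) ^ 4 * b ≤ (1 + 15 * η) * b := mul_le_mul_of_nonneg_right h15 hb0
  have h17 : 15 * η * b ≤ 15 * η * B := mul_le_mul_of_nonneg_left hb (by positivity)
  calc (1 - ε) * Real.exp (-b) ≤ Real.exp (-ε) * Real.exp (-b) := by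
        gcongr
        have := Real.add_one_le_exp (-ε)
        linarith
    _ = Real.exp (-ε + -b) := (Real.exp_add _ _).symm
    _ ≤ _ := Real.exp_le_exp.2 (by linarith)

open Classical in
/-- A random configuration is simple with probability at least `(1 - o(1)) exp (-badRate d)`. -/
theorem exists_card_simple_ge (A ε : ℝ) (hA : 0 < A) (hε : 0 < ε) :
    ∃ δ : ℝ, 0 < δ ∧ ∀ {n : ℕ} (d : Fin n → ℕ), 0 < ∑ i, d i →
      (pairCount d : ℝ) ≤ A * (∑ i, d i : ℕ) → (maxDegree d : ℝ) ^ 2 ≤ δ * (∑ i, d i : ℕ) →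
      (1 - ε) * Real.exp (-badRate d) * Fintype.card (Configuration d) ≤
        (Finset.univ.filter fun γ : Configuration d => γ.IsSimple).card := by
  set B : ℝ := A / 2 + A ^ 2 / 4 with hB
  have hB0 : 0 < B := by positivity
  set η : ℝ := min 1 (ε / (15 * B)) with hη
  have hη0 : 0 < η := by positivity
  have hη1 : η ≤ 1 := min_le_left _ _
  have hηε : 15 * η * B ≤ ε := by
    have : η ≤ ε / (15 * B) := min_le_right _ _
    rw [le_div_iff₀ (by positivity)] at this
    linarith
  refine ⟨η / (64 + 256 * A), by positivity, ?_⟩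
  intro n d hN hQ hΔ
  obtain ⟨h1, h2, h3⟩ := local_lemma_bounds (δ := η / (64 + 256 * A)) hA hη0 hη1
    (by field_simp) (Nat.cast_pos.2 hN) (Nat.one_le_cast.2 (one_le_maxDegree hN))
    (Nat.cast_nonneg _) hQ hΔ
  refine le_trans ?_ (exp_mul_le_card_simple hη0 h1 h2 h3)
  exact mul_le_mul_of_nonneg_right
    (exp_rate_bound hη0 hη1 hηε (badRate_nonneg d) (badRate_le hN hQ)) (Nat.cast_nonneg _)

end SimpleProbability

/-! ### Moments of sums over the edges of a random configuration -/

section Moments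

variable {n : ℕ} {d : Fin n → ℕ}

open Configuration

open Classical in
/-- Union bound for the expected weight of the partial matchings contained in a random
configuration. -/
theorem sum_weight_contains_le {ι : Type*} (T : Finset ι) (φ : ι → ℝ) (hφ : ∀ t ∈ T, 0 ≤ φ t)
    (M : ι → List (HalfEdge d × HalfEdge d)) (r : ℕ) (hr : ∀ t ∈ T, (M t).length = r)
    (hM : ∀ t ∈ T, (support (M t)).Nodup) (hN : 2 * r < ∑ i, d i) :
    ∑ γ : Configuration d, ∑ t ∈ T, (if γ.Contains (M t) then φ t else 0) ≤
      Fintype.card (Configuration d) * ((((∑ i, d i : ℕ) : ℝ) - 2 * r) ^ r)⁻¹ * ∑ t ∈ T, φ t := by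
  rw [Finset.sum_comm, Finset.mul_sum]
  refine Finset.sum_le_sum fun t ht => ?_
  rw [← Finset.sum_filter, Finset.sum_const, nsmul_eq_mul]
  refine mul_le_mul_of_nonneg_right ?_ (hφ t ht)
  have hpos : (0 : ℝ) < ((∑ i, d i : ℕ) : ℝ) - 2 * r := by
    have : ((2 * r : ℕ) : ℝ) < ((∑ i, d i : ℕ) : ℝ) := Nat.cast_lt.2 hN
    push_cast at this ⊢
    linarith
  rw [← div_eq_mul_inv, le_div_iff₀ (pow_pos hpos r)]
  have key := (Nat.cast_le (α := ℝ)).2 (card_contains_mul_le_card (M t) (hM t ht))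
  rw [hr t ht] at key
  have e : (((∑ i, d i) - 2 * r : ℕ) : ℝ) = ((∑ i, d i : ℕ) : ℝ) - 2 * r := by
    rw [Nat.cast_sub hN.le]; push_cast; ring
  rw [Nat.cast_mul, Nat.cast_pow, e] at key
  exact le_of_eq_of_le (by congr!) key

theorem sum_partner_le (F : HalfEdge d → HalfEdge d → ℝ) (hF : ∀ z w, 0 ≤ F z w)
    (hN : 2 < ∑ i, d i) :
    ∑ γ : Configuration d, ∑ z, F z (γ.partner z) ≤
      Fintype.card (Configuration d) * (((∑ i, d i : ℕ) : ℝ) - 2)⁻¹ * ∑ z, ∑ w, F z w := by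
  classical
  have h := sum_weight_contains_le (d := d)
    (Finset.univ.filter fun p : HalfEdge d × HalfEdge d => p.1 ≠ p.2) (fun p => F p.1 p.2)
    (fun p _ => hF _ _) (fun p => [p]) 1 (fun p _ => rfl) (by
      intro p hp
      simpa using hp) (by simpa using hN)
  rw [pow_one, Nat.cast_one, mul_one] at h
  have hle : ∑ p ∈ Finset.univ.filter (fun p : HalfEdge d × HalfEdge d => p.1 ≠ p.2), F p.1 p.2 ≤
      ∑ z, ∑ w, F z w := by
    rw [← Fintype.sum_prod_type']
    exact Finset.sum_le_sum_of_subset_of_nonneg (Finset.filter_subset _ _) fun p _ _ => hF _ _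
  have h0 : (0 : ℝ) ≤ (((∑ i, d i : ℕ) : ℝ) - 2)⁻¹ := by
    have : (2 : ℝ) < ((∑ i, d i : ℕ) : ℝ) := by exact_mod_cast hN
    rw [inv_nonneg]; linarith
  refine le_trans (le_of_eq ?_) (h.trans (mul_le_mul_of_nonneg_left hle (by positivity)))
  refine Finset.sum_congr rfl fun γ _ => ?_
  rw [Finset.sum_filter, Fintype.sum_prod_type]
  refine Finset.sum_congr rfl fun z _ => ?_
  rw [Finset.sum_eq_single (γ.partner z)]
  · simp [Contains]
  · intro w _ hw
    simp [Contains, hw.symm]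
  · simp

/-- Restricting h to `γ.others z` means that the two edges are distinct, so that together they form
a partial matching with r = 2. -/
theorem sum_partner_partner_le (F : HalfEdge d → HalfEdge d → HalfEdge d → HalfEdge d → ℝ)
    (hF : ∀ z w h w', 0 ≤ F z w h w') (hN : 4 < ∑ i, d i) :
    ∑ γ : Configuration d, ∑ z, ∑ h ∈ γ.others z, F z (γ.partner z) h (γ.partner h) ≤
      Fintype.card (Configuration d) * ((((∑ i, d i : ℕ) : ℝ) - 4) ^ 2)⁻¹ *
        ∑ z, ∑ h, ∑ w, ∑ w', F z w h w' := by
  classical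
  have h := sum_weight_contains_le (d := d)
    (Finset.univ.filter fun p : (HalfEdge d × HalfEdge d) × HalfEdge d × HalfEdge d =>
      (support [(p.1.1, p.2.1), (p.1.2, p.2.2)]).Nodup)
    (fun p => F p.1.1 p.2.1 p.1.2 p.2.2)
    (fun p _ => hF _ _ _ _) (fun p => [(p.1.1, p.2.1), (p.1.2, p.2.2)]) 2 (fun p _ => rfl) (by
      intro p hp
      exact (Finset.mem_filter.1 hp).2) (by simpa using hN)
  have e2 : (2 * ((2 : ℕ) : ℝ)) = 4 := by norm_num
  rw [e2] at h
  have hle : ∑ p ∈ Finset.univ.filter (fun p : (HalfEdge d × HalfEdge d) × HalfEdge d × HalfEdge d =>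
      (support [(p.1.1, p.2.1), (p.1.2, p.2.2)]).Nodup), F p.1.1 p.2.1 p.1.2 p.2.2 ≤
      ∑ z, ∑ h, ∑ w, ∑ w', F z w h w' := by
    refine (Finset.sum_le_sum_of_subset_of_nonneg (Finset.filter_subset _ _)
      fun p _ _ => hF _ _ _ _).trans (le_of_eq ?_)
    simp only [Fintype.sum_prod_type]
  refine le_trans (le_of_eq ?_) (h.trans (mul_le_mul_of_nonneg_left hle (by positivity)))
  refine Finset.sum_congr rfl fun γ _ => ?_
  rw [Finset.sum_filter, Fintype.sum_prod_type, Fintype.sum_prod_type]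
  refine Finset.sum_congr rfl fun z _ => ?_
  rw [others, Finset.sum_filter]
  refine Finset.sum_congr rfl fun h _ => ?_
  rw [Finset.sum_eq_single (γ.partner z, γ.partner h)]
  · have hc : γ.Contains [(z, γ.partner z), (h, γ.partner h)] := by simp [Contains]
    have hn : (support [(z, γ.partner z), (h, γ.partner h)]).Nodup ↔
        h ≠ z ∧ h ≠ γ.partner z := by
      simp only [support_cons, support_nil, List.nodup_cons, List.mem_cons, List.not_mem_nil,
        or_false, not_or, not_false_eq_true, List.nodup_nil, and_true, ne_partner, partner_inj,
        true_and]
      have e1 : γ.partner z = h ↔ z = γ.partner h := γ.partner_eq_iff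
      have e2 : h = γ.partner z ↔ γ.partner z = h := eq_comm
      have e3 : h = z ↔ z = h := eq_comm
      tauto
    simp only [hc, if_true, hn]
  · rintro ⟨w, w'⟩ _ hw
    split_ifs with h1 h2
    · exfalso
      apply hw
      simp only [Contains, List.mem_cons, List.not_mem_nil, or_false, forall_eq_or_imp,
        forall_eq] at h2
      rw [h2.1, h2.2]
    · rfl
    · rfl
  · simp

/-- The number of paths of length three with a marked middle edge. -/
def pathCount (γ : Configuration d) : ℕ := ∑ z, (d z.1 - 1) * (d (γ.partner z).1 - 1)

theorem sum_sub_one : ∑ z : HalfEdge d, (d z.1 - 1) = pairCount d := by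
  rw [sum_halfEdge (fun i => d i - 1), pairCount]
  simp

theorem sum_degree : ∑ z : HalfEdge d, d z.1 = pairCount d + ∑ i, d i := by
  have : ∀ z : HalfEdge d, d z.1 = (d z.1 - 1) + 1 := by
    intro z
    have := z.2.pos
    omega
  rw [Finset.sum_congr rfl fun z _ => this z, Finset.sum_add_distrib, sum_sub_one]
  simp

theorem sum_sub_one_sq_le : ∑ z : HalfEdge d, (d z.1 - 1) ^ 2 ≤ maxDegree d * pairCount d := by
  rw [← sum_sub_one, Finset.mul_sum]
  refine Finset.sum_le_sum fun z _ => ?_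
  rw [sq]
  have := le_maxDegree d z.1
  gcongr
  omega

theorem sum_degree_sq_le :
    ∑ z : HalfEdge d, d z.1 ^ 2 ≤ maxDegree d * (pairCount d + ∑ i, d i) := by
  rw [← sum_degree, Finset.mul_sum]
  refine Finset.sum_le_sum fun z _ => ?_
  rw [sq]
  have := le_maxDegree d z.1
  gcongr

open Classical in
/-- The probability that two given half-edges are matched. -/
theorem card_partner_eq_ge {z w : HalfEdge d} (h : z ≠ w) :
    Fintype.card (Configuration d) ≤
      (Finset.univ.filter fun γ : Configuration d => γ.partner z = w).card * ((∑ i, d i) - 1) := by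
  have hle : ∀ w : HalfEdge d, w ≠ z →
      (Finset.univ.filter fun γ : Configuration d => γ.partner z = w).card * ((∑ i, d i) - 1) ≤
      Fintype.card (Configuration d) := by
    intro w hw
    have := card_partner_eq_mul_le (d := d) (fun _ => True) z w ∅ (by simp) (by simp)
    simpa using this
  have hsum : ∑ w ∈ Finset.univ.erase z,
      (Finset.univ.filter fun γ : Configuration d => γ.partner z = w).card =
      Fintype.card (Configuration d) := by
    rw [← Finset.card_eq_sum_card_fiberwise (f := fun γ : Configuration d => γ.partner z)
      (s := Finset.univ), Finset.card_univ]
    intro γ _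
    simp
  have hw : w ∈ Finset.univ.erase z := by simp [h.symm]
  rw [← Finset.add_sum_erase _ _ hw] at hsum
  have hN : (Finset.univ.erase z).card = (∑ i, d i) - 1 := by
    rw [Finset.card_erase_of_mem (Finset.mem_univ _)]; simp
  have hN2 : ((Finset.univ.erase z).erase w).card = (∑ i, d i) - 2 := by
    rw [Finset.card_erase_of_mem hw, hN]; omega
  have hpos : 1 ≤ (∑ i, d i) - 1 := by
    rw [← hN]; exact Finset.card_pos.2 ⟨w, hw⟩
  set c := (Finset.univ.filter fun γ : Configuration d => γ.partner z = w).card with hc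
  set Z := Fintype.card (Configuration d) with hZ
  -- Each of the N - 1 possible partners of z has at most a share 1/(N - 1) of the configurations,
  -- so the upper bounds for the other N - 2 leave at least that share for w.
  have h1 : (∑ w ∈ (Finset.univ.erase z).erase w,
      (Finset.univ.filter fun γ : Configuration d => γ.partner z = w).card) * ((∑ i, d i) - 1) ≤
      ((∑ i, d i) - 2) * Z := by
    rw [Finset.sum_mul, ← hN2]
    refine (Finset.sum_le_card_nsmul _ _ Z fun v hv => hle v ?_).trans_eq (smul_eq_mul _ _)
    exact Finset.ne_of_mem_erase (Finset.mem_of_mem_erase hv)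
  have h2 := congrArg (· * ((∑ i, d i) - 1)) hsum
  simp only [add_mul] at h2
  obtain ⟨k, hk⟩ : ∃ k, (∑ i, d i) - 1 = k + 1 := ⟨(∑ i, d i) - 2, by omega⟩
  have hk2 : (∑ i, d i) - 2 = k := by omega
  rw [hk2] at h1
  rw [hk] at h1 h2 ⊢
  nlinarith

end Moments

/-! ### Creating switchings in a simple configuration -/

section CreatingMoves

variable {n : ℕ} {d : Fin n → ℕ}

open Configuration

/-- The edges around a potential triangle, given by the pairs of half-edges at its corners. -/
def triangleEdges (p : (HalfEdge d × HalfEdge d) × (HalfEdge d × HalfEdge d) ×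
    (HalfEdge d × HalfEdge d)) : List (HalfEdge d × HalfEdge d) :=
  [(p.1.2, p.2.1.1), (p.2.1.2, p.2.2.1), (p.2.2.2, p.1.1)]

/-- The edges around a potential four-cycle, given by the pairs of half-edges at its corners. -/
def squareEdges (p : (HalfEdge d × HalfEdge d) × (HalfEdge d × HalfEdge d) ×
    (HalfEdge d × HalfEdge d) × (HalfEdge d × HalfEdge d)) : List (HalfEdge d × HalfEdge d) :=
  [(p.1.2, p.2.1.1), (p.2.1.2, p.2.2.1.1), (p.2.2.1.2, p.2.2.2.1), (p.2.2.2.2, p.1.1)]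

variable (d) in
/-- The potential triangles. -/
def potentialTriangles : Finset ((HalfEdge d × HalfEdge d) × (HalfEdge d × HalfEdge d) ×
    (HalfEdge d × HalfEdge d)) :=
  (siblingPairs d ×ˢ siblingPairs d ×ˢ siblingPairs d).filter fun p => (support (triangleEdges p)).Nodup

variable (d) in
/-- The potential four-cycles. -/
def potentialSquares : Finset ((HalfEdge d × HalfEdge d) × (HalfEdge d × HalfEdge d) ×
    (HalfEdge d × HalfEdge d) × (HalfEdge d × HalfEdge d)) :=
  (siblingPairs d ×ˢ siblingPairs d ×ˢ siblingPairs d ×ˢ siblingPairs d).filter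
    fun p => (support (squareEdges p)).Nodup

open Classical in
/-- The triangles of a configuration. -/
noncomputable def triangles (γ : Configuration d) :=
  (potentialTriangles d).filter fun p => γ.Contains (triangleEdges p)

open Classical in
/-- The four-cycles of a configuration. -/
noncomputable def squares (γ : Configuration d) :=
  (potentialSquares d).filter fun p => γ.Contains (squareEdges p)

/-- The sum of the degrees of the neighbours of a vertex. -/
def neighbourDegree (γ : Configuration d) (z : HalfEdge d) : ℕ :=
  ∑ h ∈ siblings z, d (γ.partner h).1

/-- The number of edges, weighted by the degrees of their ends and by the degrees of the neighbours
of one of their ends. -/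
noncomputable def edgeWeight (γ : Configuration d) : ℕ :=
  ∑ z, d z.1 * d (γ.partner z).1 ^ 2 +
    ∑ z, ∑ h ∈ γ.others z, if h.1 = z.1 then d z.1 * d (γ.partner z).1 * d (γ.partner h).1 else 0

theorem siblings_eq {z w : HalfEdge d} (h : z.1 = w.1) : siblings z = siblings w := by
  ext x; simp [h]

theorem neighbourDegree_eq (γ : Configuration d) {z w : HalfEdge d} (h : z.1 = w.1) :
    neighbourDegree γ z = neighbourDegree γ w := by
  rw [neighbourDegree, siblings_eq h]; rfl

/-- The term h = z of `neighbourDegree` gives the first sum in `edgeWeight`. The other siblings lie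
in `σ.others z`, because a simple configuration has no loop. -/
theorem sum_neighbourDegree_le {σ : Configuration d} (hσ : σ.IsSimple) :
    ∑ z, d z.1 * d (σ.partner z).1 * neighbourDegree σ z ≤ edgeWeight σ := by
  rw [edgeWeight, ← Finset.sum_add_distrib]
  refine Finset.sum_le_sum fun z _ => ?_
  rw [neighbourDegree, ← Finset.add_sum_erase _ _ (show z ∈ siblings z by simp), mul_add]
  refine add_le_add (by rw [sq, mul_assoc]) ?_
  rw [Finset.mul_sum, ← Finset.sum_filter]
  refine Finset.sum_le_sum_of_subset fun h hh => ?_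
  simp only [Finset.mem_erase, mem_siblings] at hh
  rw [Finset.mem_filter, mem_others]
  refine ⟨⟨hh.1, fun e => ?_⟩, hh.2⟩
  rw [e] at hh
  exact hσ.ne z hh.2.symm

theorem triangle_mem {σ : Configuration d} (hσ : σ.IsSimple) {a b c : HalfEdge d}
    (h1 : (σ.partner a).1 = b.1) (h2 : (σ.partner b).1 = c.1) (h3 : (σ.partner c).1 = a.1) :
    ((σ.partner c, a), (σ.partner a, b), (σ.partner b, c)) ∈ triangles σ := by
  have key : ∀ {a b c : HalfEdge d}, (σ.partner a).1 = b.1 → (σ.partner b).1 = c.1 →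
      a ≠ σ.partner c := by
    rintro a b c h1 h2 rfl
    rw [partner_partner] at h1
    exact hσ.ne b (h1.symm.trans h2.symm)
  have m1 := key h1 h2
  have m2 := key h2 h3
  have m3 := key h3 h1
  have n1 := hσ.ne a
  have n2 := hσ.ne b
  have n3 := hσ.ne c
  simp only [triangles, potentialTriangles, Finset.mem_filter, Finset.mem_product,
    mem_siblingPairs]
  refine ⟨⟨⟨⟨h3.symm, m1⟩, ⟨h1.symm, m2⟩, ⟨h2.symm, m3⟩⟩, ?_⟩, ?_⟩
  · have hv : ∀ {x y : HalfEdge d}, x.1 ≠ y.1 → x ≠ y := fun h e => h (e ▸ rfl)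
    simp only [triangleEdges, support_cons, support_nil, List.nodup_cons, List.mem_cons,
      List.not_mem_nil, or_false, not_or, not_false_eq_true, List.nodup_nil, and_true,
      ne_partner, true_and]
    refine ⟨⟨hv ?_, hv ?_, hv ?_, m1⟩, ⟨m2.symm, hv ?_, hv ?_, hv ?_⟩, ⟨hv ?_, hv ?_⟩, m3.symm, hv ?_⟩ <;>
      grind
  · simp [triangleEdges, Contains]

theorem square_mem {σ : Configuration d} (hσ : σ.IsSimple) {a b c e : HalfEdge d}
    (h1 : (σ.partner a).1 = b.1) (h2 : (σ.partner b).1 = c.1) (h3 : (σ.partner c).1 = e.1)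
    (h4 : (σ.partner e).1 = a.1) (h5 : a.1 ≠ c.1) (h6 : b.1 ≠ e.1) :
    ((σ.partner e, a), (σ.partner a, b), (σ.partner b, c), (σ.partner c, e)) ∈ squares σ := by
  have key : ∀ {a b e : HalfEdge d}, (σ.partner a).1 = b.1 → b.1 ≠ e.1 → a ≠ σ.partner e := by
    rintro a b e h1 h2 rfl
    rw [partner_partner] at h1
    exact h2 h1.symm
  have m1 := key h1 h6
  have m2 := key h2 h5.symm
  have m3 := key h3 h6.symm
  have m4 := key h4 h5
  have n1 := hσ.ne a
  have n2 := hσ.ne b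
  have n3 := hσ.ne c
  have n4 := hσ.ne e
  simp only [squares, potentialSquares, Finset.mem_filter, Finset.mem_product,
    mem_siblingPairs]
  refine ⟨⟨⟨⟨h4.symm, m1⟩, ⟨h1.symm, m2⟩, ⟨h2.symm, m3⟩, ⟨h3.symm, m4⟩⟩, ?_⟩, ?_⟩
  · have hv : ∀ {x y : HalfEdge d}, x.1 ≠ y.1 → x ≠ y := fun h e => h (e ▸ rfl)
    simp only [squareEdges, support_cons, support_nil, List.nodup_cons, List.mem_cons,
      List.not_mem_nil, or_false, not_or, not_false_eq_true, List.nodup_nil, and_true,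
      ne_partner, true_and]
    refine ⟨⟨hv ?_, hv ?_, hv ?_, hv ?_, hv ?_, m1⟩,
      ⟨m2.symm, hv ?_, hv ?_, hv ?_, hv ?_, hv ?_⟩, ⟨hv ?_, hv ?_, hv ?_, hv ?_⟩,
      ⟨m3.symm, hv ?_, hv ?_, hv ?_⟩, ⟨hv ?_, hv ?_⟩, m4.symm, hv ?_⟩ <;>
      grind
  · simp [squareEdges, Contains]

/-- The edges of a configuration together with a second half-edge at both of their ends. -/
def doublePaths (σ : Configuration d) : Finset (Σ _ : HalfEdge d, HalfEdge d × HalfEdge d) :=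
  Finset.univ.sigma fun z => (siblings z).erase z ×ˢ (siblings (σ.partner z)).erase (σ.partner z)

theorem card_doublePaths (σ : Configuration d) : (doublePaths σ).card = pathCount σ := by
  rw [doublePaths, Finset.card_sigma, pathCount]
  refine Finset.sum_congr rfl fun z _ => ?_
  rw [Finset.card_product, card_erase_siblings, card_erase_siblings]

theorem mem_doublePaths {σ : Configuration d} {p : Σ _ : HalfEdge d, HalfEdge d × HalfEdge d} :
    p ∈ doublePaths σ ↔ (p.2.1 ≠ p.1 ∧ p.2.1.1 = p.1.1) ∧
      p.2.2 ≠ σ.partner p.1 ∧ p.2.2.1 = (σ.partner p.1).1 := by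
  simp [doublePaths]

/-- For siblings x, x' with partners y, k, the switching turns {x, y} and {k, x'} into the loop {x,
x'} and {k, y}. By simplicity y and k lie at different vertices, so non-adjacency is the only
condition left. -/
theorem creates_loop {σ : Configuration d} (hσ : σ.IsSimple) {p : HalfEdge d × HalfEdge d}
    (hp : p ∈ siblingPairs d) (h : ¬ σ.Adj (σ.partner p.2).1 (σ.partner p.1).1) (t : Bool) :
    σ.Creates ∅ (p.1, σ.partner p.2, t) := by
  obtain ⟨h1, h2⟩ := mem_siblingPairs.1 hp
  have n1 := hσ.ne p.1
  have n2 := hσ.ne p.2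
  refine ⟨Finset.disjoint_empty_right _, ?_, n1, ?_, ?_, ?_, h, Or.inl ?_⟩
  · simp only; rw [← h1]; exact n2
  · simp only [partner_partner]; exact n2
  · simp only [partner_partner]; rw [h1]; exact n1
  · simp only; exact fun e => h2 (hσ.eq h1 e)
  · simp only [partner_partner]; exact h1.symm

/-- The half-edges x and y sit at the two ends of the edge z; switching their edges joins x to y, in
parallel to z. -/
theorem creates_double {σ : Configuration d} (hσ : σ.IsSimple)
    {p : Σ _ : HalfEdge d, HalfEdge d × HalfEdge d} (hp : p ∈ doublePaths σ)
    (h₁ : (σ.partner p.2.2).1 ≠ (σ.partner p.2.1).1)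
    (h : ¬ σ.Adj (σ.partner p.2.2).1 (σ.partner p.2.1).1) :
    σ.Creates ∅ (p.2.1, σ.partner p.2.2, false) := by
  obtain ⟨z, x, y⟩ := p
  obtain ⟨⟨a1, a2⟩, b1, b2⟩ := mem_doublePaths.1 hp
  simp only at a1 a2 b1 b2 h₁ h ⊢
  have n1 := hσ.ne x
  have n2 := hσ.ne y
  refine ⟨Finset.disjoint_empty_right _, ?_, n1, ?_, ?_, h₁, h, Or.inr ⟨rfl, z, a2.symm, ?_⟩⟩
  · intro e
    refine b1 (hσ.eq b2 ?_)
    rw [partner_partner, ← a2]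
    exact e.symm
  · simp only [partner_partner]; exact n2
  · simp only [partner_partner]
    intro e
    refine a1 (hσ.eq a2 ?_)
    rw [← b2]
    exact e.symm
  · simp only [partner_partner]; exact b2.symm

open Classical in
theorem card_adjacent_siblingPairs_le {σ : Configuration d} (hσ : σ.IsSimple) :
    ((siblingPairs d).filter fun p => σ.Adj (σ.partner p.2).1 (σ.partner p.1).1).card ≤
      (triangles σ).card := by
  refine (Finset.card_le_card ?_).trans (Finset.card_image_le (f := Prod.fst))
  intro p hp
  rw [Finset.mem_filter, mem_siblingPairs] at hp
  obtain ⟨⟨h1, h2⟩, z, h3, h4⟩ := hp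
  refine Finset.mem_image.2 ⟨_, triangle_mem hσ (a := p.2) (b := z) (c := σ.partner p.1) h3.symm h4
    (by simpa using h1.symm), by simp⟩

-- The outer ends of the path fail to be usable only if they coincide, which closes a triangle, or
-- are adjacent, which closes a four-cycle.
open Classical in
theorem card_adjacent_doublePaths_le {σ : Configuration d} (hσ : σ.IsSimple) :
    ((doublePaths σ).filter fun p => (σ.partner p.2.2).1 = (σ.partner p.2.1).1 ∨
      σ.Adj (σ.partner p.2.2).1 (σ.partner p.2.1).1).card ≤
      (triangles σ).card + (squares σ).card := by
  refine (Finset.card_le_card ?_).trans ((Finset.card_union_le _ _).trans (add_le_add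
    (Finset.card_image_le (s := triangles σ)
      (f := fun q => (⟨q.1.1, q.1.2, q.2.2.1⟩ : Σ _ : HalfEdge d, HalfEdge d × HalfEdge d)))
    (Finset.card_image_le (s := squares σ)
      (f := fun q => (⟨q.1.1, q.1.2, q.2.2.2.1⟩ : Σ _ : HalfEdge d, HalfEdge d × HalfEdge d)))))
  rintro ⟨z, x, y⟩ hp
  rw [Finset.mem_filter, mem_doublePaths] at hp
  obtain ⟨⟨⟨a1, a2⟩, b1, b2⟩, h⟩ := hp
  simp only at a1 a2 b1 b2 h
  rw [Finset.mem_union]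
  by_cases h' : (σ.partner y).1 = (σ.partner x).1
  · left
    refine Finset.mem_image.2 ⟨_, triangle_mem hσ (a := x) (b := σ.partner y) (c := σ.partner z)
      h'.symm (by simpa using b2) (by simpa using a2.symm), by simp⟩
  · right
    obtain ⟨w, hw1, hw2⟩ := h.resolve_left h'
    refine Finset.mem_image.2 ⟨_, square_mem hσ (a := x) (b := σ.partner w) (c := σ.partner y)
      (e := σ.partner z) hw2.symm (by simpa using hw1) (by simpa using b2) (by simpa using a2.symm)
      ?_ ?_, by simp⟩
    · intro e
      refine b1 (hσ.eq b2 ?_)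
      rw [partner_partner, ← a2]
      exact e.symm
    · rw [hw2]
      intro e
      exact a1 (hσ.eq a2 e)

/-- The set of half-edges on the edges at `v`. -/
noncomputable def halfEdgesNear (σ : Configuration d) (v : Fin n) : Finset (HalfEdge d) :=
  Finset.univ.filter fun z => z.1 = v ∨ (σ.partner z).1 = v

theorem card_halfEdgesNear_le (σ : Configuration d) (v : Fin n) :
    (halfEdgesNear σ v).card ≤ 2 * maxDegree d := by
  rw [halfEdgesNear, Finset.filter_or]
  refine (Finset.card_union_le _ _).trans ?_
  have h1 : (Finset.univ.filter fun z : HalfEdge d => z.1 = v).card ≤ maxDegree d :=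
    (card_halfEdges_at v).le.trans (le_maxDegree d v)
  have h2 : (Finset.univ.filter fun z : HalfEdge d => (σ.partner z).1 = v).card ≤ maxDegree d := by
    refine le_trans ?_ h1
    refine Finset.card_le_card_of_injOn σ.partner ?_ ?_
    · intro z hz
      simpa using hz
    · intro a _ b _ e
      exact σ.partner_inj.1 e
  omega

/-- The paths of length three at whose ends the sums of the degrees of the neighbours are not too
large. -/
noncomputable def lightPaths (σ : Configuration d) (ρ : ℝ) :
    Finset (Σ _ : HalfEdge d, HalfEdge d × HalfEdge d) := by
  classical
  exact (doublePaths σ).filter fun p =>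
    (neighbourDegree σ p.1 : ℝ) ≤ ρ ∧ (neighbourDegree σ (σ.partner p.1) : ℝ) ≤ ρ

-- Given x, it remains to choose the middle edge at the vertex of x and a half-edge at its far end.
-- The number of ways is at most the sum of the degrees of the neighbours, and a light path requires
-- this to be at most ρ.
open Classical in
theorem card_lightPaths_through_le (σ : Configuration d) {ρ : ℝ} (hρ : 0 ≤ ρ) (x : HalfEdge d) :
    (((lightPaths σ ρ).filter fun p => p.2.1 = x).card : ℝ) ≤ ρ ∧
    (((lightPaths σ ρ).filter fun p => p.2.2 = x).card : ℝ) ≤ ρ := by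
  constructor
  · by_cases hx : (neighbourDegree σ x : ℝ) ≤ ρ
    · refine le_trans (Nat.cast_le.2 ?_) hx
      have hs : ((lightPaths σ ρ).filter fun p => p.2.1 = x) ⊆
          ((siblings x).sigma fun z => siblings (σ.partner z)).image
            fun q => (⟨q.1, x, q.2⟩ : Σ _ : HalfEdge d, HalfEdge d × HalfEdge d) := by
        rintro ⟨z, x', y⟩ hp
        simp only [lightPaths, Finset.mem_filter, mem_doublePaths] at hp
        obtain ⟨⟨⟨⟨-, h1⟩, -, h2⟩, -⟩, rfl⟩ := hp
        refine Finset.mem_image.2 ⟨⟨z, y⟩, ?_, rfl⟩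
        simp only [Finset.mem_sigma, mem_siblings]
        exact ⟨h1.symm, h2⟩
      refine (Finset.card_le_card hs).trans (Finset.card_image_le.trans ?_)
      rw [Finset.card_sigma, neighbourDegree]
      simp only [card_siblings]
      exact le_rfl
    · rw [Finset.card_eq_zero.2]
      · simpa using hρ
      · rw [Finset.filter_eq_empty_iff]
        rintro ⟨z, x', y⟩ hp rfl
        simp only [lightPaths, Finset.mem_filter, mem_doublePaths] at hp
        apply hx
        rw [neighbourDegree_eq σ hp.1.1.2]
        exact hp.2.1
  · by_cases hx : (neighbourDegree σ x : ℝ) ≤ ρ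
    · refine le_trans (Nat.cast_le.2 ?_) hx
      have hs : ((lightPaths σ ρ).filter fun p => p.2.2 = x) ⊆
          ((siblings x).sigma fun z => siblings (σ.partner z)).image
            fun q => (⟨σ.partner q.1, q.2, x⟩ : Σ _ : HalfEdge d, HalfEdge d × HalfEdge d) := by
        rintro ⟨z, x', y⟩ hp
        simp only [lightPaths, Finset.mem_filter, mem_doublePaths] at hp
        obtain ⟨⟨⟨⟨-, h1⟩, -, h2⟩, -⟩, rfl⟩ := hp
        refine Finset.mem_image.2 ⟨⟨σ.partner z, x'⟩, ?_, by simp⟩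
        simp only [Finset.mem_sigma, mem_siblings, partner_partner]
        exact ⟨h2.symm, h1⟩
      refine (Finset.card_le_card hs).trans (Finset.card_image_le.trans ?_)
      rw [Finset.card_sigma, neighbourDegree]
      simp only [card_siblings]
      exact le_rfl
    · rw [Finset.card_eq_zero.2]
      · simpa using hρ
      · rw [Finset.filter_eq_empty_iff]
        rintro ⟨z, x', y⟩ hp rfl
        simp only [lightPaths, Finset.mem_filter, mem_doublePaths] at hp
        apply hx
        rw [neighbourDegree_eq σ hp.1.2.2]
        exact hp.2.2

-- Markov's inequality for `neighbourDegree`, with each edge weighted by its number of paths.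
-- Reversing the paths treats the other end, hence the factor 2.
open Classical in
theorem card_heavyPaths_le {σ : Configuration d} (hσ : σ.IsSimple) {ρ : ℝ} (hρ : 0 < ρ) :
    (pathCount σ : ℝ) ≤ (lightPaths σ ρ).card + 2 * (edgeWeight σ / ρ) := by
  have hheavy : (((doublePaths σ).filter fun p => ¬ (neighbourDegree σ p.1 : ℝ) ≤ ρ).card : ℝ) ≤
      edgeWeight σ / ρ := by
    rw [le_div_iff₀ hρ]
    have e := (Nat.cast_le (α := ℝ)).2 (sum_neighbourDegree_le hσ)
    refine le_trans ?_ e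
    rw [Finset.card_filter, doublePaths, Finset.sum_sigma]
    push_cast
    rw [Finset.sum_mul]
    refine Finset.sum_le_sum fun z _ => ?_
    simp only [Finset.sum_const, nsmul_eq_mul, Finset.card_product, card_erase_siblings]
    split_ifs with h
    · simp only [mul_zero, zero_mul]; positivity
    · rw [not_le] at h
      have h1 : (((d z.1 - 1) * (d (σ.partner z).1 - 1) : ℕ) : ℝ) ≤
          ((d z.1 * d (σ.partner z).1 : ℕ) : ℝ) :=
        Nat.cast_le.2 (Nat.mul_le_mul (Nat.sub_le _ _) (Nat.sub_le _ _))
      rw [mul_one]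
      refine (mul_le_mul h1 h.le hρ.le (Nat.cast_nonneg _)).trans_eq ?_
      push_cast; ring
  have hheavy' : ((doublePaths σ).filter
      fun p => ¬ (neighbourDegree σ (σ.partner p.1) : ℝ) ≤ ρ).card ≤
      ((doublePaths σ).filter fun p => ¬ (neighbourDegree σ p.1 : ℝ) ≤ ρ).card := by
    refine Finset.card_le_card_of_injOn
      (fun p => (⟨σ.partner p.1, p.2.2, p.2.1⟩ : Σ _ : HalfEdge d, HalfEdge d × HalfEdge d)) ?_ ?_
    · rintro ⟨z, x, y⟩ hp
      simp only [Finset.coe_filter, Set.mem_ofPred_eq, mem_doublePaths, partner_partner] at hp ⊢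
      tauto
    · rintro ⟨z, x, y⟩ _ ⟨z', x', y'⟩ _ e
      simp only [Sigma.mk.injEq, partner_inj, heq_eq_eq, Prod.mk.injEq] at e ⊢
      tauto
  have hsplit : (doublePaths σ).card ≤ (lightPaths σ ρ).card +
      (((doublePaths σ).filter fun p => ¬ (neighbourDegree σ p.1 : ℝ) ≤ ρ).card +
      ((doublePaths σ).filter fun p => ¬ (neighbourDegree σ (σ.partner p.1) : ℝ) ≤ ρ).card) := by
    refine le_trans (Finset.card_le_card ?_) ((Finset.card_union_le _ _).trans
      (Nat.add_le_add_left (Finset.card_union_le _ _) _))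
    intro p hp
    simp only [lightPaths, Finset.mem_union, Finset.mem_filter]
    tauto
  rw [← card_doublePaths]
  have h2 := (Nat.cast_le (α := ℝ)).2 (hsplit.trans (Nat.add_le_add_left
    (Nat.add_le_add_left hheavy' _) _))
  push_cast at h2
  linarith

open Classical in
/-- In a simple configuration there are many switchings that create a loop or a double edge, and
they are spread over the vertices. -/
theorem exists_creating_moves {σ : Configuration d} (hσ : σ.IsSimple) {ρ : ℝ} (hρ : 0 < ρ) :
    ∃ 𝒢 : Finset (Move d), (∀ m ∈ 𝒢, σ.Creates ∅ m) ∧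
      (∀ v, ((𝒢.filter fun m => v ∈ σ.touched m).card : ℝ) ≤
        8 * (maxDegree d : ℝ) ^ 2 + 4 * maxDegree d * ρ) ∧
      2 * (pairCount d : ℝ) + pathCount σ ≤
        𝒢.card + 3 * (triangles σ).card + (squares σ).card + 2 * (edgeWeight σ / ρ) := by
  set L : Finset (HalfEdge d × HalfEdge d) :=
    (siblingPairs d).filter fun p => ¬ σ.Adj (σ.partner p.2).1 (σ.partner p.1).1 with hL
  set P : Finset (Σ _ : HalfEdge d, HalfEdge d × HalfEdge d) :=
    (lightPaths σ ρ).filter fun p => ¬ ((σ.partner p.2.2).1 = (σ.partner p.2.1).1 ∨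
      σ.Adj (σ.partner p.2.2).1 (σ.partner p.2.1).1) with hP
  set f : (HalfEdge d × HalfEdge d) × Bool → Move d := fun q => (q.1.1, σ.partner q.1.2, q.2) with hf
  set g : (Σ _ : HalfEdge d, HalfEdge d × HalfEdge d) → Move d :=
    fun p => (p.2.1, σ.partner p.2.2, false) with hg
  have hPsub : ∀ p ∈ P, p ∈ doublePaths σ := fun p hp =>
    (Finset.mem_filter.1 (Finset.mem_filter.1 hp).1).1
  -- Both marks are used for loops, which accounts for 2Q and not Q in the final count.
  have hcardf : ((L ×ˢ Finset.univ).image f).card = 2 * L.card := by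
    rw [Finset.card_image_of_injective, Finset.card_product, mul_comm]
    · rfl
    · rintro ⟨⟨a, b⟩, t⟩ ⟨⟨a', b'⟩, t'⟩ e
      simpa [hf, and_assoc] using e
  have hcardg : (P.image g).card = P.card := by
    rw [Finset.card_image_of_injOn]
    rintro ⟨z, x, y⟩ hp ⟨z', x', y'⟩ hp' e
    simp only [hg, Prod.mk.injEq, partner_inj, and_true] at e
    obtain ⟨rfl, rfl⟩ := e
    have h1 := mem_doublePaths.1 (hPsub _ hp)
    have h2 := mem_doublePaths.1 (hPsub _ hp')
    have : z = z' := hσ.eq (h1.1.2.symm.trans h2.1.2) (h1.2.2.symm.trans h2.2.2)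
    rw [this]
  have hdisj : Disjoint ((L ×ˢ Finset.univ).image f) (P.image g) := by
    rw [Finset.disjoint_left]
    intro m hm hm'
    obtain ⟨⟨⟨a, b⟩, t⟩, hq, rfl⟩ := Finset.mem_image.1 hm
    obtain ⟨⟨z, x, y⟩, hp, e⟩ := Finset.mem_image.1 hm'
    simp only [hf, hg, Prod.mk.injEq, partner_inj] at e
    obtain ⟨rfl, rfl, -⟩ := e
    have h1 := mem_doublePaths.1 (hPsub _ hp)
    have h2 := mem_siblingPairs.1 (Finset.mem_filter.1 (Finset.mem_product.1 hq).1).1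
    apply hσ.ne z
    rw [← h1.2.2, ← h1.1.2]
    exact h2.1.symm
  have hLcard : pairCount d ≤ L.card + (triangles σ).card := by
    have := card_adjacent_siblingPairs_le hσ
    have h2 : ((siblingPairs d).filter fun p =>
        σ.Adj (σ.partner p.2).1 (σ.partner p.1).1).card + L.card = (siblingPairs d).card := by
      refine Eq.trans ?_ (Finset.card_filter_add_card_filter_not (s := siblingPairs d)
        (fun p => σ.Adj (σ.partner p.2).1 (σ.partner p.1).1))
      rw [hL]
    rw [card_siblingPairs] at h2
    omega
  have hPcard : (lightPaths σ ρ).card ≤ P.card + ((triangles σ).card + (squares σ).card) := by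
    have := card_adjacent_doublePaths_le hσ
    have h2 : ((lightPaths σ ρ).filter fun p => (σ.partner p.2.2).1 = (σ.partner p.2.1).1 ∨
        σ.Adj (σ.partner p.2.2).1 (σ.partner p.2.1).1).card + P.card = (lightPaths σ ρ).card := by
      refine Eq.trans ?_ (Finset.card_filter_add_card_filter_not (s := lightPaths σ ρ)
        (fun p => (σ.partner p.2.2).1 = (σ.partner p.2.1).1 ∨
          σ.Adj (σ.partner p.2.2).1 (σ.partner p.2.1).1))
      rw [hP]
    have h3 : ((lightPaths σ ρ).filter fun p => (σ.partner p.2.2).1 = (σ.partner p.2.1).1 ∨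
        σ.Adj (σ.partner p.2.2).1 (σ.partner p.2.1).1).card ≤ _ :=
      (Finset.card_le_card (Finset.filter_subset_filter _
        (show lightPaths σ ρ ⊆ doublePaths σ from Finset.filter_subset _ _))).trans this
    omega
  refine ⟨(L ×ˢ Finset.univ).image f ∪ P.image g, ?_, ?_, ?_⟩
  · intro m hm
    rcases Finset.mem_union.1 hm with hm | hm
    · obtain ⟨q, hq, rfl⟩ := Finset.mem_image.1 hm
      have h2 := Finset.mem_filter.1 (Finset.mem_product.1 hq).1
      exact creates_loop hσ h2.1 h2.2 q.2
    · obtain ⟨p, hp, rfl⟩ := Finset.mem_image.1 hm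
      have h2 := (Finset.mem_filter.1 hp).2
      rw [not_or] at h2
      exact creates_double hσ (hPsub p hp) h2.1 h2.2
  · intro v
    set X := halfEdgesNear σ v with hX
    have hXc : (X.card : ℝ) ≤ 2 * maxDegree d := by exact_mod_cast card_halfEdgesNear_le σ v
    -- A touched vertex is an end of the edge of x or of the edge of y, so one of these half-edges
    -- is among the at most 2Δ near v.
    have hXmem : ∀ {x y : HalfEdge d} {t : Bool}, v ∈ σ.touched (x, σ.partner y, t) →
        x ∈ X ∨ y ∈ X := by
      intro x y t h
      simp only [touched, Finset.mem_insert, Finset.mem_singleton, partner_partner] at h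
      simp only [hX, halfEdgesNear, Finset.mem_filter, Finset.mem_univ, true_and]
      grind
    have hsub : ((L ×ˢ Finset.univ).image f ∪ P.image g).filter (fun m => v ∈ σ.touched m) ⊆
        ((((X.sigma fun x => siblings x).image fun q => (q.1, q.2)) ∪
          ((X.sigma fun x => siblings x).image fun q => (q.2, q.1))) ×ˢ Finset.univ).image f ∪
        ((X.biUnion fun x => (lightPaths σ ρ).filter fun p => p.2.1 = x) ∪
          (X.biUnion fun x => (lightPaths σ ρ).filter fun p => p.2.2 = x)).image g := by
      intro m hm
      rw [Finset.mem_filter, Finset.mem_union] at hm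
      obtain ⟨hm, hv⟩ := hm
      rw [Finset.mem_union]
      rcases hm with hm | hm
      · left
        obtain ⟨⟨⟨x, y⟩, t⟩, hq, rfl⟩ := Finset.mem_image.1 hm
        have h2 := mem_siblingPairs.1 (Finset.mem_filter.1 (Finset.mem_product.1 hq).1).1
        refine Finset.mem_image_of_mem f (Finset.mem_product.2 ⟨?_, Finset.mem_univ _⟩)
        rw [Finset.mem_union]
        rcases hXmem hv with h | h
        · left
          exact Finset.mem_image.2 ⟨⟨x, y⟩, Finset.mem_sigma.2 ⟨h, mem_siblings.2 h2.1⟩, rfl⟩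
        · right
          exact Finset.mem_image.2 ⟨⟨y, x⟩, Finset.mem_sigma.2 ⟨h, mem_siblings.2 h2.1.symm⟩, rfl⟩
      · right
        obtain ⟨p, hp, rfl⟩ := Finset.mem_image.1 hm
        have h2 := (Finset.mem_filter.1 hp).1
        refine Finset.mem_image_of_mem g ?_
        rw [Finset.mem_union]
        rcases hXmem hv with h | h
        · left
          exact Finset.mem_biUnion.2 ⟨_, h, Finset.mem_filter.2 ⟨h2, rfl⟩⟩
        · right
          exact Finset.mem_biUnion.2 ⟨_, h, Finset.mem_filter.2 ⟨h2, rfl⟩⟩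
    have hsig : (X.sigma fun x => siblings x).card ≤ X.card * maxDegree d := by
      rw [Finset.card_sigma]
      refine (Finset.sum_le_card_nsmul _ _ _ fun x _ => card_siblings_le x).trans_eq ?_
      rw [smul_eq_mul]
    have hbi : ∀ h : (Σ _ : HalfEdge d, HalfEdge d × HalfEdge d) → HalfEdge d,
        (∀ x, (((lightPaths σ ρ).filter fun p => h p = x).card : ℝ) ≤ ρ) →
        ((X.biUnion fun x => (lightPaths σ ρ).filter fun p => h p = x).card : ℝ) ≤ X.card * ρ := by
      intro h hh
      refine (Nat.cast_le.2 Finset.card_biUnion_le).trans ?_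
      push_cast
      refine (Finset.sum_le_card_nsmul _ _ _ fun x _ => hh x).trans_eq ?_
      rw [nsmul_eq_mul]
    have c1 : ((((((X.sigma fun x => siblings x).image fun q => (q.1, q.2)) ∪
          ((X.sigma fun x => siblings x).image fun q => (q.2, q.1))) ×ˢ
          (Finset.univ : Finset Bool)).image f).card : ℝ) ≤ 4 * (X.card * maxDegree d) := by
      have : (((((X.sigma fun x => siblings x).image fun q => (q.1, q.2)) ∪
          ((X.sigma fun x => siblings x).image fun q => (q.2, q.1))) ×ˢ
          (Finset.univ : Finset Bool)).image f).card ≤ 4 * (X.card * maxDegree d) := by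
        refine Finset.card_image_le.trans ?_
        rw [Finset.card_product]
        have a1 := Finset.card_union_le ((X.sigma fun x => siblings x).image fun q => (q.1, q.2))
          ((X.sigma fun x => siblings x).image fun q => (q.2, q.1))
        have a2 := Finset.card_image_le (s := X.sigma fun x => siblings x)
          (f := fun q => (q.1, q.2))
        have a3 := Finset.card_image_le (s := X.sigma fun x => siblings x)
          (f := fun q => (q.2, q.1))
        have a4 : (Finset.univ : Finset Bool).card = 2 := rfl
        rw [a4]
        omega
      exact_mod_cast this
    have c2 : ((((X.biUnion fun x => (lightPaths σ ρ).filter fun p => p.2.1 = x) ∪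
          (X.biUnion fun x => (lightPaths σ ρ).filter fun p => p.2.2 = x)).image g).card : ℝ) ≤
        X.card * ρ + X.card * ρ := by
      refine (Nat.cast_le.2 (Finset.card_image_le.trans (Finset.card_union_le _ _))).trans ?_
      push_cast
      exact add_le_add (hbi (fun p => p.2.1) fun x => (card_lightPaths_through_le σ hρ.le x).1)
        (hbi (fun p => p.2.2) fun x => (card_lightPaths_through_le σ hρ.le x).2)
    refine (Nat.cast_le.2 ((Finset.card_le_card hsub).trans (Finset.card_union_le _ _))).trans ?_
    push_cast
    refine (add_le_add c1 c2).trans ?_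
    have hD : (0 : ℝ) ≤ maxDegree d := Nat.cast_nonneg _
    nlinarith [mul_le_mul_of_nonneg_right hXc hD, mul_le_mul_of_nonneg_right hXc hρ.le]
  · rw [Finset.card_union_of_disjoint hdisj, hcardf, hcardg]
    have h1 := card_heavyPaths_le hσ hρ
    have h2 := (Nat.cast_le (α := ℝ)).2 hLcard
    have h3 := (Nat.cast_le (α := ℝ)).2 hPcard
    push_cast at h2 h3 ⊢
    linarith

end CreatingMoves

/-! ### Expectations of the error terms and concentration of the path count -/

section Expectations

variable {n : ℕ} {d : Fin n → ℕ}

open Configuration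

/-- There are at most Q³ potential triangles, each contained with probability at most (N - 6)⁻³ ≤
(2/N)³. -/
theorem sum_card_triangles_le {A : ℝ} (hN : 16 ≤ ∑ i, d i)
    (hQ : (pairCount d : ℝ) ≤ A * (∑ i, d i : ℕ)) :
    ∑ γ : Configuration d, ((triangles γ).card : ℝ) ≤
      Fintype.card (Configuration d) * (8 * A ^ 3) := by
  classical
  have h := sum_weight_contains_le (d := d) (potentialTriangles d) (fun _ => 1)
    (fun _ _ => zero_le_one) triangleEdges 3 (fun _ _ => rfl)
    (fun t ht => (Finset.mem_filter.1 ht).2) (by omega)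
  have hc : ((potentialTriangles d).card : ℝ) ≤ (pairCount d : ℝ) ^ 3 := by
    have : (potentialTriangles d).card ≤ (pairCount d) ^ 3 := by
      refine (Finset.card_filter_le _ _).trans_eq ?_
      simp only [Finset.card_product, card_siblingPairs]
      ring
    exact_mod_cast this
  have hN' : (16 : ℝ) ≤ (∑ i, d i : ℕ) := by exact_mod_cast hN
  have hQ0 : (0 : ℝ) ≤ pairCount d := Nat.cast_nonneg _
  calc _ = ∑ γ : Configuration d, ∑ t ∈ potentialTriangles d,
        (if γ.Contains (triangleEdges t) then (1 : ℝ) else 0) := by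
        refine Finset.sum_congr rfl fun γ _ => ?_
        rw [triangles, Finset.card_filter]
        push_cast
        rfl
    _ ≤ _ := le_of_eq_of_le (by congr!) h
    _ ≤ _ := by
        rw [mul_assoc]
        refine mul_le_mul_of_nonneg_left ?_ (Nat.cast_nonneg _)
        rw [Finset.sum_const, nsmul_eq_mul, mul_one]
        generalize ((∑ i, d i : ℕ) : ℝ) = N at *
        have h1 : N / 2 ≤ N - 2 * (3 : ℕ) := by push_cast; linarith
        have h0 : 0 < N - 2 * (3 : ℕ) := lt_of_lt_of_le (by linarith) h1
        rw [inv_mul_le_iff₀ (pow_pos h0 3)]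
        calc ((potentialTriangles d).card : ℝ) ≤ (A * N) ^ 3 :=
              hc.trans (pow_le_pow_left₀ hQ0 hQ 3)
          _ = (N / 2) ^ 3 * (8 * A ^ 3) := by ring
          _ ≤ _ := by
              have : 0 ≤ A := by
                by_contra hA
                nlinarith
              gcongr

theorem sum_card_squares_le {A : ℝ} (hN : 16 ≤ ∑ i, d i)
    (hQ : (pairCount d : ℝ) ≤ A * (∑ i, d i : ℕ)) :
    ∑ γ : Configuration d, ((squares γ).card : ℝ) ≤
      Fintype.card (Configuration d) * (16 * A ^ 4) := by
  classical
  have h := sum_weight_contains_le (d := d) (potentialSquares d) (fun _ => 1)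
    (fun _ _ => zero_le_one) squareEdges 4 (fun _ _ => rfl)
    (fun t ht => (Finset.mem_filter.1 ht).2) (by omega)
  have hc : ((potentialSquares d).card : ℝ) ≤ (pairCount d : ℝ) ^ 4 := by
    have : (potentialSquares d).card ≤ (pairCount d) ^ 4 := by
      refine (Finset.card_filter_le _ _).trans_eq ?_
      simp only [Finset.card_product, card_siblingPairs]
      ring
    exact_mod_cast this
  have hN' : (16 : ℝ) ≤ (∑ i, d i : ℕ) := by exact_mod_cast hN
  have hQ0 : (0 : ℝ) ≤ pairCount d := Nat.cast_nonneg _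
  calc _ = ∑ γ : Configuration d, ∑ t ∈ potentialSquares d,
        (if γ.Contains (squareEdges t) then (1 : ℝ) else 0) := by
        refine Finset.sum_congr rfl fun γ _ => ?_
        rw [squares, Finset.card_filter]
        push_cast
        rfl
    _ ≤ _ := le_of_eq_of_le (by congr!) h
    _ ≤ _ := by
        rw [mul_assoc]
        refine mul_le_mul_of_nonneg_left ?_ (Nat.cast_nonneg _)
        rw [Finset.sum_const, nsmul_eq_mul, mul_one]
        generalize ((∑ i, d i : ℕ) : ℝ) = N at *
        have h1 : N / 2 ≤ N - 2 * (4 : ℕ) := by push_cast; linarith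
        have h0 : 0 < N - 2 * (4 : ℕ) := lt_of_lt_of_le (by linarith) h1
        rw [inv_mul_le_iff₀ (pow_pos h0 4)]
        calc ((potentialSquares d).card : ℝ) ≤ (A * N) ^ 4 :=
              hc.trans (pow_le_pow_left₀ hQ0 hQ 4)
          _ = (N / 2) ^ 4 * (16 * A ^ 4) := by ring
          _ ≤ _ := by gcongr

theorem inv_sub_two_le {N : ℝ} (hN : 16 ≤ N) : (N - 2)⁻¹ ≤ 2 / N := by
  rw [inv_eq_one_div, div_le_div_iff₀ (by linarith) (by linarith)]; linarith

theorem inv_sub_four_sq_le {N : ℝ} (hN : 16 ≤ N) : ((N - 4) ^ 2)⁻¹ ≤ 4 / N ^ 2 := by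
  rw [inv_eq_one_div, div_le_div_iff₀ (by nlinarith) (by positivity)]; nlinarith

/-- After replacing matched pairs by all pairs, the sums factor into ∑ d ≤ (A + 1)N and ∑ d² ≤ Δ(A +
1)N over half-edges; only one factor Δ appears. -/
theorem sum_edgeWeight_le {A : ℝ} (hA : 0 < A) (hN : 16 ≤ ∑ i, d i)
    (hQ : (pairCount d : ℝ) ≤ A * (∑ i, d i : ℕ)) :
    ∑ γ : Configuration d, (edgeWeight γ : ℝ) ≤
      Fintype.card (Configuration d) *
        ((2 * (A + 1) ^ 2 + 4 * (A + 1) ^ 3) * (maxDegree d * (∑ i, d i : ℕ))) := by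
  classical
  have h1 := sum_partner_le (d := d) (fun z w => (d z.1 : ℝ) * (d w.1 : ℝ) ^ 2)
    (fun z w => by positivity) (by omega)
  have h2 := sum_partner_partner_le (d := d)
    (fun z w h w' => if h.1 = z.1 then (d z.1 : ℝ) * d w.1 * d w'.1 else 0)
    (fun z w h w' => by positivity) (by omega)
  have e1 : ∑ z : HalfEdge d, (d z.1 : ℝ) ≤ (A + 1) * (∑ i, d i : ℕ) := by
    have := congrArg (Nat.cast (R := ℝ)) (sum_degree (d := d))
    push_cast at this hQ ⊢
    rw [this]
    linarith
  have e2 : ∑ z : HalfEdge d, (d z.1 : ℝ) ^ 2 ≤ maxDegree d * ((A + 1) * (∑ i, d i : ℕ)) := by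
    have := (Nat.cast_le (α := ℝ)).2 (sum_degree_sq_le (d := d))
    push_cast at this hQ ⊢
    refine this.trans (mul_le_mul_of_nonneg_left (by linarith) (Nat.cast_nonneg _))
  have s1 : ∑ z : HalfEdge d, ∑ w : HalfEdge d, (d z.1 : ℝ) * (d w.1 : ℝ) ^ 2 =
      (∑ z : HalfEdge d, (d z.1 : ℝ)) * ∑ z : HalfEdge d, (d z.1 : ℝ) ^ 2 := by
    rw [Finset.sum_mul_sum]
  have s2 : ∑ z : HalfEdge d, ∑ h : HalfEdge d, ∑ w : HalfEdge d, ∑ w' : HalfEdge d,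
      (if h.1 = z.1 then (d z.1 : ℝ) * d w.1 * d w'.1 else 0) =
      (∑ z : HalfEdge d, (d z.1 : ℝ) ^ 2) * (∑ z : HalfEdge d, (d z.1 : ℝ)) ^ 2 := by
    have : ∀ z h : HalfEdge d, ∑ w : HalfEdge d, ∑ w' : HalfEdge d,
        (if h.1 = z.1 then (d z.1 : ℝ) * d w.1 * d w'.1 else 0) =
        if h ∈ siblings z then d z.1 * (∑ z : HalfEdge d, (d z.1 : ℝ)) ^ 2 else 0 := by
      intro z h
      simp only [mem_siblings]
      split_ifs
      · rw [sq, Finset.sum_mul_sum, Finset.mul_sum]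
        refine Finset.sum_congr rfl fun w _ => ?_
        rw [Finset.mul_sum]
        refine Finset.sum_congr rfl fun w' _ => ?_
        ring
      · simp
    rw [Finset.sum_mul]
    refine Finset.sum_congr rfl fun z _ => ?_
    simp only [this]
    rw [Finset.sum_ite_mem, Finset.univ_inter, Finset.sum_const, card_siblings, nsmul_eq_mul]
    ring
  rw [s1] at h1
  rw [s2] at h2
  have hN' : (16 : ℝ) ≤ (∑ i, d i : ℕ) := by exact_mod_cast hN
  have i1 := inv_sub_two_le hN'
  have i2 := inv_sub_four_sq_le hN'
  have hs0 : 0 ≤ ∑ z : HalfEdge d, (d z.1 : ℝ) := by positivity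
  have hs1 : 0 ≤ ∑ z : HalfEdge d, (d z.1 : ℝ) ^ 2 := by positivity
  have hD : (0 : ℝ) ≤ maxDegree d := Nat.cast_nonneg _
  have hZ : (0 : ℝ) ≤ Fintype.card (Configuration d) := Nat.cast_nonneg _
  have hsum : ∑ γ : Configuration d, (edgeWeight γ : ℝ) =
      ∑ γ : Configuration d, ∑ z, (d z.1 : ℝ) * (d (γ.partner z).1 : ℝ) ^ 2 +
      ∑ γ : Configuration d, ∑ z, ∑ h ∈ γ.others z,
        if h.1 = z.1 then (d z.1 : ℝ) * d (γ.partner z).1 * d (γ.partner h).1 else 0 := by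
    rw [← Finset.sum_add_distrib]
    refine Finset.sum_congr rfl fun γ _ => ?_
    rw [edgeWeight]
    push_cast
    rfl
  rw [hsum]
  refine (add_le_add h1 h2).trans ?_
  generalize (Fintype.card (Configuration d) : ℝ) = Z at *
  generalize ((∑ i, d i : ℕ) : ℝ) = N at *
  generalize ∑ z : HalfEdge d, (d z.1 : ℝ) = S at *
  generalize ∑ z : HalfEdge d, (d z.1 : ℝ) ^ 2 = R at *
  generalize (maxDegree d : ℝ) = D at *
  have hNpos : 0 < N := by linarith
  have hinv0 : 0 ≤ (N - 2)⁻¹ := inv_nonneg.2 (by linarith)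
  calc Z * (N - 2)⁻¹ * (S * R) + Z * ((N - 4) ^ 2)⁻¹ * (R * S ^ 2) ≤
        Z * (2 / N) * (((A + 1) * N) * (D * ((A + 1) * N))) +
        Z * (4 / N ^ 2) * ((D * ((A + 1) * N)) * ((A + 1) * N) ^ 2) := by gcongr
    _ = _ := by field_simp

/-- Distinct half-edges are matched with probability at least 1/N. Leaving out the diagonal pairs
costs at most ΔQ. -/
theorem sum_pathCount_ge (hN : 2 ≤ ∑ i, d i) :
    Fintype.card (Configuration d) * (((pairCount d : ℝ) ^ 2 - maxDegree d * pairCount d) /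
      (∑ i, d i : ℕ)) ≤ ∑ γ : Configuration d, (pathCount γ : ℝ) := by
  classical
  set a : HalfEdge d → ℝ := fun z => ((d z.1 - 1 : ℕ) : ℝ) with ha
  have ha0 : ∀ z, 0 ≤ a z := fun z => Nat.cast_nonneg _
  have hNpos : (0 : ℝ) < (∑ i, d i : ℕ) := by exact_mod_cast (by omega : 0 < ∑ i, d i)
  have hS : ∑ z, a z = pairCount d := by
    rw [← sum_sub_one]; push_cast; rfl
  have hS2 : ∑ z, a z ^ 2 ≤ maxDegree d * pairCount d := by
    have := (Nat.cast_le (α := ℝ)).2 (sum_sub_one_sq_le (d := d))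
    push_cast at this
    exact this
  have hpair : ∀ z w : HalfEdge d, z ≠ w → (Fintype.card (Configuration d) : ℝ) / (∑ i, d i : ℕ) ≤
      ((Finset.univ.filter fun γ : Configuration d => γ.partner z = w).card : ℝ) := by
    intro z w h
    rw [div_le_iff₀ hNpos]
    have h1 := card_partner_eq_ge h
    have h2 := (Nat.cast_le (α := ℝ)).2 (h1.trans (Nat.mul_le_mul_left _ (Nat.sub_le _ 1)))
    push_cast at h2 ⊢
    convert h2
  have hsum : ∑ γ : Configuration d, (pathCount γ : ℝ) = ∑ z, ∑ w, a z * a w *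
      ((Finset.univ.filter fun γ : Configuration d => γ.partner z = w).card : ℝ) := by
    simp only [pathCount]
    push_cast
    rw [Finset.sum_comm]
    refine Finset.sum_congr rfl fun z _ => ?_
    rw [← Finset.sum_fiberwise Finset.univ (fun γ : Configuration d => γ.partner z)]
    refine Finset.sum_congr rfl fun w _ => ?_
    rw [Finset.sum_congr rfl (g := fun _ => a z * a w), Finset.sum_const, nsmul_eq_mul, mul_comm]
    intro γ hγ
    rw [(Finset.mem_filter.1 hγ).2]
  rw [hsum]
  calc _ ≤ Fintype.card (Configuration d) * (((∑ z, a z) ^ 2 - ∑ z, a z ^ 2) /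
      (∑ i, d i : ℕ)) := by
        rw [hS]
        gcongr
    _ = ∑ z, ∑ w, (if z = w then 0 else
        a z * a w * ((Fintype.card (Configuration d) : ℝ) / (∑ i, d i : ℕ))) := by
        have : ∀ z, ∑ w, (if z = w then 0 else
            a z * a w * ((Fintype.card (Configuration d) : ℝ) / (∑ i, d i : ℕ))) =
            (a z * (∑ w, a w) - a z ^ 2) *
              ((Fintype.card (Configuration d) : ℝ) / (∑ i, d i : ℕ)) := by
          intro z
          rw [Finset.mul_sum, ← Finset.add_sum_erase _ _ (Finset.mem_univ z),
            ← Finset.add_sum_erase _ (fun w => a z * a w) (Finset.mem_univ z)]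
          rw [if_pos rfl, zero_add, sq, add_sub_cancel_left, Finset.sum_mul]
          refine Finset.sum_congr rfl fun w hw => ?_
          rw [if_neg (Finset.ne_of_mem_erase hw).symm]
        simp only [this]
        rw [← Finset.sum_mul, Finset.sum_sub_distrib, ← Finset.sum_mul]
        ring
    _ ≤ _ := by
        refine Finset.sum_le_sum fun z _ => Finset.sum_le_sum fun w _ => ?_
        split_ifs with h
        · have := ha0 z
          have := ha0 w
          positivity
        · exact mul_le_mul_of_nonneg_left (hpair z w h) (mul_nonneg (ha0 z) (ha0 w))

/-- The square is split according to whether z and h lie on the same edge. If so, h is z or its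
partner, with equal contributions; this is the factor 2. -/
theorem sum_pathCount_sq_le (hN : 16 ≤ ∑ i, d i) :
    ∑ γ : Configuration d, (pathCount γ : ℝ) ^ 2 ≤ Fintype.card (Configuration d) *
      ((((∑ i, d i : ℕ) - 4 : ℝ) ^ 2)⁻¹ * (pairCount d : ℝ) ^ 4 +
        2 * (((∑ i, d i : ℕ) - 2 : ℝ)⁻¹ * (maxDegree d * pairCount d : ℝ) ^ 2)) := by
  classical
  set a : HalfEdge d → ℝ := fun z => ((d z.1 - 1 : ℕ) : ℝ) with ha
  have ha0 : ∀ z, 0 ≤ a z := fun z => Nat.cast_nonneg _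
  have hS : ∑ z, a z = pairCount d := by
    rw [← sum_sub_one]; push_cast; rfl
  have hS2 : ∑ z, a z ^ 2 ≤ maxDegree d * pairCount d := by
    have := (Nat.cast_le (α := ℝ)).2 (sum_sub_one_sq_le (d := d))
    push_cast at this
    exact this
  have h1 := sum_partner_le (d := d) (fun z w => a z ^ 2 * a w ^ 2)
    (fun z w => by positivity) (by omega)
  have h2 := sum_partner_partner_le (d := d) (fun z w h w' => a z * a w * (a h * a w'))
    (fun z w h w' => mul_nonneg (mul_nonneg (ha0 _) (ha0 _)) (mul_nonneg (ha0 _) (ha0 _)))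
    (by omega)
  have s1 : ∑ z, ∑ w, a z ^ 2 * a w ^ 2 = (∑ z, a z ^ 2) ^ 2 := by
    rw [sq, Finset.sum_mul_sum]
  have s2 : ∑ z, ∑ h, ∑ w, ∑ w', a z * a w * (a h * a w') = (∑ z, a z) ^ 4 := by
    rw [show (∑ z, a z) ^ 4 = (∑ z, a z) * ((∑ z, a z) * ((∑ z, a z) * ∑ z, a z)) by ring,
      Finset.sum_mul]
    refine Finset.sum_congr rfl fun z _ => ?_
    rw [Finset.sum_mul, Finset.mul_sum]
    refine Finset.sum_congr rfl fun h _ => ?_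
    rw [Finset.sum_mul_sum, Finset.mul_sum, Finset.mul_sum]
    refine Finset.sum_congr rfl fun w _ => ?_
    rw [Finset.mul_sum, Finset.mul_sum]
    refine Finset.sum_congr rfl fun w' _ => ?_
    ring
  rw [s1] at h1
  rw [s2, hS] at h2
  have hexp : ∀ γ : Configuration d, (pathCount γ : ℝ) ^ 2 =
      (∑ z, ∑ h ∈ γ.others z, a z * a (γ.partner z) * (a h * a (γ.partner h))) +
        2 * ∑ z, a z ^ 2 * a (γ.partner z) ^ 2 := by
    intro γ
    have hT : (pathCount γ : ℝ) = ∑ z, a z * a (γ.partner z) := by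
      rw [pathCount]; push_cast; rfl
    rw [sq, hT, Finset.sum_mul_sum, Finset.mul_sum, ← Finset.sum_add_distrib]
    refine Finset.sum_congr rfl fun z _ => ?_
    have hoth : γ.others z = (Finset.univ.erase z).erase (γ.partner z) := by
      ext h
      rw [mem_others]
      simp [and_comm]
    rw [← Finset.add_sum_erase _ _ (Finset.mem_univ z),
      ← Finset.add_sum_erase _ _ (show γ.partner z ∈ Finset.univ.erase z by simp), hoth,
      partner_partner]
    ring
  rw [Finset.sum_congr rfl fun γ _ => hexp γ, Finset.sum_add_distrib, ← Finset.mul_sum]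
  have h1' : (∑ γ : Configuration d, ∑ z, a z ^ 2 * a (γ.partner z) ^ 2) ≤
      Fintype.card (Configuration d) * (((∑ i, d i : ℕ) - 2 : ℝ)⁻¹ *
        (maxDegree d * pairCount d : ℝ) ^ 2) := by
    refine h1.trans ?_
    rw [mul_assoc]
    have : (0 : ℝ) ≤ ((∑ i, d i : ℕ) - 2 : ℝ)⁻¹ := by
      have : (16 : ℝ) ≤ (∑ i, d i : ℕ) := by exact_mod_cast hN
      exact inv_nonneg.2 (by linarith)
    gcongr
  rw [mul_assoc] at h2
  linarith

/-- The terms Q⁴/N² cancel. What remains is of the orders N, D²N and DN, all at most D²N as D ≥ 1.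
-/
theorem variance_bound {A N D Q : ℝ} (hA : 0 < A) (hN : 16 ≤ N) (hQ0 : 0 ≤ Q) (hQ : Q ≤ A * N)
    (hD : 1 ≤ D) :
    (((N - 4) ^ 2)⁻¹ * Q ^ 4 + 2 * ((N - 2)⁻¹ * (D * Q) ^ 2)) -
      2 * (Q ^ 2 / N) * ((Q ^ 2 - D * Q) / N) + (Q ^ 2 / N) ^ 2 ≤
      (32 * A ^ 4 + 4 * A ^ 2 + 2 * A ^ 3) * (D ^ 2 * N) := by
  have hN0 : 0 < N := by linarith
  have i1 := inv_sub_two_le hN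
  have i2 : ((N - 4) ^ 2)⁻¹ ≤ 1 / N ^ 2 + 32 / N ^ 3 := by
    rw [div_add_div _ _ (by positivity) (by positivity), inv_eq_one_div,
      div_le_div_iff₀ (by nlinarith) (by positivity)]
    have : 0 ≤ N ^ 3 * (24 * N ^ 2 - 240 * N + 512) :=
      mul_nonneg (by positivity) (by nlinarith)
    have h3 : (1 * N ^ 3 + N ^ 2 * 32) * (N - 4) ^ 2 = N ^ 2 * ((N + 32) * (N - 4) ^ 2) := by ring
    have h4 : 1 * (N ^ 2 * N ^ 3) = N ^ 2 * N ^ 3 := by ring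
    rw [h3, h4]
    refine mul_le_mul_of_nonneg_left ?_ (by positivity)
    nlinarith
  have t1 : ((N - 4) ^ 2)⁻¹ * Q ^ 4 ≤ (1 / N ^ 2 + 32 / N ^ 3) * Q ^ 4 :=
    mul_le_mul_of_nonneg_right i2 (by positivity)
  have t2 : (N - 2)⁻¹ * (D * Q) ^ 2 ≤ (2 / N) * (D * Q) ^ 2 :=
    mul_le_mul_of_nonneg_right i1 (by positivity)
  have e : (1 / N ^ 2 + 32 / N ^ 3) * Q ^ 4 + 2 * ((2 / N) * (D * Q) ^ 2) -
      2 * (Q ^ 2 / N) * ((Q ^ 2 - D * Q) / N) + (Q ^ 2 / N) ^ 2 =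
      32 / N ^ 3 * Q ^ 4 + 4 / N * D ^ 2 * Q ^ 2 + 2 / N ^ 2 * D * Q ^ 3 := by
    field_simp
    ring
  have b : 32 / N ^ 3 * Q ^ 4 + 4 / N * D ^ 2 * Q ^ 2 + 2 / N ^ 2 * D * Q ^ 3 ≤
      32 / N ^ 3 * (A * N) ^ 4 + 4 / N * D ^ 2 * (A * N) ^ 2 + 2 / N ^ 2 * D * (A * N) ^ 3 := by
    gcongr
  have e2 : 32 / N ^ 3 * (A * N) ^ 4 + 4 / N * D ^ 2 * (A * N) ^ 2 + 2 / N ^ 2 * D * (A * N) ^ 3 =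
      32 * A ^ 4 * N + 4 * A ^ 2 * (D ^ 2 * N) + 2 * A ^ 3 * (D * N) := by
    field_simp
  have f1 : N ≤ D ^ 2 * N := le_mul_of_one_le_left hN0.le (one_le_pow₀ hD)
  have f2 : D * N ≤ D ^ 2 * N := mul_le_mul_of_nonneg_right (by nlinarith) hN0.le
  have g1 : 32 * A ^ 4 * N ≤ 32 * A ^ 4 * (D ^ 2 * N) := mul_le_mul_of_nonneg_left f1 (by positivity)
  have g2 : 2 * A ^ 3 * (D * N) ≤ 2 * A ^ 3 * (D ^ 2 * N) :=
    mul_le_mul_of_nonneg_left f2 (by positivity)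
  linarith

theorem sum_pathCount_sub_sq_le {A : ℝ} (hA : 0 < A) (hN : 16 ≤ ∑ i, d i)
    (hQ : (pairCount d : ℝ) ≤ A * (∑ i, d i : ℕ)) :
    ∑ γ : Configuration d, ((pathCount γ : ℝ) - (pairCount d : ℝ) ^ 2 / (∑ i, d i : ℕ)) ^ 2 ≤
      Fintype.card (Configuration d) * ((32 * A ^ 4 + 4 * A ^ 2 + 2 * A ^ 3) *
        ((maxDegree d : ℝ) ^ 2 * (∑ i, d i : ℕ))) := by
  have hN' : (16 : ℝ) ≤ (∑ i, d i : ℕ) := by exact_mod_cast hN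
  have hb := variance_bound hA hN' (Nat.cast_nonneg _) hQ
    (Nat.one_le_cast.2 (one_le_maxDegree (d := d) (by omega)))
  have h1 := sum_pathCount_sq_le hN
  have h2 := sum_pathCount_ge (d := d) (by omega)
  have hZ : (0 : ℝ) ≤ Fintype.card (Configuration d) := Nat.cast_nonneg _
  refine le_trans ?_ (mul_le_mul_of_nonneg_left hb hZ)
  set m : ℝ := (pairCount d : ℝ) ^ 2 / (∑ i, d i : ℕ) with hm
  have hm0 : 0 ≤ m := by positivity
  have e : ∑ γ : Configuration d, ((pathCount γ : ℝ) - m) ^ 2 =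
      ∑ γ : Configuration d, (pathCount γ : ℝ) ^ 2 - 2 * m * ∑ γ : Configuration d, (pathCount γ : ℝ) +
        Fintype.card (Configuration d) * m ^ 2 := by
    rw [Finset.mul_sum, ← Finset.sum_sub_distrib, ← nsmul_eq_mul, ← Finset.card_univ,
      ← Finset.sum_const, ← Finset.sum_add_distrib]
    refine Finset.sum_congr rfl fun γ _ => ?_
    ring
  rw [e]
  have h3 := mul_le_mul_of_nonneg_left h2 (by positivity : 0 ≤ 2 * m)
  linarith

end Expectations

/-! ### Most simple configurations have many creating switchings -/

section Reversible

variable {n : ℕ} {d : Fin n → ℕ}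

open Configuration

/-- There are about as many switchings creating a loop or a double edge as expected, and they are
spread over the vertices. -/
def HasManyCreatingMoves (η : ℝ) (σ : Configuration d) : Prop := by
  classical
  exact ∃ 𝒢 : Finset (Move d), (∀ m ∈ 𝒢, σ.Creates ∅ m) ∧
    (∀ v, ((𝒢.filter fun m => v ∈ σ.touched m).card : ℝ) ≤ η * (∑ i, d i : ℕ)) ∧
    2 * (pairCount d : ℝ) + (pairCount d : ℝ) ^ 2 / (∑ i, d i : ℕ) - η * (∑ i, d i : ℕ) ≤ 𝒢.card

/-- The deviation which bounds the number of missing switchings. -/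
noncomputable def deviation (η : ℝ) (σ : Configuration d) : ℝ :=
  3 * (triangles σ).card + (squares σ).card +
    16 * maxDegree d / (η * (∑ i, d i : ℕ)) * edgeWeight σ +
    1 / (2 * η * (∑ i, d i : ℕ)) *
      (pathCount σ - (pairCount d : ℝ) ^ 2 / (∑ i, d i : ℕ)) ^ 2

theorem hasManyCreatingMoves_of_deviation_le {η : ℝ} (hη : 0 < η) (hN : 0 < ∑ i, d i)
    (hΔ : 16 * (maxDegree d : ℝ) ^ 2 ≤ η * (∑ i, d i : ℕ)) {σ : Configuration d} (hσ : σ.IsSimple)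
    (h : deviation η σ ≤ η * (∑ i, d i : ℕ) / 2) : HasManyCreatingMoves η σ := by
  classical
  have hD : (1 : ℝ) ≤ maxDegree d := Nat.one_le_cast.2 (one_le_maxDegree hN)
  have hN' : (0 : ℝ) < (∑ i, d i : ℕ) := by exact_mod_cast hN
  -- With this value of ρ one has 4Δρ = ηN/2, while 8Δ² ≤ ηN/2 by `hΔ`.
  have hρ : 0 < η * (∑ i, d i : ℕ) / (8 * maxDegree d) := by positivity
  obtain ⟨𝒢, h1, h2, h3⟩ := exists_creating_moves hσ hρ
  refine ⟨𝒢, h1, fun v => ?_, ?_⟩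
  · refine le_trans (le_of_eq (by congr!)) ((h2 v).trans ?_)
    have : 4 * (maxDegree d : ℝ) * (η * (∑ i, d i : ℕ) / (8 * maxDegree d)) =
        η * (∑ i, d i : ℕ) / 2 := by
      field_simp; ring
    rw [this]
    linarith
  · rw [deviation] at h
    have e : 2 * ((edgeWeight σ : ℝ) / (η * (∑ i, d i : ℕ) / (8 * maxDegree d))) =
        16 * maxDegree d / (η * (∑ i, d i : ℕ)) * edgeWeight σ := by
      field_simp; ring
    rw [e] at h3
    generalize 16 * (maxDegree d : ℝ) / (η * (∑ i, d i : ℕ)) * edgeWeight σ = V at *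
    generalize (pairCount d : ℝ) ^ 2 / (∑ i, d i : ℕ) = m at *
    generalize ((∑ i, d i : ℕ) : ℝ) = N at *
    -- By the inequality of arithmetic and geometric means the shortfall of the path count is traded
    -- for its square, whose mean is known; the cost ηN/2 is half of the permitted loss.
    have key : m - pathCount σ ≤ 1 / (2 * η * N) * (pathCount σ - m) ^ 2 + η * N / 2 := by
      have hp : 0 < η * N := by positivity
      generalize (pathCount σ : ℝ) = T at *
      have : 1 / (2 * η * N) * (T - m) ^ 2 + η * N / 2 - (m - T) =
          (T - m + η * N) ^ 2 / (2 * (η * N)) := by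
        field_simp
        ring
      have h0 : 0 ≤ (T - m + η * N) ^ 2 / (2 * (η * N)) := by positivity
      linarith
    linarith

/-- Each term has mean O(Δ²): triangles and four-cycles even O(1), the weighted edges by Δ/N · ΔN,
and the variance by Δ²N/N. -/
theorem sum_deviation_le {A η : ℝ} (hA : 0 < A) (hη : 0 < η) (hN : 16 ≤ ∑ i, d i)
    (hQ : (pairCount d : ℝ) ≤ A * (∑ i, d i : ℕ)) :
    ∑ γ : Configuration d, deviation η γ ≤ Fintype.card (Configuration d) *
      ((24 * A ^ 3 + 16 * A ^ 4 + 16 * (2 * (A + 1) ^ 2 + 4 * (A + 1) ^ 3) / η +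
        (32 * A ^ 4 + 4 * A ^ 2 + 2 * A ^ 3) / (2 * η)) * (maxDegree d : ℝ) ^ 2) := by
  have h1 := sum_card_triangles_le hN hQ
  have h2 := sum_card_squares_le hN hQ
  have h3 := sum_edgeWeight_le hA hN hQ
  have h4 := sum_pathCount_sub_sq_le hA hN hQ
  have hD : (1 : ℝ) ≤ maxDegree d := Nat.one_le_cast.2 (one_le_maxDegree (d := d) (by omega))
  have hN' : (0 : ℝ) < (∑ i, d i : ℕ) := by exact_mod_cast (by omega : 0 < ∑ i, d i)
  simp only [deviation, Finset.sum_add_distrib, ← Finset.mul_sum]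
  generalize (pairCount d : ℝ) ^ 2 / (∑ i, d i : ℕ) = m at *
  generalize ∑ γ : Configuration d, ((triangles γ).card : ℝ) = t₁ at *
  generalize ∑ γ : Configuration d, ((squares γ).card : ℝ) = t₂ at *
  generalize ∑ γ : Configuration d, (edgeWeight γ : ℝ) = t₃ at *
  generalize ∑ γ : Configuration d, ((pathCount γ : ℝ) - m) ^ 2 = t₄ at *
  have hZ : (0 : ℝ) ≤ Fintype.card (Configuration d) := Nat.cast_nonneg _
  generalize (Fintype.card (Configuration d) : ℝ) = Z at *
  generalize ((∑ i, d i : ℕ) : ℝ) = N at *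
  generalize (maxDegree d : ℝ) = D at *
  have hD2 : 1 ≤ D ^ 2 := one_le_pow₀ hD
  have b1 : 3 * t₁ + t₂ ≤ Z * ((24 * A ^ 3 + 16 * A ^ 4) * D ^ 2) := by
    have : Z * ((24 * A ^ 3 + 16 * A ^ 4) * 1) ≤ Z * ((24 * A ^ 3 + 16 * A ^ 4) * D ^ 2) := by
      gcongr
    linarith
  have b3 : 16 * D / (η * N) * t₃ ≤
      Z * (16 * (2 * (A + 1) ^ 2 + 4 * (A + 1) ^ 3) / η * D ^ 2) := by
    refine (mul_le_mul_of_nonneg_left h3 (by positivity)).trans_eq ?_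
    field_simp
  have b4 : 1 / (2 * η * N) * t₄ ≤
      Z * ((32 * A ^ 4 + 4 * A ^ 2 + 2 * A ^ 3) / (2 * η) * D ^ 2) := by
    refine (mul_le_mul_of_nonneg_left h4 (by positivity)).trans_eq ?_
    field_simp
  linarith

theorem deviation_nonneg {η : ℝ} (hη : 0 < η) (σ : Configuration d) : 0 ≤ deviation η σ := by
  unfold deviation
  positivity

open Classical in
/-- In most of the simple configurations there are as many switchings creating a loop or a double
edge as expected. -/
theorem exists_card_not_hasManyCreatingMoves_le (A η ε : ℝ) (hA : 0 < A) (hη : 0 < η)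
    (hε : 0 < ε) :
    ∃ δ : ℝ, 0 < δ ∧ ∀ {n : ℕ} (d : Fin n → ℕ), 0 < ∑ i, d i →
      (pairCount d : ℝ) ≤ A * (∑ i, d i : ℕ) → (maxDegree d : ℝ) ^ 2 ≤ δ * (∑ i, d i : ℕ) →
      ((Finset.univ.filter fun γ : Configuration d => γ.IsSimple ∧
        ¬ HasManyCreatingMoves η γ).card : ℝ) ≤ ε * Fintype.card (Configuration d) := by
  set C : ℝ := 24 * A ^ 3 + 16 * A ^ 4 + 16 * (2 * (A + 1) ^ 2 + 4 * (A + 1) ^ 3) / η +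
        (32 * A ^ 4 + 4 * A ^ 2 + 2 * A ^ 3) / (2 * η) with hC
  have hC0 : 0 < C := by positivity
  -- The three bounds serve, in this order, to force N ≥ 16 (as Δ ≥ 1), to satisfy the hypothesis
  -- 16Δ² ≤ ηN, and to make CΔ² at most ε times the Markov threshold ηN/2.
  refine ⟨min (1 / 16) (min (η / 16) (ε * η / (2 * C))), by positivity, ?_⟩
  intro n d hN hQ hΔ
  have hN' : (0 : ℝ) < (∑ i, d i : ℕ) := by exact_mod_cast hN
  have hD : (1 : ℝ) ≤ maxDegree d := Nat.one_le_cast.2 (one_le_maxDegree hN)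
  have hD2 : 1 ≤ (maxDegree d : ℝ) ^ 2 := one_le_pow₀ hD
  have d1 : (maxDegree d : ℝ) ^ 2 ≤ 1 / 16 * (∑ i, d i : ℕ) :=
    hΔ.trans (mul_le_mul_of_nonneg_right (min_le_left _ _) hN'.le)
  have d2 : (maxDegree d : ℝ) ^ 2 ≤ η / 16 * (∑ i, d i : ℕ) :=
    hΔ.trans (mul_le_mul_of_nonneg_right ((min_le_right _ _).trans (min_le_left _ _)) hN'.le)
  have d3 : (maxDegree d : ℝ) ^ 2 ≤ ε * η / (2 * C) * (∑ i, d i : ℕ) :=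
    hΔ.trans (mul_le_mul_of_nonneg_right ((min_le_right _ _).trans (min_le_right _ _)) hN'.le)
  have hN16 : 16 ≤ ∑ i, d i := by
    have : (16 : ℝ) ≤ (∑ i, d i : ℕ) := by linarith
    exact_mod_cast this
  have hsum := sum_deviation_le hA hη hN16 hQ
  rw [← hC] at hsum
  have hmarkov : ((Finset.univ.filter fun γ : Configuration d => γ.IsSimple ∧
        ¬ HasManyCreatingMoves η γ).card : ℝ) * (η * (∑ i, d i : ℕ) / 2) ≤
      ∑ γ : Configuration d, deviation η γ := by
    rw [← nsmul_eq_mul]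
    refine (Finset.card_nsmul_le_sum _ (deviation η) _ ?_).trans
      (Finset.sum_le_sum_of_subset_of_nonneg (Finset.filter_subset _ _)
        fun γ _ _ => deviation_nonneg hη γ)
    intro γ hγ
    obtain ⟨h1, h2⟩ := (Finset.mem_filter.1 hγ).2
    by_contra hlt
    exact h2 (hasManyCreatingMoves_of_deviation_le hη hN (by linarith) h1 (not_le.1 hlt).le)
  have hZ : (0 : ℝ) ≤ Fintype.card (Configuration d) := Nat.cast_nonneg _
  have h5 : Fintype.card (Configuration d) * (C * (maxDegree d : ℝ) ^ 2) ≤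
      ε * Fintype.card (Configuration d) * (η * (∑ i, d i : ℕ) / 2) := by
    calc Fintype.card (Configuration d) * (C * (maxDegree d : ℝ) ^ 2) ≤
        Fintype.card (Configuration d) * (C * (ε * η / (2 * C) * (∑ i, d i : ℕ))) := by gcongr
      _ = _ := by field_simp
  exact le_of_mul_le_mul_right ((hmarkov.trans hsum).trans h5) (by positivity)

end Reversible

/-! ### Comparison of the uniform graph with the switched graph -/

theorem hasSum_exp (t : ℝ) : HasSum (fun b : ℕ => t ^ b / b.factorial) (Real.exp t) := by
  rw [Real.exp_eq_exp_ℝ]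
  exact NormedSpace.expSeries_div_hasSum_exp t

/-- The tail of the exponential series increases with t ≥ 0, so a K that works for t = B works for
all t. -/
theorem exp_sub_le_sum {B ε : ℝ} (hε : 0 < ε) :
    ∃ K : ℕ, ∀ t : ℝ, 0 ≤ t → t ≤ B →
      Real.exp t - ε ≤ ∑ b ∈ Finset.range (K + 1), t ^ b / b.factorial := by
  have h := (hasSum_exp B).tendsto_sum_nat.eventually (lt_mem_nhds (sub_lt_self (Real.exp B) hε))
  obtain ⟨K, hK⟩ := eventually_atTop.1 h
  refine ⟨K, fun t ht htB => ?_⟩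
  have h1 := hK (K + 1) (Nat.le_succ K)
  have h2 := sum_le_hasSum (Finset.range (K + 1)) (fun b _ => ?_) ((hasSum_exp B).sub (hasSum_exp t))
  · rw [Finset.sum_sub_distrib] at h2
    linarith
  · rw [sub_nonneg]
    gcongr

theorem mul_card_sub_card_le_sum {α : Type*} (a g t : Finset α) (F : α → ℝ) {c : ℝ} (hc : 0 ≤ c)
    (hF0 : ∀ x ∈ t, 0 ≤ F x) (hF : ∀ x ∈ a, x ∉ g → c ≤ F x) (hat : a ⊆ t) :
    c * ((a.card : ℝ) - g.card) ≤ ∑ x ∈ t, F x := by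
  classical
  have hcard : (a.card : ℝ) - g.card ≤ (a \ g).card := by
    have := Finset.le_card_sdiff g a
    have h4 : (a.card : ℝ) ≤ (a \ g).card + g.card := by
      exact_mod_cast (by omega : a.card ≤ (a \ g).card + g.card)
    linarith
  refine (mul_le_mul_of_nonneg_left hcard hc).trans ?_
  rw [mul_comm, ← nsmul_eq_mul]
  refine (Finset.card_nsmul_le_sum (a \ g) F c fun x hx => ?_).trans
    (Finset.sum_le_sum_of_subset_of_nonneg (Finset.sdiff_subset.trans hat) fun x hx _ => hF0 x hx)
  rw [Finset.mem_sdiff] at hx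
  exact hF x hx.1 hx.2

section Comparison

variable {n : ℕ} {d : Fin n → ℕ}

open Configuration

open Classical in
theorem lintegral_uniformConfiguration (hd : Even (∑ i, d i)) (g : Configuration d → ℝ≥0∞) :
    ∫⁻ γ, g γ ∂(uniformConfiguration d hd) =
      (Fintype.card (Configuration d) : ℝ≥0∞)⁻¹ * ∑ γ, g γ := by
  have := Configuration.nonempty_of_even hd
  unfold uniformConfiguration
  rw [lintegral_fintype, Finset.mul_sum]
  refine Finset.sum_congr rfl fun γ _ => ?_
  rw [PMF.toMeasure_apply_singleton _ _ (MeasurableSet.of_discrete), PMF.uniformOfFintype_apply,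
    mul_comm]

-- The bound of `sum_histories_le_hitProb` is averaged over the initial configuration and re-sorted
-- by starting points of histories. Only K steps of the first attempt are used, which is enough for
-- a lower bound.
open Classical in
theorem ofReal_sum_valid_le (hd : Even (∑ i, d i)) (hN : 0 < ∑ i, d i) (rule : BadEdgeRule d)
    {𝒜 : Set (Configuration d)} (h𝒜 : Symmetric 𝒜) (K : ℕ) :
    ENNReal.ofReal ((Fintype.card (Configuration d) : ℝ)⁻¹ *
      ∑ σ ∈ Finset.univ.filter (fun σ : Configuration d => σ ∈ 𝒜 ∧ σ.IsSimple),
        ∑ b ∈ Finset.range (K + 1), ((4 * (∑ i, d i : ℕ) : ℝ) ^ b * b.factorial)⁻¹ *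
          ((Finset.univ.filter fun D : Fin b → Move d => σ.Valid (List.ofFn D)).card : ℝ)) ≤
      switchingMeasure d hd rule {ω | finalConfiguration ω ∈ 𝒜} := by
  have := Configuration.nonempty_of_even hd
  have hZ : (0 : ℝ) < Fintype.card (Configuration d) := by exact_mod_cast Fintype.card_pos
  have hN' : (0 : ℝ) < (∑ i, d i : ℕ) := by exact_mod_cast hN
  have e : ENNReal.ofReal ((Fintype.card (Configuration d) : ℝ)⁻¹ *
      ∑ σ ∈ Finset.univ.filter (fun σ : Configuration d => σ ∈ 𝒜 ∧ σ.IsSimple),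
        ∑ b ∈ Finset.range (K + 1), ((4 * (∑ i, d i : ℕ) : ℝ) ^ b * b.factorial)⁻¹ *
          ((Finset.univ.filter fun D : Fin b → Move d => σ.Valid (List.ofFn D)).card : ℝ)) =
      (Fintype.card (Configuration d) : ℝ≥0∞)⁻¹ * ∑ b ∈ Finset.range (K + 1),
        historyWeight (∑ i, d i) b * ∑ γ, ((histories 𝒜 b γ).card : ℝ≥0∞) := by
    rw [Finset.sum_comm, Finset.sum_congr rfl fun b _ => (Finset.mul_sum _ _ _).symm,
      ENNReal.ofReal_mul (by positivity), ENNReal.ofReal_inv_of_pos hZ, ENNReal.ofReal_natCast,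
      ENNReal.ofReal_sum_of_nonneg fun b _ => by positivity]
    congr 1
    refine Finset.sum_congr rfl fun b _ => ?_
    rw [ENNReal.ofReal_mul (by positivity), ENNReal.ofReal_inv_of_pos (by positivity),
      ENNReal.ofReal_mul (by positivity), ENNReal.ofReal_pow (by positivity),
      ENNReal.ofReal_mul (by positivity), ENNReal.ofReal_natCast, ENNReal.ofReal_natCast,
      ENNReal.ofReal_ofNat, ← Nat.cast_sum, ENNReal.ofReal_natCast, ← Nat.cast_sum,
      sum_card_histories, Finset.sum_filter]
    rfl
  refine le_trans (le_of_eq_of_le e ?_) (switchingChain_le_switchingMeasure hd rule 𝒜 K)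
  · rw [lintegral_hitProb, lintegral_uniformConfiguration]
    refine mul_le_mul_right ?_ _
    rw [Finset.sum_congr rfl fun b _ => Finset.mul_sum _ _ _, Finset.sum_comm]
    exact Finset.sum_le_sum fun γ _ => sum_histories_le_hitProb rule h𝒜 K γ

open Classical in
/-- A simple configuration arises from many configurations by switchings. -/
theorem HasManyCreatingMoves.sum_valid_ge {η B : ℝ} {K : ℕ} {ε : ℝ} (hη : 0 ≤ η)
    (hε : 0 ≤ ε)
    (hηε : η * (1 + 4 * K) / 4 ≤ ε) (hN : 0 < ∑ i, d i) (hB : badRate d ≤ B)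
    (hK : ∀ t : ℝ, 0 ≤ t → t ≤ B →
      Real.exp t - ε ≤ ∑ b ∈ Finset.range (K + 1), t ^ b / b.factorial)
    {σ : Configuration d} (h : HasManyCreatingMoves η σ) :
    (1 - 2 * ε) * Real.exp (badRate d) ≤
      ∑ b ∈ Finset.range (K + 1), ((4 * (∑ i, d i : ℕ) : ℝ) ^ b * b.factorial)⁻¹ *
          ((Finset.univ.filter fun D : Fin b → Move d => σ.Valid (List.ofFn D)).card : ℝ) := by
  have hN' : (0 : ℝ) < (∑ i, d i : ℕ) := by exact_mod_cast hN
  obtain ⟨𝒢, h1, h2, h3⟩ := h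
  -- Lowering Λ by ε pays for the missing switchings (ηN) and for those blocked by earlier ones
  -- (4KηN), as `hηε` gives ηN + 4KηN ≤ 4Nε. This way (4Nt)^b bounds the number of valid lists from
  -- below.
  set t : ℝ := max (badRate d - ε) 0 with ht
  have ht0 : 0 ≤ t := le_max_right _ _
  have htB : t ≤ B := max_le (by linarith) ((badRate_nonneg d).trans hB)
  have hexp : (1 - ε) * Real.exp (badRate d) ≤ Real.exp t := by
    calc (1 - ε) * Real.exp (badRate d) ≤ Real.exp (-ε) * Real.exp (badRate d) := by
          gcongr
          have := Real.add_one_le_exp (-ε)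
          linarith
      _ = Real.exp (badRate d - ε) := by rw [← Real.exp_add]; ring_nf
      _ ≤ _ := Real.exp_le_exp.2 (le_max_left _ _)
  have hone : 1 ≤ Real.exp (badRate d) := Real.one_le_exp (badRate_nonneg d)
  have hlow : (1 - 2 * ε) * Real.exp (badRate d) ≤ Real.exp t - ε := by nlinarith
  refine hlow.trans ((hK t ht0 htB).trans (Finset.sum_le_sum fun b hb => ?_))
  have hbK : b ≤ K := by simpa [Nat.lt_succ_iff] using hb
  set M : ℕ := ⌊η * (∑ i, d i : ℕ)⌋₊ with hM
  have hval := pow_le_card_valid σ 𝒢 h1 M K (fun v => by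
    refine le_of_eq_of_le (by congr!) (Nat.le_floor (h2 v))) hbK
  have hMle : (M : ℝ) ≤ η * (∑ i, d i : ℕ) := Nat.floor_le (by positivity)
  have hrate : 4 * (∑ i, d i : ℕ) * badRate d =
      2 * (pairCount d : ℝ) + (pairCount d : ℝ) ^ 2 / (∑ i, d i : ℕ) := by
    unfold badRate
    field_simp
    ring
  have hbase : 4 * (∑ i, d i : ℕ) * t ≤ ((𝒢.card - 4 * K * M : ℕ) : ℝ) := by
    rw [ht, mul_max_of_nonneg _ _ (by positivity)]
    refine max_le ?_ (by simp)
    have h5 : (𝒢.card : ℝ) - 4 * K * M ≤ ((𝒢.card - 4 * K * M : ℕ) : ℝ) := by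
      have : (𝒢.card : ℝ) ≤ ((𝒢.card - 4 * K * M : ℕ) : ℝ) + ((4 * K * M : ℕ) : ℝ) := by
        exact_mod_cast (by omega : 𝒢.card ≤ (𝒢.card - 4 * K * M) + 4 * K * M)
      push_cast at this
      linarith
    refine le_trans ?_ h5
    have h6 : (4 * K : ℝ) * M ≤ 4 * K * (η * (∑ i, d i : ℕ)) := by gcongr
    have h7 := mul_le_mul_of_nonneg_right hηε hN'.le
    rw [mul_sub, hrate]
    generalize ((∑ i, d i : ℕ) : ℝ) = N at *
    linarith
  have hval' := (Nat.cast_le (α := ℝ)).2 hval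
  rw [Nat.cast_pow] at hval'
  calc t ^ b / b.factorial = ((4 * (∑ i, d i : ℕ) : ℝ) ^ b * b.factorial)⁻¹ *
        (4 * (∑ i, d i : ℕ) * t) ^ b := by
        field_simp; ring
    _ ≤ ((4 * (∑ i, d i : ℕ) : ℝ) ^ b * b.factorial)⁻¹ * ((𝒢.card - 4 * K * M : ℕ) : ℝ) ^ b := by
        gcongr
    _ ≤ _ := by
        refine mul_le_mul_of_nonneg_left ?_ (by positivity)
        exact hval'.trans_eq (by congr!)

open Classical in
/-- The graph obtained by switchings has any symmetric property at least as often as predicted by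
counting the simple configurations from which there are many switchings. -/
theorem mul_card_sub_card_le_switchingMeasure (hd : Even (∑ i, d i)) (hN : 0 < ∑ i, d i)
    (rule : BadEdgeRule d) {𝒜 : Set (Configuration d)} (h𝒜 : Symmetric 𝒜) {η B ε : ℝ} {K : ℕ}
    (hη : 0 ≤ η) (hε : 0 ≤ ε) (hε1 : 2 * ε ≤ 1) (hηε : η * (1 + 4 * K) / 4 ≤ ε)
    (hB : badRate d ≤ B) (hK : ∀ t : ℝ, 0 ≤ t → t ≤ B →
      Real.exp t - ε ≤ ∑ b ∈ Finset.range (K + 1), t ^ b / b.factorial) :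
    (1 - 2 * ε) * Real.exp (badRate d) *
      (((Finset.univ.filter fun σ : Configuration d => σ ∈ 𝒜 ∧ σ.IsSimple).card : ℝ) -
        (Finset.univ.filter fun σ : Configuration d =>
          σ.IsSimple ∧ ¬ HasManyCreatingMoves η σ).card) ≤
      (switchingMeasure d hd rule {ω | finalConfiguration ω ∈ 𝒜}).toReal *
        Fintype.card (Configuration d) := by
  have := Configuration.nonempty_of_even hd
  have hZ : (0 : ℝ) < Fintype.card (Configuration d) := by exact_mod_cast Fintype.card_pos
  have h3 := (ENNReal.ofReal_le_iff_le_toReal (measure_ne_top _ _)).1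
    (ofReal_sum_valid_le hd hN rule h𝒜 K)
  rw [inv_mul_le_iff₀ hZ] at h3
  rw [mul_comm _ (Fintype.card (Configuration d) : ℝ)]
  refine le_trans (mul_card_sub_card_le_sum _ _ _ _ ?_ ?_ ?_ subset_rfl) h3
  · exact mul_nonneg (by linarith) (Real.exp_pos _).le
  · intro σ _
    exact Finset.sum_nonneg fun b _ => by positivity
  · intro σ hσ hσg
    have hσ' := (Finset.mem_filter.1 hσ).2
    have hgood : HasManyCreatingMoves η σ := by
      by_contra hc
      exact hσg (Finset.mem_filter.2 ⟨Finset.mem_univ _, hσ'.2, hc⟩)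
    exact hgood.sum_valid_ge hη hε hηε hN hB hK

/-- With u = a/s the hypotheses give p ≥ (1 - ε/3)(1 - ε/6)u - ε/2, and the product of the two
brackets is at least 1 - ε/2. The factors e^Λ and e^{-Λ} cancel, and the set of g exceptional
configurations is small enough to survive multiplication by e^Λ ≤ e^B. -/
theorem comparison_bound {ε Λ B Z a s g p : ℝ} (hε0 : 0 < ε) (hε1 : ε ≤ 1) (hΛ : Λ ≤ B) (hZ : 0 < Z)
    (ha : 0 ≤ a) (has : a ≤ s) (hs : (1 - ε / 6) * Real.exp (-Λ) * Z ≤ s)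
    (hg0 : 0 ≤ g) (hg : g ≤ ε / (2 * Real.exp B) * Z)
    (hp : (1 - 2 * (ε / 6)) * Real.exp Λ * (a - g) ≤ p * Z) : a / s ≤ p + ε := by
  have hs0 : 0 < s := lt_of_lt_of_le (mul_pos (mul_pos (by linarith) (Real.exp_pos _)) hZ) hs
  obtain ⟨u, hu⟩ : ∃ u, u = a / s := ⟨_, rfl⟩
  have hau : a = u * s := by rw [hu]; field_simp
  have hu0 : 0 ≤ u := by rw [hu]; positivity
  have hu1 : u ≤ 1 := by rw [hu, div_le_one hs0]; exact has
  rw [← hu]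
  have e1 : (1 - ε / 6) * Z ≤ Real.exp Λ * s := by
    have := mul_le_mul_of_nonneg_left hs (Real.exp_pos Λ).le
    have e : Real.exp Λ * ((1 - ε / 6) * Real.exp (-Λ) * Z) =
        (Real.exp Λ * Real.exp (-Λ)) * ((1 - ε / 6) * Z) := by ring
    rw [e, ← Real.exp_add, add_neg_cancel, Real.exp_zero, one_mul] at this
    exact this
  have e2 : Real.exp Λ * g ≤ ε / 2 * Z := by
    calc Real.exp Λ * g ≤ Real.exp B * (ε / (2 * Real.exp B) * Z) := by gcongr
      _ = _ := by field_simp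
  have e3 : 0 ≤ Real.exp Λ * g := by positivity
  have e4 : u * ((1 - ε / 6) * Z) ≤ u * (Real.exp Λ * s) := mul_le_mul_of_nonneg_left e1 hu0
  have e5 : (1 - 2 * (ε / 6)) * Real.exp Λ * (a - g) =
      (1 - 2 * (ε / 6)) * (u * (Real.exp Λ * s)) - (1 - 2 * (ε / 6)) * (Real.exp Λ * g) := by
    rw [hau]; ring
  have e6 : (1 - 2 * (ε / 6)) * (u * ((1 - ε / 6) * Z)) ≤ (1 - 2 * (ε / 6)) * (u * (Real.exp Λ * s)) :=
    mul_le_mul_of_nonneg_left e4 (by linarith)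
  have e7 : (1 - 2 * (ε / 6)) * (Real.exp Λ * g) ≤ ε / 2 * Z := by nlinarith
  have e8 : (u - ε) * Z ≤ p * Z := by
    have : (u - ε / 2) * Z ≤ (1 - 2 * (ε / 6)) * (u * ((1 - ε / 6) * Z)) := by
      have : 0 ≤ (1 - 2 * (ε / 6)) * (u * (1 - ε / 6)) - (u - ε / 2) := by nlinarith [mul_nonneg hu0 hε0.le]
      nlinarith
    nlinarith
  have := le_of_mul_le_mul_right e8 hZ
  linarith

theorem natCast_div_le_add_ofReal {ε Λ B : ℝ} {Z a s g : ℕ} {p : ℝ≥0∞} (hp0 : p ≠ ⊤) (hε0 : 0 < ε)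
    (hε1 : ε ≤ 1) (hΛ : Λ ≤ B) (hZ : (0 : ℝ) < Z) (has : a ≤ s)
    (hs : (1 - ε / 6) * Real.exp (-Λ) * Z ≤ s) (hg : (g : ℝ) ≤ ε / (2 * Real.exp B) * Z)
    (hp : (1 - 2 * (ε / 6)) * Real.exp Λ * ((a : ℝ) - g) ≤ p.toReal * Z) :
    (a : ℝ≥0∞) / s ≤ p + ENNReal.ofReal ε := by
  have hspos : (0 : ℝ) < s :=
    lt_of_lt_of_le (mul_pos (mul_pos (by linarith) (Real.exp_pos _)) hZ) hs
  have h4 := ENNReal.ofReal_le_ofReal (comparison_bound hε0 hε1 hΛ hZ (Nat.cast_nonneg a)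
    (Nat.cast_le.2 has) hs (Nat.cast_nonneg g) hg hp)
  rwa [ENNReal.ofReal_add ENNReal.toReal_nonneg hε0.le, ENNReal.ofReal_toReal hp0,
    ENNReal.ofReal_div_of_pos hspos, ENNReal.ofReal_natCast, ENNReal.ofReal_natCast] at h4

/-- The law of a uniformly random simple graph is dominated by that of the graph obtained by
switchings, up to a small error. -/
theorem uniformGraphMeasure_le (A ε : ℝ) (hA : 0 < A) (hε : 0 < ε) :
    ∃ δ : ℝ, 0 < δ ∧ ∀ {n : ℕ} (d : Fin n → ℕ) (hd : Even (∑ i, d i)) (rule : BadEdgeRule d),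
      0 < ∑ i, d i → (pairCount d : ℝ) ≤ A * (∑ i, d i : ℕ) →
      (maxDegree d : ℝ) ^ 2 ≤ δ * (∑ i, d i : ℕ) →
      (graphsWithDegrees d).Nonempty ∧ ∀ 𝔸 : Set (Multigraph (Fin n)),
        uniformGraphMeasure d {G | simpleToMultigraph G ∈ 𝔸} ≤
          switchingMeasure d hd rule {ω | switchedGraph ω ∈ 𝔸} + ENNReal.ofReal ε := by
  classical
  wlog hε1 : ε ≤ 1 generalizing ε with H
  · obtain ⟨δ, hδ, h⟩ := H 1 one_pos le_rfl
    refine ⟨δ, hδ, fun d hd rule h1 h2 h3 => ⟨(h d hd rule h1 h2 h3).1, fun 𝔸 => ?_⟩⟩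
    refine ((h d hd rule h1 h2 h3).2 𝔸).trans ?_
    gcongr
    exact (not_le.1 hε1).le
  set B : ℝ := A / 2 + A ^ 2 / 4 with hB
  have hε6 : 0 < ε / 6 := by positivity
  obtain ⟨K, hK⟩ := exp_sub_le_sum (B := B) hε6
  -- The length K is fixed before η, since the permitted loss of switchings per vertex must be small
  -- compared with 1/K.
  set η : ℝ := 4 * (ε / 6) / (1 + 4 * K) with hη
  have hη0 : 0 < η := by positivity
  have hηε : η * (1 + 4 * K) / 4 ≤ ε / 6 := by
    rw [hη]
    field_simp
    exact le_rfl
  obtain ⟨δ₁, hδ₁, h₁⟩ := exists_card_simple_ge A (ε / 6) hA hε6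
  obtain ⟨δ₂, hδ₂, h₂⟩ := exists_card_not_hasManyCreatingMoves_le A η (ε / (2 * Real.exp B)) hA hη0
    (by positivity)
  refine ⟨min δ₁ δ₂, by positivity, fun d hd rule hN hQ hΔ => ?_⟩
  have hN' : (0 : ℝ) < (∑ i, d i : ℕ) := by exact_mod_cast hN
  have := Configuration.nonempty_of_even hd
  have hZ : (0 : ℝ) < Fintype.card (Configuration d) := by exact_mod_cast Fintype.card_pos
  have hs := h₁ d hN hQ (hΔ.trans (mul_le_mul_of_nonneg_right (min_le_left _ _) hN'.le))
  have hg := h₂ d hN hQ (hΔ.trans (mul_le_mul_of_nonneg_right (min_le_right _ _) hN'.le))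
  have hBle := badRate_le hN hQ
  have hex : ∃ γ : Configuration d, γ.IsSimple := by
    have : (0 : ℝ) < ((Finset.univ.filter fun γ : Configuration d => γ.IsSimple).card : ℝ) :=
      lt_of_lt_of_le (mul_pos (mul_pos (by linarith) (Real.exp_pos _)) hZ) hs
    obtain ⟨γ, hγ⟩ := Finset.card_pos.1 (Nat.cast_pos.1 this)
    exact ⟨γ, (Finset.mem_filter.1 hγ).2⟩
  refine ⟨?_, fun 𝔸 => ?_⟩
  · obtain ⟨γ, hγ⟩ := hex
    exact ⟨_, hγ.toGraph_mem⟩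
  · have hp := mul_card_sub_card_le_switchingMeasure hd hN rule (symmetric_preimage (d := d) 𝔸)
      hη0.le hε6.le (by linarith) hηε hBle hK
    rw [uniformGraphMeasure_eq 𝔸 hex]
    refine natCast_div_le_add_ofReal (measure_ne_top _ _) hε hε1 hBle hZ ?_ hs hg hp
    exact Finset.card_le_card (Finset.monotone_filter_right _ fun γ _ hγ => hγ.2)

end Comparison

/-! ### From the degree asymptotics to convergence in distribution -/

/-- The conditions on the degrees that are used in the comparison of the random graphs. -/
theorem eventually_degree_conditions (d : (n : ℕ) → Fin n → ℕ)
    (hsum : (fun n : ℕ => (n : ℝ)) =O[atTop] fun n : ℕ => ((∑ i, d n i : ℕ) : ℝ))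
    (hsq : (fun n : ℕ => ((∑ i, d n i ^ 2 : ℕ) : ℝ)) =O[atTop] fun n : ℕ => (n : ℝ))
    (hmax : (fun n : ℕ => ((Finset.univ.sup (d n) : ℕ) : ℝ)) =o[atTop]
      fun n : ℕ => Real.sqrt (n : ℝ)) :
    ∃ A : ℝ, 0 < A ∧ ∀ δ : ℝ, 0 < δ → ∀ᶠ n in atTop, 0 < ∑ i, d n i ∧
      (pairCount (d n) : ℝ) ≤ A * (∑ i, d n i : ℕ) ∧
      (maxDegree (d n) : ℝ) ^ 2 ≤ δ * (∑ i, d n i : ℕ) := by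
  obtain ⟨c, hc, h1⟩ := hsum.exists_pos
  obtain ⟨C, hC, h2⟩ := hsq.exists_pos
  -- From ∑ d_i² ≤ Cn and n ≤ cN one gets Q ≤ CcN. Likewise Δ ≤ √(δ/c) √n yields Δ² ≤ δN.
  refine ⟨C * c, by positivity, fun δ hδ => ?_⟩
  filter_upwards [h1.bound, h2.bound, hmax.bound (Real.sqrt_pos.2 (div_pos hδ hc)),
    eventually_ge_atTop 1] with n g1 g2 g3 g4
  rw [Real.norm_of_nonneg (Nat.cast_nonneg _), Real.norm_of_nonneg (Nat.cast_nonneg _)] at g1 g2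
  rw [Real.norm_of_nonneg (Nat.cast_nonneg _), Real.norm_of_nonneg (Real.sqrt_nonneg _)] at g3
  refine ⟨?_, ?_, ?_⟩
  · by_contra h0
    rw [not_lt, Nat.le_zero] at h0
    rw [h0, Nat.cast_zero, mul_zero] at g1
    have : (1 : ℝ) ≤ n := Nat.one_le_cast.2 g4
    linarith
  · have : pairCount (d n) ≤ ∑ i, d n i ^ 2 := by
      refine Finset.sum_le_sum fun i _ => ?_
      rw [sq]
      exact Nat.mul_le_mul_left _ (Nat.sub_le _ _)
    calc (pairCount (d n) : ℝ) ≤ (∑ i, d n i ^ 2 : ℕ) := Nat.cast_le.2 this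
      _ ≤ C * n := g2
      _ ≤ C * (c * (∑ i, d n i : ℕ)) := by gcongr
      _ = _ := by ring
  · calc (maxDegree (d n) : ℝ) ^ 2 ≤ (Real.sqrt (δ / c) * Real.sqrt n) ^ 2 := by
          refine pow_le_pow_left₀ (Nat.cast_nonneg _) g3 2
      _ = δ / c * n := by
          rw [mul_pow, Real.sq_sqrt (by positivity), Real.sq_sqrt (by positivity)]
      _ ≤ δ / c * (c * (∑ i, d n i : ℕ)) := by gcongr
      _ = _ := by field_simp

theorem corollary2
    (d : (n : ℕ) → Fin n → ℕ)
    (hd : ∀ n, Even (∑ i, d n i))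
    (hsum : (fun n : ℕ => ((∑ i, d n i : ℕ) : ℝ)) =Θ[atTop] fun n : ℕ => (n : ℝ))
    (hsq : (fun n : ℕ => ((∑ i, d n i ^ 2 : ℕ) : ℝ)) =O[atTop] fun n : ℕ => (n : ℝ))
    (hmax : (fun n : ℕ => ((Finset.univ.sup (d n) : ℕ) : ℝ)) =o[atTop]
      fun n : ℕ => Real.sqrt (n : ℝ))
    (rule : (n : ℕ) → BadEdgeRule (d n))
    (f : (n : ℕ) → Multigraph (Fin n) → ℝ)
    (hdiff : ∀ ε : ℝ, 0 < ε → Tendsto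
      (fun n : ℕ => switchingMeasure (d n) (hd n) (rule n)
        {ω | ε ≤ |f n (switchedGraph ω) - f n (configurationMultigraph ω)|})
      atTop (𝓝 0))
    {Ω : Type*} [MeasurableSpace Ω] (P : Measure Ω) [IsProbabilityMeasure P] (Y : Ω → ℝ)
    (hY : TendstoInDistribution
      (fun (n : ℕ) (ω : SwitchingSpace (d n)) => f n (configurationMultigraph ω))
      atTop Y (fun n => switchingMeasure (d n) (hd n) (rule n)) P) :
    (∀ᶠ n in atTop, (graphsWithDegrees (d n)).Nonempty) ∧
      TendstoInDistribution
        (fun (n : ℕ) (G : SimpleGraph (Fin n)) => f n (simpleToMultigraph G))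
        atTop Y (fun n => uniformGraphMeasure (d n)) P := by
  obtain ⟨A, hA, hcond⟩ := eventually_degree_conditions d hsum.2 hsq hmax
  have hcomp : ∀ ε : ℝ, 0 < ε → ∀ᶠ n in atTop, (graphsWithDegrees (d n)).Nonempty ∧
      ∀ 𝔸 : Set (Multigraph (Fin n)), uniformGraphMeasure (d n) {G | simpleToMultigraph G ∈ 𝔸} ≤
        switchingMeasure (d n) (hd n) (rule n) {ω | switchedGraph ω ∈ 𝔸} + ENNReal.ofReal ε := by
    intro ε hε
    obtain ⟨δ, hδ, h⟩ := uniformGraphMeasure_le A ε hA hε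
    filter_upwards [hcond δ hδ] with n hn
    exact h (d n) (hd n) (rule n) hn.1 hn.2.1 hn.2.2
  refine ⟨(hcomp 1 one_pos).mono fun n hn => hn.1, ?_⟩
  have hmeas : ∀ n, Measurable fun G : SimpleGraph (Fin n) => f n (simpleToMultigraph G) :=
    fun n => Measurable.of_discrete
  refine ⟨fun n => (hmeas n).aemeasurable, hY.aemeasurable_limit, ?_⟩
  -- The portmanteau criterion for closed sets needs upper bounds only, so the one-sided domination
  -- is sufficient.
  refine tendsto_of_forall_isClosed_limsup_le' fun F hF => ?_
  set ν := P.map Y with hν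
  have : IsProbabilityMeasure ν := Measure.isProbabilityMeasure_map hY.aemeasurable_limit
  -- If f(Ĝ) ∈ F, then f(G*) lies in the δ-thickening of F unless the two values differ by at least
  -- δ, which has vanishing probability.
  have hbound : ∀ δ : ℝ, 0 < δ → limsup (fun n => uniformGraphMeasure (d n)
      {G | f n (simpleToMultigraph G) ∈ F}) atTop ≤ ν (Metric.cthickening δ F) := by
    intro δ hδ
    refine ENNReal.le_of_forall_pos_le_add fun ε hε _ => ?_
    have h1 : ∀ᶠ n in atTop, uniformGraphMeasure (d n) {G | f n (simpleToMultigraph G) ∈ F} ≤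
        (switchingMeasure (d n) (hd n) (rule n)).map (fun ω => f n (configurationMultigraph ω))
          (Metric.cthickening δ F) + switchingMeasure (d n) (hd n) (rule n)
            {ω | δ ≤ |f n (switchedGraph ω) - f n (configurationMultigraph ω)|} + ε := by
      filter_upwards [hcomp ε hε] with n hn
      refine (hn.2 (f n ⁻¹' F)).trans ?_
      rw [ENNReal.ofReal_coe_nnreal]
      refine add_le_add_left ?_ _
      rw [Measure.map_apply_of_aemeasurable (hY.forall_aemeasurable n)
        Metric.isClosed_cthickening.measurableSet]
      refine (measure_mono fun ω hω => ?_).trans (measure_union_le _ _)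
      rw [Set.mem_union]
      by_cases hlt : δ ≤ |f n (switchedGraph ω) - f n (configurationMultigraph ω)|
      · exact Or.inr hlt
      · left
        refine Metric.mem_cthickening_of_dist_le _ (f n (switchedGraph ω)) _ _ hω ?_
        rw [dist_comm, Real.dist_eq]
        exact (not_le.1 hlt).le
    refine (limsup_le_limsup h1).trans ?_
    rw [limsup_add_const _ _ _ (by isBoundedDefault) (by isBoundedDefault)]
    refine add_le_add_left ?_ _
    refine (ENNReal.limsup_add_of_right_tendsto_zero (hdiff δ hδ) _).trans_le ?_
    exact ProbabilityMeasure.limsup_measure_closed_le_of_tendsto hY.tendsto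
      Metric.isClosed_cthickening
  -- The thickenings decrease to the closed set F, which removes δ.
  have hlim : Tendsto (fun δ => ν (Metric.cthickening δ F)) (𝓝[>] 0) (𝓝 (ν F)) :=
    (tendsto_measure_cthickening_of_isClosed ⟨1, one_pos, measure_ne_top _ _⟩ hF).mono_left
      nhdsWithin_le_nhds
  have key := ge_of_tendsto hlim (eventually_nhdsWithin_of_forall fun δ hδ => hbound δ hδ)
  refine le_trans (le_of_eq ?_) key
  refine congrArg (fun u => limsup u atTop) (funext fun n => ?_)
  exact Measure.map_apply (hmeas n) hF.measurableSet
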